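/- Let $X$ be a connected complex projective manifold of dimension $n$, let $D\subset X$ be a smooth reduced effective divisor, and let $E_*$ be a parabolic vector bundle on $X$ with parabolic divisor $D$: a holomorphic vector bundle $E$ of rank $r$ together with a flag of holomorphic subbundles of $E|_D$ with increasing rational weights in $(0,1)$; a local holomorphic frame $e_1,\dots,e_r$ of $E$ is adapted, with weights $\alpha_1\le\dots\le\alpha_r$, if each step of the flag is spanned along $D$ by the $e_j$ whose weight is at least the smallest weight of that step. A Kawamata cover of $(X,E_*,D)$ is a triple $(Y,q,V)$, where $Y$ is a connected compact complex manifold with a faithful action of a finite group $\Gamma$ by biholomorphisms, $q:Y\to X$ is a holomorphic map identifying $X$ with $Y/\Gamma$ whose set $D''\supseteq D$ of critical values is a simple normal crossing divisor, and $V$ is a $\Gamma$-equivariant holomorphic vector bundle on $Y$ whose invariant direct image is $E_*$: there is an equivariant holomorphic isomorphism $q^*E\cong V$ off $q^{-1}(D)$ and, near each point of $q^{-1}(D)$, there are an adapted frame $e_j$ of $E_*$ with weights $\alpha_j$, a holomorphic frame $\tilde e_j$ of $V$, a local equation $z$ of $D$ and a local equation $w$ of $q^{-1}(D)_{\rm red}$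 with $z\circ q=w^N$ and $e_j=w^{N\alpha_j}\tilde e_j$. It is locally good around $p\in X$ if $D''\cap U_p=D\cap U_p$ for some Zariski open neighbourhood $U_p$ of $p$. A $C^\infty$ Hermitian metric $H$ on $E|_{X\setminus D}$ is admissible if it extends to a smooth Hermitian structure on the ramified principal bundle of $E_*$, that is: each point of $D$ has a neighbourhood with holomorphic coordinates $z_1,\dots,z_n$ in which $D=\{z_1=0\}$ and with an adapted frame $e_j$ with weights $\alpha_j$, such that, with $N$ the least common denominator of the $\alpha_j$, the Gram matrix of $H$ in the frame $w_1^{-N\alpha_j}e_j$, as a function of $(w_1,z_2,\dots,z_n)$ with $w_1^N=z_1$, extends smoothly and positive definitely across $w_1=0$. Let $\Phi$ be a polynomial on complex $r\times r$ matrices with $\Phi(gAg^{-1})=\Phi(A)$ for all invertible $g$, and let $k\ge0$. All forms below are the components of degree $2k$. For an admissible metric $H$, a parabolic Chern–Weil form $\Phi_{par}(\Theta_H)$ is defined by choosing, for every $p\in X$, a Kawamata cover $(Y_p,q_p,V_p)$ that is locally good around $p$, with neighbourhood $U_p$; at $p\in X\setminus D$ it is the form whose pullback under $q_p$ at the points over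 $p$ is the Chern–Weil form $\Phi(\Theta_{\widetilde H_p})$, where $\widetilde H_p$ is the smooth invariant metric on $V_p|_{q_p^{-1}(U_p)}$ that descends to $H$ and $\Theta_{\widetilde H_p}$ is its Chern curvature. Then the following hold. 1. Let $H$ be admissible. There is one form $\eta$ of degree $2k$, smooth on $X\setminus D$, such that for every $p\in X$ and every Kawamata cover $(Y,q,V)$ that is locally good around $p$, with neighbourhood $U$, the metric $H$ lifts to a smooth invariant metric $\widetilde H$ on $V|_{q^{-1}(U)}$ and $q^*\eta=\Phi(\Theta_{\widetilde H})$ on $q^{-1}(U\setminus D)$. Every parabolic Chern–Weil form $\Phi_{par}(\Theta_H)$ defines a closed current $f\mapsto\int_X f\wedge\Phi_{par}(\Theta_H)$ on $X$ (with absolutely convergent integrals). Any two choices of locally good Kawamata covers give the same form on $X\setminus D$ and the same current on $X$. 2. If $H_1,H_2$ are admissible metrics on $E_*$, then for any choices of locally good Kawamata covers the currents $\Phi_{par}(\Theta_{H_1})$ and $\Phi_{par}(\Theta_{H_2})$ are cohomologous: their difference is $dS$ for a current $S$ on $X$. -/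

import Mathlib

open scoped Manifold ContDiff Topology LinearAlgebra.Projectivization

universe u v v' w

noncomputable section

namespace ParChernWeil

/-! ## Complex manifolds: projectivity, Zariski topology, divisors

A complex manifold of dimension `n` is a space charted on `ℂⁿ = Fin n → ℂ` whose transition maps are
holomorphic, that is, of class `C^ω` over `ℂ`. The same charts are used for its underlying real
smooth structure (model `𝓘(ℝ, Fin n → ℂ)`). -/

section Manifolds

variable {n : ℕ} {X : Type u} [TopologicalSpace X] [ChartedSpace (Fin n → ℂ) X]

/-- `ι : X → ℙ^N` is a holomorphic injective immersion (a holomorphic embedding if `X` is compact):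
locally it lifts to a holomorphic map `f` to `ℂ^(N+1) \ {0}` whose differential is injective modulo
the line spanned by `f x`. -/
def IsProjectiveEmbedding (n : ℕ) {X : Type u} [TopologicalSpace X] [ChartedSpace (Fin n → ℂ) X]
    {N : ℕ} (ι : X → ℙ ℂ (Fin (N + 1) → ℂ)) : Prop :=
  Function.Injective ι ∧
  ∀ x : X, ∃ (U : Set X) (f : X → Fin (N + 1) → ℂ), IsOpen U ∧ x ∈ U ∧
    ContMDiffOn 𝓘(ℂ, Fin n → ℂ) 𝓘(ℂ, Fin (N + 1) → ℂ) ω f U ∧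
    (∀ x' ∈ U, ∃ h : f x' ≠ 0, ι x' = Projectivization.mk ℂ (f x') h) ∧
    ∀ t : TangentSpace 𝓘(ℂ, Fin n → ℂ) x,
      (mfderiv 𝓘(ℂ, Fin n → ℂ) 𝓘(ℂ, Fin (N + 1) → ℂ) f x t : Fin (N + 1) → ℂ) ∈
        Submodule.span ℂ {f x} → t = 0

/-- `X` embeds holomorphically into some complex projective space. -/
def IsProjectiveManifold (n : ℕ) (X : Type u) [TopologicalSpace X]
    [ChartedSpace (Fin n → ℂ) X] : Prop :=
  ∃ (N : ℕ) (ι : X → ℙ ℂ (Fin (N + 1) → ℂ)), IsProjectiveEmbedding n ι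

/-- Zariski open subsets of a projective manifold: complements of the common zero sets of
homogeneous polynomials in a projective embedding. -/
def IsZariskiOpen (n : ℕ) {X : Type u} [TopologicalSpace X] [ChartedSpace (Fin n → ℂ) X]
    (U : Set X) : Prop :=
  ∃ (N : ℕ) (ι : X → ℙ ℂ (Fin (N + 1) → ℂ)) (S : Set (MvPolynomial (Fin (N + 1)) ℂ)),
    IsProjectiveEmbedding n ι ∧ (∀ Q ∈ S, ∃ d, Q.IsHomogeneous d) ∧
    U = {x | ∃ Q ∈ S, MvPolynomial.eval (ι x).rep Q ≠ 0}

/-- `z` is a holomorphic chart of `X` in which `D` is the coordinate hyperplane `z_i = 0`. -/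
def IsDivisorChart (D : Set X) (z : OpenPartialHomeomorph X (Fin n → ℂ)) (i : Fin n) : Prop :=
  z ∈ IsManifold.maximalAtlas 𝓘(ℂ, Fin n → ℂ) ω X ∧ ∀ x ∈ z.source, x ∈ D ↔ z x i = 0

/-- (The support of) a smooth reduced effective divisor: a closed complex submanifold of
codimension one. -/
def IsSmoothDivisor (n : ℕ) {X : Type u} [TopologicalSpace X] [ChartedSpace (Fin n → ℂ) X]
    (D : Set X) : Prop :=
  IsClosed D ∧ ∀ p ∈ D, ∃ (z : OpenPartialHomeomorph X (Fin n → ℂ)) (i : Fin n),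
    p ∈ z.source ∧ IsDivisorChart D z i

/-- (The support of) a reduced simple normal crossing divisor: a finite union of closed connected
smooth hypersurfaces `C i` that, near each point, are distinct coordinate hyperplanes of one
holomorphic chart. -/
def IsSNCDivisor (n : ℕ) {X : Type u} [TopologicalSpace X] [ChartedSpace (Fin n → ℂ) X]
    (B : Set X) : Prop :=
  ∃ (μ : ℕ) (C : Fin μ → Set X), B = ⋃ i, C i ∧ (∀ i, IsClosed (C i) ∧ IsConnected (C i)) ∧
    ∀ p : X, ∃ (z : OpenPartialHomeomorph X (Fin n → ℂ)) (c : Fin μ → Fin n), p ∈ z.source ∧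
      Set.InjOn c {i | p ∈ C i} ∧ ∀ i, p ∈ C i → IsDivisorChart (C i) z (c i)

end Manifolds

/-! ## Differential forms, currents, cohomology of currents -/

section Forms

/-- Complex-valued differential forms of degree `m` (no regularity) on the real manifold
underlying `X`. -/
abbrev DForm (n m : ℕ) (X : Type u) [TopologicalSpace X] [ChartedSpace (Fin n → ℂ) X] : Type u :=
  ∀ x : X, TangentSpace 𝓘(ℝ, Fin n → ℂ) x [⋀^Fin m]→L[ℝ] ℂ

variable {n m a b : ℕ} {X : Type u} [TopologicalSpace X] [ChartedSpace (Fin n → ℂ) X]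

/-- The expression `(φ⁻¹)^* f` of the form `f` in the chart `φ`. -/
def localRep (φ : OpenPartialHomeomorph X (Fin n → ℂ)) (f : DForm n m X) (t : Fin n → ℂ) :
    (Fin n → ℂ) [⋀^Fin m]→L[ℝ] ℂ :=
  (f (φ.symm t)).compContinuousLinearMap
    (mfderiv 𝓘(ℝ, Fin n → ℂ) 𝓘(ℝ, Fin n → ℂ) φ.symm t)

/-- `f` is a `C^∞` form on the open set `W`. -/
def IsSmoothFormOn (f : DForm n m X) (W : Set X) : Prop :=
  ∀ φ ∈ atlas (Fin n → ℂ) X, ContDiffOn ℝ ∞ (localRep φ f) (φ.target ∩ φ.symm ⁻¹' W)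

/-- `f` is a `C^∞` form on `X`. -/
def IsSmoothForm (f : DForm n m X) : Prop := IsSmoothFormOn f Set.univ

/-- The exterior derivative, computed at `x` in the preferred chart at `x`. -/
def extD (f : DForm n m X) : DForm n (m + 1) X := fun x =>
  (extDeriv (localRep (chartAt (Fin n → ℂ) x) f) (chartAt (Fin n → ℂ) x x)).compContinuousLinearMap
    (mfderiv 𝓘(ℝ, Fin n → ℂ) 𝓘(ℝ, Fin n → ℂ) (chartAt (Fin n → ℂ) x) x)

/-- Convergence to `0` in the `C^∞` topology of forms on a compact manifold: all derivatives in all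
charts converge to `0` uniformly on compact sets. -/
def TendstoZeroSmooth (f : ℕ → DForm n m X) : Prop :=
  ∀ φ ∈ atlas (Fin n → ℂ) X, ∀ K : Set (Fin n → ℂ), IsCompact K → K ⊆ φ.target → ∀ l : ℕ,
    TendstoUniformlyOn (fun j t => iteratedFDeriv ℝ l (localRep φ (f j)) t) 0 Filter.atTop K

/-- Currents of dimension `a` (degree `2n - a`) on the compact complex manifold `X` of dimension
`n`: continuous linear functionals on the Fréchet space of smooth complex `a`-forms. The values of
`toFun` at forms that are not smooth are irrelevant. -/
structure Current (n a : ℕ) (X : Type u) [TopologicalSpace X] [ChartedSpace (Fin n → ℂ) X] where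
  toFun : DForm n a X → ℂ
  map_add : ∀ f g, IsSmoothForm f → IsSmoothForm g → toFun (f + g) = toFun f + toFun g
  map_smul : ∀ (s : ℂ) f, IsSmoothForm f → toFun (s • f) = s * toFun f
  cont : ∀ f : ℕ → DForm n a X, (∀ j, IsSmoothForm (f j)) → TendstoZeroSmooth f →
    Filter.Tendsto (fun j => toFun (f j)) Filter.atTop (𝓝 0)

/-- The `i`-th vector of the real basis `(e₀, √-1 e₀, e₁, √-1 e₁, …)` of `ℂⁿ`. It is positively
oriented and unimodular for Lebesgue measure. -/
def realBasis (n i : ℕ) : Fin n → ℂ := fun j =>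
  if i = 2 * (j : ℕ) then 1 else if i = 2 * (j : ℕ) + 1 then Complex.I else 0

/-- The value `(f ∧ g)(v₀, …, v_{a+b-1})` of the wedge product. -/
def wedgeEval (f : (Fin n → ℂ) [⋀^Fin a]→L[ℝ] ℂ) (g : (Fin n → ℂ) [⋀^Fin b]→L[ℝ] ℂ)
    (t : ℕ → Fin n → ℂ) : ℂ :=
  (1 / ((a.factorial : ℂ) * (b.factorial : ℂ))) *
    ∑ σ : Equiv.Perm (Fin (a + b)), ((Equiv.Perm.sign σ : ℤ) : ℂ) *
      (f fun i => t (σ (Fin.castAdd b i))) * (g fun j => t (σ (Fin.natAdd a j)))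

/-- The coefficient of `f ∧ g` with respect to Lebesgue measure in the chart `φ`
(when `a + b = 2n`). -/
def wedgeDensity (φ : OpenPartialHomeomorph X (Fin n → ℂ)) (f : DForm n a X) (g : DForm n b X)
    (t : Fin n → ℂ) : ℂ :=
  wedgeEval (localRep φ f t) (localRep φ g t) (realBasis n)

/-- The current `T` is the one defined by the locally integrable form `η`, i.e.
`T f = ∫_X f ∧ η` with an absolutely convergent integral: by a partition of unity it is enough to
require this for smooth `f` supported in a coordinate chart. -/
def Current.IsRepresentedBy (T : Current n a X) (η : DForm n b X) : Prop :=
  a + b = 2 * n ∧ ∀ φ ∈ atlas (Fin n → ℂ) X, ∀ f : DForm n a X, IsSmoothForm f →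
    closure {x | f x ≠ 0} ⊆ φ.source →
    MeasureTheory.IntegrableOn (wedgeDensity φ f η) φ.target ∧
    T.toFun f = ∫ t in φ.target, wedgeDensity φ f η t

/-- `dT = 0`, i.e. `T` vanishes on exact smooth forms. -/
def Current.IsClosed : {a : ℕ} → Current n a X → Prop
  | 0, _ => True
  | _ + 1, T => ∀ f, IsSmoothForm f → T.toFun (extD f) = 0

/-- `T₁ - T₂ = dS` for a current `S`: the two currents have the same de Rham cohomology class.
The sign is the one for which `d` extends the exterior derivative of forms when a form `η` defines
the current `f ↦ ∫ f ∧ η`. -/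
def Current.Cohomologous (T₁ T₂ : Current n a X) : Prop :=
  ∃ S : Current n (a + 1) X, ∀ f, IsSmoothForm f →
    T₁.toFun f - T₂.toFun f = (-1) ^ (a + 1) * S.toFun (extD f)

end Forms

/-! ## Holomorphic vector bundles and Hermitian metrics -/

section Bundles

/-- Holomorphic vector bundles of rank `r` on `X`. -/
structure HolBundle (n r : ℕ) (X : Type u) [TopologicalSpace X]
    [ChartedSpace (Fin n → ℂ) X] where
  Fib : X → Type w
  [instAddCommGroup : ∀ x, AddCommGroup (Fib x)]
  [instModule : ∀ x, Module ℂ (Fib x)]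
  [instTopFib : ∀ x, TopologicalSpace (Fib x)]
  [instTopTotal : TopologicalSpace (Bundle.TotalSpace (Fin r → ℂ) Fib)]
  [instFiberBundle : FiberBundle (Fin r → ℂ) Fib]
  [instVectorBundle : VectorBundle ℂ (Fin r → ℂ) Fib]
  [instHolomorphic : ContMDiffVectorBundle ω (Fin r → ℂ) Fib 𝓘(ℂ, Fin n → ℂ)]

attribute [instance] HolBundle.instAddCommGroup HolBundle.instModule HolBundle.instTopFib
  HolBundle.instTopTotal HolBundle.instFiberBundle HolBundle.instVectorBundle
  HolBundle.instHolomorphic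

variable {n r : ℕ} {X : Type u} [TopologicalSpace X] [ChartedSpace (Fin n → ℂ) X]

/-- `s` is a holomorphic section of `E` on `U`. -/
def HolBundle.IsHolSection (E : HolBundle.{u, w} n r X) (s : ∀ x, E.Fib x) (U : Set X) : Prop :=
  ContMDiffOn 𝓘(ℂ, Fin n → ℂ) (𝓘(ℂ, Fin n → ℂ).prod 𝓘(ℂ, Fin r → ℂ)) ω
    (fun x => Bundle.TotalSpace.mk' (Fin r → ℂ) x (s x)) U

/-- `e` is a holomorphic frame of `E` on `U`. -/
def HolBundle.IsHolFrame (E : HolBundle.{u, w} n r X) (e : Fin r → ∀ x, E.Fib x) (U : Set X) :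
    Prop :=
  IsLocalFrameOn 𝓘(ℂ, Fin n → ℂ) (Fin r → ℂ) ω e U

/-- Families of sesquilinear forms on the fibres of `E`, conjugate linear in the first variable. -/
abbrev HolBundle.Sesq (E : HolBundle.{u, w} n r X) : Type _ :=
  ∀ x, E.Fib x →ₗ⋆[ℂ] E.Fib x →ₗ[ℂ] ℂ

/-- `H` restricts to a `C^∞` Hermitian metric of `E` over the open set `W`. -/
def HolBundle.IsHermitianMetricOn (E : HolBundle.{u, w} n r X) (H : E.Sesq) (W : Set X) : Prop :=
  (∀ x ∈ W, ∀ s t, H x s t = star (H x t s)) ∧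
  (∀ x ∈ W, ∀ s, s ≠ 0 → 0 < (H x s s).re) ∧
  ∀ (U : Set X) (e : Fin r → ∀ x, E.Fib x), IsOpen U → E.IsHolFrame e U → ∀ i j,
    ContMDiffOn 𝓘(ℝ, Fin n → ℂ) 𝓘(ℝ, ℂ) ∞ (fun x => H x (e i x) (e j x)) (U ∩ W)

end Bundles

/-! ## Chern–Weil forms -/

section ChernWeil

/-- `∂f` of a complex function `f` on `ℂⁿ`, at the point `t` in direction `ξ`. -/
def del {n : ℕ} (f : (Fin n → ℂ) → ℂ) (t ξ : Fin n → ℂ) : ℂ :=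
  (1 / 2) * (fderiv ℝ f t ξ - Complex.I * fderiv ℝ f t (Complex.I • ξ))

/-- `∂̄f` of a complex function `f` on `ℂⁿ`, at the point `t` in direction `ξ`. -/
def delbar {n : ℕ} (f : (Fin n → ℂ) → ℂ) (t ξ : Fin n → ℂ) : ℂ :=
  (1 / 2) * (fderiv ℝ f t ξ + Complex.I * fderiv ℝ f t (Complex.I • ξ))

/-- The matrix `h⁻¹ ∂h` of `(1,0)`-forms of the Chern connection, `h i j = ⟨e_i, e_j⟩` being the
Gram matrix (conjugate linear in the first slot) of a holomorphic frame `e`. -/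
def connMatrix {n r : ℕ} (h : (Fin n → ℂ) → Matrix (Fin r) (Fin r) ℂ) (t ξ : Fin n → ℂ) :
    Matrix (Fin r) (Fin r) ℂ :=
  (h t)⁻¹ * Matrix.of fun i j => del (fun t' => h t' i j) t ξ

/-- The matrix `Θ = ∂̄(h⁻¹ ∂h)` of `(1,1)`-forms, the curvature of the Chern connection. -/
def curvMatrix {n r : ℕ} (h : (Fin n → ℂ) → Matrix (Fin r) (Fin r) ℂ) (t ξ ζ : Fin n → ℂ) :
    Matrix (Fin r) (Fin r) ℂ :=
  Matrix.of fun i j =>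
    delbar (fun t' => connMatrix h t' ζ i j) t ξ - delbar (fun t' => connMatrix h t' ξ i j) t ζ

/-- The value of a polynomial in the entries of `r × r` matrices. -/
def matEval {r : ℕ} (Φ : MvPolynomial (Fin r × Fin r) ℂ) (A : Matrix (Fin r) (Fin r) ℂ) : ℂ :=
  MvPolynomial.eval (fun ij => A ij.1 ij.2) Φ

/-- Invariant polynomials on matrices: `Φ(g A g⁻¹) = Φ(A)`. -/
def IsInvariantPolynomial {r : ℕ} (Φ : MvPolynomial (Fin r × Fin r) ℂ) : Prop :=
  ∀ (g : GL (Fin r) ℂ) (A : Matrix (Fin r) (Fin r) ℂ),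
    matEval Φ ((g : Matrix (Fin r) (Fin r) ℂ) * A *
      ((g⁻¹ : GL (Fin r) ℂ) : Matrix (Fin r) (Fin r) ℂ)) = matEval Φ A

/-- The complete polarization `Φ_k(A₀, …, A_{k-1})` of the homogeneous part `Φ_k` of degree `k` of
`Φ`: the symmetric multilinear form with `Φ_k(A, …, A) = Φ_k(A)`. -/
def polarization {r : ℕ} (Φ : MvPolynomial (Fin r × Fin r) ℂ) (k : ℕ)
    (A : Fin k → Matrix (Fin r) (Fin r) ℂ) : ℂ :=
  (1 / (k.factorial : ℂ)) * ∑ S : Finset (Fin k), (-1) ^ (k - S.card) *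
    matEval (MvPolynomial.homogeneousComponent k Φ) (∑ i ∈ S, A i)

/-- The value at `(v₀, …, v_{2k-1})` of the component of degree `2k` of `Φ(Θ)`, for a matrix `Θ` of
2-forms: a monomial in the entries is the wedge product of the corresponding 2-forms. -/
def polyOfTwoForms {n r : ℕ} (Φ : MvPolynomial (Fin r × Fin r) ℂ) (k : ℕ)
    (Θ : (Fin n → ℂ) → (Fin n → ℂ) → Matrix (Fin r) (Fin r) ℂ)
    (t : Fin (2 * k) → Fin n → ℂ) : ℂ :=
  (1 / (2 : ℂ) ^ k) * ∑ σ : Equiv.Perm (Fin (2 * k)), ((Equiv.Perm.sign σ : ℤ) : ℂ) *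
    polarization Φ k fun i =>
      Θ (t (σ ⟨2 * i, by omega⟩)) (t (σ ⟨2 * i + 1, by omega⟩))

variable {n r : ℕ} {X : Type u} [TopologicalSpace X] [ChartedSpace (Fin n → ℂ) X]

/-- The Gram matrix of `H` in the holomorphic frame of `E` given by the preferred trivialization at
`x`, expressed in the preferred chart at `x`. -/
def HolBundle.gram (E : HolBundle.{u, w} n r X) (H : E.Sesq) (x : X) (t : Fin n → ℂ) :
    Matrix (Fin r) (Fin r) ℂ :=
  Matrix.of fun i j =>
    H ((chartAt (Fin n → ℂ) x).symm t)
      ((trivializationAt (Fin r → ℂ) E.Fib x).localFrame (Pi.basisFun ℂ (Fin r)) i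
        ((chartAt (Fin n → ℂ) x).symm t))
      ((trivializationAt (Fin r → ℂ) E.Fib x).localFrame (Pi.basisFun ℂ (Fin r)) j
        ((chartAt (Fin n → ℂ) x).symm t))

/-- The value at tangent vectors `v₀, …, v_{2k-1}` at `x` of the component of degree `2k` of the
Chern–Weil form `Φ(Θ_H)` of a metric `H` that is smooth near `x`. -/
def HolBundle.chernWeil (E : HolBundle.{u, w} n r X) (H : E.Sesq)
    (Φ : MvPolynomial (Fin r × Fin r) ℂ) (k : ℕ) (x : X)
    (t : Fin (2 * k) → TangentSpace 𝓘(ℝ, Fin n → ℂ) x) : ℂ :=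
  polyOfTwoForms Φ k (curvMatrix (E.gram H x) (chartAt (Fin n → ℂ) x x)) fun i =>
    (mfderiv 𝓘(ℝ, Fin n → ℂ) 𝓘(ℝ, Fin n → ℂ) (chartAt (Fin n → ℂ) x) x (t i) : Fin n → ℂ)

end ChernWeil

/-! ## Parabolic bundles, Kawamata covers, admissible metrics -/

section Parabolic

open scoped ComplexOrder

variable {n r : ℕ} {X : Type u} [TopologicalSpace X] [ChartedSpace (Fin n → ℂ) X]

/-- `e` is an adapted frame, with (increasing) weights `α` in `(0,1)`, on the open set `U` for the
filtrations `F_x^t` of the fibres over `D`: at `x ∈ D` the step `F_x^t` is spanned by the `e_j(x)`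
with `α_j ≥ t`. -/
def IsAdaptedFrame (E : HolBundle.{u, w} n r X) (D : Set X)
    (filt : ∀ x, ℝ → Submodule ℂ (E.Fib x)) (U : Set X) (e : Fin r → ∀ x, E.Fib x)
    (α : Fin r → ℚ) : Prop :=
  IsOpen U ∧ E.IsHolFrame e U ∧ Monotone α ∧ (∀ j, 0 < α j ∧ α j < 1) ∧
  ∀ x ∈ D ∩ U, ∀ t : ℝ, filt x t = Submodule.span ℂ {s | ∃ j, t ≤ (α j : ℝ) ∧ s = e j x}

/-- A parabolic structure on `E` over the smooth divisor `D`: a flag of holomorphic subbundles of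
`E|_D` with rational weights in `(0,1)` that increase along the flag. It is recorded as the
decreasing family `F^t ⊆ E|_D`, `t ∈ ℝ`, where `F^t` is the largest step of the flag all of whose
weights are `≥ t`; that the steps are holomorphic subbundles and that the weights are locally
constant on `D` is the existence of local adapted frames. The values `filt x t` for `x ∉ D` are
irrelevant. -/
structure ParabolicStructure (E : HolBundle.{u, w} n r X) (D : Set X) where
  filt : ∀ x, ℝ → Submodule ℂ (E.Fib x)
  exists_adapted : ∀ p ∈ D, ∃ (U : Set X) (e : Fin r → ∀ x, E.Fib x) (α : Fin r → ℚ),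
    p ∈ U ∧ IsAdaptedFrame E D filt U e α

/-- Kawamata covers `(Y, q, V)` of `(X, E_*, D)`, with covering group `Γ = Gal(q)`. -/
structure KawamataCover {E : HolBundle.{u, w} n r X} {D : Set X} (P : ParabolicStructure E D) where
  Y : Type v
  [instTop : TopologicalSpace Y]
  [instT2 : T2Space Y]
  [instCompact : CompactSpace Y]
  [instConnected : ConnectedSpace Y]
  [instCharted : ChartedSpace (Fin n → ℂ) Y]
  [instManifold : IsManifold 𝓘(ℂ, Fin n → ℂ) ω Y]
  /-- the covering group, acting faithfully on `Y` by biholomorphisms -/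
  Γ : Type
  [instGroup : Group Γ]
  [instFinite : Finite Γ]
  [instMulAction : MulAction Γ Y]
  [instFaithful : FaithfulSMul Γ Y]
  smul_hol : ∀ g : Γ, ContMDiff 𝓘(ℂ, Fin n → ℂ) 𝓘(ℂ, Fin n → ℂ) ω fun y : Y => g • y
  /-- the covering map, a holomorphic map identifying `X` with `Y / Γ` -/
  q : Y → X
  q_hol : ContMDiff 𝓘(ℂ, Fin n → ℂ) 𝓘(ℂ, Fin n → ℂ) ω q
  q_surj : Function.Surjective q
  q_fibre : ∀ y y', q y = q y' ↔ ∃ g : Γ, g • y = y'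
  /-- the set `D'' ⊆ X` of critical values of `q` is a simple normal crossing divisor
  `D ∪ D'` -/
  D_subset : D ⊆ q '' {y | ¬ Function.Bijective
    (mfderiv 𝓘(ℝ, Fin n → ℂ) 𝓘(ℝ, Fin n → ℂ) q y)}
  branch_snc : IsSNCDivisor n (q '' {y | ¬ Function.Bijective
    (mfderiv 𝓘(ℝ, Fin n → ℂ) 𝓘(ℝ, Fin n → ℂ) q y)})
  /-- the `Γ`-equivariant holomorphic vector bundle on `Y` -/
  V : HolBundle.{v, v} n r Y
  act : ∀ (g : Γ) (y : Y), V.Fib y →ₗ[ℂ] V.Fib (g • y)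
  act_one : ∀ (y : Y) (s : V.Fib y), (⟨(1 : Γ) • y, act 1 y s⟩ :
    Bundle.TotalSpace (Fin r → ℂ) V.Fib) = ⟨y, s⟩
  act_mul : ∀ (g h : Γ) (y : Y) (s : V.Fib y), (⟨(g * h) • y, act (g * h) y s⟩ :
    Bundle.TotalSpace (Fin r → ℂ) V.Fib) = ⟨g • h • y, act g (h • y) (act h y s)⟩
  act_hol : ∀ g : Γ, ContMDiff (𝓘(ℂ, Fin n → ℂ).prod 𝓘(ℂ, Fin r → ℂ))
    (𝓘(ℂ, Fin n → ℂ).prod 𝓘(ℂ, Fin r → ℂ)) ω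
    fun s : Bundle.TotalSpace (Fin r → ℂ) V.Fib =>
      (⟨g • s.proj, act g s.proj s.snd⟩ : Bundle.TotalSpace (Fin r → ℂ) V.Fib)
  /-- the equivariant holomorphic identification of `q^* E` with `V` away from `q⁻¹(D)`; its values
  over `D` are irrelevant -/
  θ : ∀ y : Y, E.Fib (q y) ≃ₗ[ℂ] V.Fib y
  θ_hol : ∀ (U : Set X) (s : ∀ x, E.Fib x), IsOpen U → E.IsHolSection s U →
    V.IsHolSection (fun y => θ y (s (q y))) (q ⁻¹' (U \ D))
  θ_equivariant : ∀ (g : Γ) (y : Y) (s : ∀ x, E.Fib x), q y ∉ D →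
    act g y (θ y (s (q y))) = θ (g • y) (s (q (g • y)))
  /-- `E_*` is the invariant direct image of `V`: near a point `y` over `D` there are an adapted
  frame `e_j` with weights `α_j` of `E_*`, a holomorphic frame `e'_j` of `V` and a local equation
  `z` of `D` such that `z ∘ q = w ^ N` for a local equation `w` of the reduced divisor `q⁻¹(D)`, and
  `e_j = w ^ (N α_j) e'_j`. -/
  direct_image : ∀ y : Y, q y ∈ D →
    ∃ (U : Set X) (e : Fin r → ∀ x, E.Fib x) (α : Fin r → ℚ)
      (z : OpenPartialHomeomorph X (Fin n → ℂ)) (i : Fin n)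
      (O : Set Y) (w : Y → ℂ) (e' : Fin r → ∀ y, V.Fib y) (N : ℕ) (κ : Fin r → ℕ),
      q y ∈ U ∧ IsAdaptedFrame E D P.filt U e α ∧
      q y ∈ z.source ∧ IsDivisorChart D z i ∧
      IsOpen O ∧ y ∈ O ∧ O ⊆ q ⁻¹' (U ∩ z.source) ∧
      ContMDiffOn 𝓘(ℂ, Fin n → ℂ) 𝓘(ℂ, ℂ) ω w O ∧
      mfderiv 𝓘(ℂ, Fin n → ℂ) 𝓘(ℂ, ℂ) w y ≠ 0 ∧
      0 < N ∧ (∀ y' ∈ O, z (q y') i = w y' ^ N) ∧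
      (∀ j, (κ j : ℚ) = N * α j) ∧ V.IsHolFrame e' O ∧
      ∀ y' ∈ O, q y' ∉ D → ∀ j, θ y' (e j (q y')) = w y' ^ κ j • e' j y'

attribute [instance] KawamataCover.instTop KawamataCover.instT2 KawamataCover.instCompact
  KawamataCover.instConnected KawamataCover.instCharted KawamataCover.instManifold
  KawamataCover.instGroup KawamataCover.instFinite KawamataCover.instMulAction
  KawamataCover.instFaithful

variable {E : HolBundle.{u, w} n r X} {D : Set X} {P : ParabolicStructure E D}

/-- The ramification divisor `D''` of the cover, as a subset of `X`. -/
def KawamataCover.branch (c : KawamataCover.{u, v, w} P) : Set X :=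
  c.q '' {y | ¬ Function.Bijective (mfderiv 𝓘(ℝ, Fin n → ℂ) 𝓘(ℝ, Fin n → ℂ) c.q y)}

/-- The cover is locally good around `p`, as witnessed by the Zariski open neighbourhood `U`. -/
def KawamataCover.IsLocallyGood (c : KawamataCover.{u, v, w} P) (p : X) (U : Set X) : Prop :=
  IsZariskiOpen n U ∧ p ∈ U ∧ c.branch ∩ U = D ∩ U

/-- The branched cover `(…, w_i, …) ↦ (…, w_i ^ N, …)` of `ℂⁿ`. -/
def powerMap {n : ℕ} (i : Fin n) (N : ℕ) (t : Fin n → ℂ) : Fin n → ℂ :=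
  Function.update t i (t i ^ N)

/-- `H` is an admissible Hermitian metric on `E_*`: a smooth Hermitian metric on `E|_{X ∖ D}` that
extends to a smooth Hermitian structure on the ramified principal bundle of `E_*`.
Near a point of `D`, the ramified bundle is the quotient by the group of `N`-th roots of unity of
the frame bundle of the vector bundle with frame `e'_j = w_i ^ (-N α_j) e_j` over the local cover
`z_i = w_i ^ N`, where `e_j` is an adapted frame with weights `α_j` and `N` is the least common
denominator of the weights. So the condition is that the Gram matrix `G` of the `e'_j` extends
smoothly, as a positive definite matrix, over `w_i = 0`. -/
def IsAdmissible (P : ParabolicStructure E D) (H : E.Sesq) : Prop :=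
  E.IsHermitianMetricOn H Dᶜ ∧
  ∀ p ∈ D, ∃ (z : OpenPartialHomeomorph X (Fin n → ℂ)) (i : Fin n)
      (e : Fin r → ∀ x, E.Fib x) (α : Fin r → ℚ) (N : ℕ) (κ : Fin r → ℕ)
      (G : (Fin n → ℂ) → Matrix (Fin r) (Fin r) ℂ),
    p ∈ z.source ∧ IsDivisorChart D z i ∧ IsAdaptedFrame E D P.filt z.source e α ∧
    N = Finset.univ.lcm (fun j => (α j).den) ∧ (∀ j, (κ j : ℚ) = N * α j) ∧
    (∀ a b, ContDiffOn ℝ ∞ (fun t => G t a b) (powerMap i N ⁻¹' z.target)) ∧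
    ∀ t ∈ powerMap i N ⁻¹' z.target, (G t).PosDef ∧
      (t i ≠ 0 → ∀ a b,
        H (z.symm (powerMap i N t)) (e a (z.symm (powerMap i N t)))
          (e b (z.symm (powerMap i N t))) = star (t i ^ κ a) * G t a b * t i ^ κ b)

/-- `H'` is a smooth `Γ`-invariant Hermitian metric on `V` over `q⁻¹(U)` that descends to `H`. -/
def KawamataCover.IsLift (c : KawamataCover.{u, v, w} P) (U : Set X) (H : E.Sesq)
    (H' : c.V.Sesq) : Prop :=
  c.V.IsHermitianMetricOn H' (c.q ⁻¹' U) ∧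
  (∀ (g : c.Γ) (y : c.Y), c.q y ∈ U → ∀ s t,
    H' (g • y) (c.act g y s) (c.act g y t) = H' y s t) ∧
  ∀ y, c.q y ∈ U \ D → ∀ s t, H' y (c.θ y s) (c.θ y t) = H (c.q y) s t

/-- At the point `x ∈ X`, the form `η` is induced from the component of degree `2k` of the
Chern–Weil form of `(V, H')`: the pullback `q^* η` agrees with it at all points over `x`. -/
def KawamataCover.InducesAt (c : KawamataCover.{u, v, w} P) (H' : c.V.Sesq)
    (Φ : MvPolynomial (Fin r × Fin r) ℂ) {k : ℕ} (η : DForm n (2 * k) X) (x : X) : Prop :=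
  ∀ y, c.q y = x → ∀ t : Fin (2 * k) → TangentSpace 𝓘(ℝ, Fin n → ℂ) y,
    η (c.q y) (fun i => mfderiv 𝓘(ℝ, Fin n → ℂ) 𝓘(ℝ, Fin n → ℂ) c.q y (t i)) =
      c.V.chernWeil H' Φ k y t

/-- `η` is (the component of degree `2k` of) a parabolic Chern–Weil form `Φ_par(Θ_H)` of the
admissible metric `H`, defined by some choice, for each point `p`, of a Kawamata cover that is
locally good around `p`: at `p ∉ D` it is induced from the Chern–Weil form of the smooth metric on
the cover chosen for `p` that descends to `H`. The values of `η` on `D` are irrelevant. -/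
def IsParabolicChernWeilForm (P : ParabolicStructure E D) (H : E.Sesq)
    (Φ : MvPolynomial (Fin r × Fin r) ℂ) {k : ℕ} (η : DForm n (2 * k) X) : Prop :=
  ∀ p : X, ∃ (c : KawamataCover.{u, v, w} P) (U : Set X) (H' : c.V.Sesq),
    c.IsLocallyGood p U ∧ c.IsLift U H H' ∧ (p ∉ D → c.InducesAt H' Φ η p)

end Parabolic

end ParChernWeil

end

open ParChernWeil

noncomputable section

namespace ParChernWeil

set_option linter.unusedSectionVars false

/-! ## Permutation sums -/

section PermSums

lemma sum_perm_succ {m : ℕ} {R : Type*} [CommRing R] (h : Equiv.Perm (Fin (m + 1)) → R) :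
    ∑ τ : Equiv.Perm (Fin (m + 1)), ((Equiv.Perm.sign τ : ℤ) : R) * h τ =
      ∑ j : Fin (m + 1), (-1) ^ (j : ℕ) * ∑ σ : Equiv.Perm (Fin m),
        ((Equiv.Perm.sign σ : ℤ) : R) * h (j.cycleRange⁻¹ * Equiv.Perm.decomposeFin.symm (0, σ)) := by
  let F : Fin (m + 1) × Equiv.Perm (Fin m) → Equiv.Perm (Fin (m + 1)) := fun p =>
    p.1.cycleRange⁻¹ * Equiv.Perm.decomposeFin.symm (0, p.2)
  have hinj : Function.Injective F := by
    rintro ⟨j, σ⟩ ⟨j', σ'⟩ h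
    have h0 : j = j' := by
      have := congrArg (fun τ : Equiv.Perm (Fin (m + 1)) => τ 0) h
      simpa [F, Equiv.Perm.inv_def] using this
    subst h0
    have := mul_left_cancel h
    simpa using this
  have hbij : Function.Bijective F := by
    rw [Fintype.bijective_iff_injective_and_card]
    refine ⟨hinj, ?_⟩
    simp [Fintype.card_perm, Nat.factorial_succ]
  rw [← hbij.sum_comp, Fintype.sum_prod_type]
  refine Finset.sum_congr rfl fun j _ => ?_
  rw [Finset.mul_sum]
  refine Finset.sum_congr rfl fun σ _ => ?_
  simp only [F, Equiv.Perm.sign_mul, Equiv.Perm.sign_inv, Fin.sign_cycleRange,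
    Equiv.Perm.decomposeFin.symm_sign]
  push_cast
  simp
  ring

lemma comp_cycleRange_decomposeFin {m : ℕ} {V : Type*} (v : Fin (m + 1) → V) (j : Fin (m + 1))
    (σ : Equiv.Perm (Fin m)) :
    (fun i => v ((j.cycleRange⁻¹ * Equiv.Perm.decomposeFin.symm (0, σ)) i)) =
      Fin.cons (v j) fun i => j.removeNth v (σ i) := by
  funext i
  refine Fin.cases ?_ (fun i => ?_) i
  · simp [Equiv.Perm.inv_def]
  · simp [Equiv.Perm.inv_def, Fin.removeNth]

/-- Summing over permutations of `m + 1` letters, by first choosing the image of `0`. -/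
lemma sum_perm_succ_apply {m : ℕ} {R V : Type*} [CommRing R] (h : (Fin (m + 1) → V) → R)
    (v : Fin (m + 1) → V) :
    ∑ τ : Equiv.Perm (Fin (m + 1)), ((Equiv.Perm.sign τ : ℤ) : R) * h (fun i => v (τ i)) =
      ∑ j : Fin (m + 1), (-1) ^ (j : ℕ) * ∑ σ : Equiv.Perm (Fin m),
        ((Equiv.Perm.sign σ : ℤ) : R) * h (Fin.cons (v j) fun i => j.removeNth v (σ i)) := by
  rw [sum_perm_succ (fun τ => h fun i => v (τ i))]
  simp only [comp_cycleRange_decomposeFin]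

/-- A permutation sum vanishes if the cyclic sums over some three slots vanish. -/
lemma sum_perm_eq_zero_of_cyclic {m : ℕ} {V : Type*} (h : (Fin m → V) → ℂ)
    (c : Equiv.Perm (Fin m)) (hc : Equiv.Perm.sign c = 1)
    (hz : ∀ v, h v + h (fun i => v (c i)) + h (fun i => v (c (c i))) = 0) (v : Fin m → V) :
    ∑ τ : Equiv.Perm (Fin m), ((Equiv.Perm.sign τ : ℤ) : ℂ) * h (fun i => v (τ i)) = 0 := by
  set S := ∑ τ : Equiv.Perm (Fin m), ((Equiv.Perm.sign τ : ℤ) : ℂ) * h (fun i => v (τ i)) with hS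
  have h1 : S = ∑ τ : Equiv.Perm (Fin m), ((Equiv.Perm.sign τ : ℤ) : ℂ) * h (fun i => v (τ (c i))) := by
    rw [hS, ← Equiv.sum_comp (Equiv.mulRight c)]
    simp [hc]
  have h2 : S = ∑ τ : Equiv.Perm (Fin m), ((Equiv.Perm.sign τ : ℤ) : ℂ) *
      h (fun i => v (τ (c (c i)))) := by
    rw [hS, ← Equiv.sum_comp (Equiv.mulRight (c * c))]
    simp [hc]
  have h3 : S + S + S = 0 := by
    conv_lhs => arg 2; rw [h2]
    conv_lhs => arg 1; arg 2; rw [h1]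
    rw [hS, ← Finset.sum_add_distrib, ← Finset.sum_add_distrib]
    refine Finset.sum_eq_zero fun τ _ => ?_
    have := hz fun i => v (τ i)
    linear_combination ((Equiv.Perm.sign τ : ℤ) : ℂ) * this
  linear_combination h3 / 3

end PermSums

/-! ## Polarization -/

section Polarization

lemma sum_neg_one_pow_of_subset {k : ℕ} (R : Finset (Fin k)) :
    ∑ S : Finset (Fin k), (if R ⊆ S then (-1 : ℂ) ^ (k - S.card) else 0) =
      if R = Finset.univ then 1 else 0 := by
  have h1 : ∑ S : Finset (Fin k), (if R ⊆ S then (-1 : ℂ) ^ (k - S.card) else 0) =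
      ∑ T : Finset (Fin k), (if T ⊆ Rᶜ then (-1 : ℂ) ^ T.card else 0) := by
    refine Fintype.sum_equiv (compl_involutive.toPerm (compl : Finset (Fin k) → Finset (Fin k))) _ _
      fun S => ?_
    simp [Finset.card_compl]
  rw [h1, ← Finset.sum_filter]
  have h2 : Finset.univ.filter (fun T : Finset (Fin k) => T ⊆ Rᶜ) = (Rᶜ).powerset := by
    ext; simp
  rw [h2]
  have h3 := congrArg (Int.cast : ℤ → ℂ) (Finset.sum_powerset_neg_one_pow_card (x := Rᶜ))
  push_cast at h3
  rw [h3]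
  simp [Finset.compl_eq_empty_iff]

/-- The polarization formula for a multilinear map. -/
lemma sum_neg_one_pow_multilinear {k : ℕ} {M : Type*} [AddCommGroup M] [Module ℂ M]
    (f : MultilinearMap ℂ (fun _ : Fin k => M) ℂ) (A : Fin k → M) :
    ∑ S : Finset (Fin k), (-1) ^ (k - S.card) * f (fun _ => ∑ i ∈ S, A i) =
      ∑ σ : Equiv.Perm (Fin k), f fun j => A (σ j) := by
  have h1 : ∀ S : Finset (Fin k), f (fun _ => ∑ i ∈ S, A i) =
      ∑ r : Fin k → Fin k, if Finset.univ.image r ⊆ S then f (fun i => A (r i)) else 0 := by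
    intro S
    rw [f.map_sum_finset (fun _ i => A i) (fun _ => S), ← Finset.sum_filter]
    refine Finset.sum_congr ?_ fun _ _ => rfl
    ext r
    simp [Fintype.mem_piFinset, Finset.image_subset_iff]
  simp_rw [h1, Finset.mul_sum]
  rw [Finset.sum_comm]
  have h2 : ∀ r : Fin k → Fin k, ∑ S : Finset (Fin k), (-1 : ℂ) ^ (k - S.card) *
      (if Finset.univ.image r ⊆ S then f (fun i => A (r i)) else 0) =
      if Function.Bijective r then f (fun i => A (r i)) else 0 := by
    intro r
    have := sum_neg_one_pow_of_subset (Finset.univ.image r)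
    calc _ = (∑ S : Finset (Fin k), (if Finset.univ.image r ⊆ S then (-1 : ℂ) ^ (k - S.card)
          else 0)) * f (fun i => A (r i)) := by
          rw [Finset.sum_mul]
          refine Finset.sum_congr rfl fun S _ => ?_
          split_ifs <;> simp
      _ = _ := by
          rw [this]
          have : Finset.univ.image r = Finset.univ ↔ Function.Bijective r := by
            rw [← Finite.surjective_iff_bijective]
            simp [Finset.eq_univ_iff_forall, Function.Surjective]
          simp [this]
  simp_rw [h2]
  rw [← Finset.sum_filter]
  symm
  refine Finset.sum_bij (fun σ _ => (σ : Fin k → Fin k)) ?_ ?_ ?_ ?_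
  · intro σ _; exact Finset.mem_filter.2 ⟨Finset.mem_univ _, σ.bijective⟩
  · intro σ _ τ _ h; exact Equiv.coe_fn_injective h
  · intro r hr
    exact ⟨Equiv.ofBijective r (by simpa using hr), Finset.mem_univ _, rfl⟩
  · intro σ _; rfl

/-- A homogeneous polynomial of degree `k` is the diagonal of a `k`-linear map. -/
lemma exists_multilinear_of_isHomogeneous {σ : Type*} {k : ℕ} (Q : MvPolynomial σ ℂ)
    (hQ : Q.IsHomogeneous k) :
    ∃ f : MultilinearMap ℂ (fun _ : Fin k => σ → ℂ) ℂ,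
      ∀ x, f (fun _ => x) = MvPolynomial.eval x Q := by
  have hmono : ∀ s : σ →₀ ℕ, s.degree = k → ∃ f : MultilinearMap ℂ (fun _ : Fin k => σ → ℂ) ℂ,
      ∀ x, f (fun _ => x) = s.prod fun i e => x i ^ e := by
    intro s hs
    obtain ⟨l, hl⟩ := Quot.exists_rep (Finsupp.toMultiset s)
    have hl' : (l : Multiset σ) = Finsupp.toMultiset s := hl
    have hlen : l.length = k := by
      rw [← hs, ← Multiset.coe_card, hl', Finsupp.card_toMultiset]; rfl
    subst hlen
    refine ⟨(MultilinearMap.mkPiAlgebra ℂ (Fin l.length) ℂ).compLinearMap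
      fun j => LinearMap.proj (l.get j), fun x => ?_⟩
    have h1 : ∏ j : Fin l.length, x (l.get j) = (l.map x).prod := by
      rw [← List.prod_ofFn]
      congr 1
      apply List.ext_get <;> simp
    have h2 : (l.map x).prod = s.prod fun i e => x i ^ e := by
      have : (l.map x).prod = ((l : Multiset σ).map x).prod := by simp
      rw [this, hl', Finsupp.toMultiset_map, Finsupp.prod_toMultiset, Finsupp.prod_mapDomain_index]
      · intro; simp
      · intro a m n; exact pow_add a m n
    simpa [MultilinearMap.mkPiAlgebra_apply] using h1.trans h2
  choose! F hF using hmono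
  refine ⟨∑ s ∈ Q.support, Q.coeff s • F s, fun x => ?_⟩
  rw [sum_apply, MvPolynomial.eval_eq]
  refine Finset.sum_congr rfl fun s hs => ?_
  have hd : s.degree = k := by
    have := hQ (MvPolynomial.mem_support_iff.1 hs)
    rw [Finsupp.degree_eq_weight_one]; exact this
  rw [smul_apply, hF s hd x]
  rfl

variable {r : ℕ}

lemma continuous_polarization (Φ : MvPolynomial (Fin r × Fin r) ℂ) (k : ℕ) :
    Continuous (polarization Φ k) := by
  unfold polarization matEval
  refine continuous_const.mul (continuous_finsetSum _ fun S _ => continuous_const.mul ?_)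
  refine (MvPolynomial.continuous_eval _).comp (continuous_pi fun ij => ?_)
  simp only [Matrix.sum_apply]
  exact continuous_finsetSum _ fun i _ => (continuous_apply_apply ij.1 ij.2).comp (continuous_apply i)

/-- The polarization of `Φ` as a continuous multilinear map. -/
lemma exists_polarizationCMM (Φ : MvPolynomial (Fin r × Fin r) ℂ) (k : ℕ) :
    ∃ Ψ : ContinuousMultilinearMap ℝ (fun _ : Fin k => Matrix (Fin r) (Fin r) ℂ) ℂ,
      ∀ A, Ψ A = polarization Φ k A := by
  obtain ⟨f, hf⟩ := exists_multilinear_of_isHomogeneous _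
    (MvPolynomial.homogeneousComponent_isHomogeneous k Φ)
  let u : Matrix (Fin r) (Fin r) ℂ →ₗ[ℂ] (Fin r × Fin r → ℂ) :=
    { toFun := fun A ij => A ij.1 ij.2, map_add' := fun _ _ => rfl, map_smul' := fun _ _ => rfl }
  let f' := f.compLinearMap fun _ => u
  let G : MultilinearMap ℂ (fun _ : Fin k => Matrix (Fin r) (Fin r) ℂ) ℂ :=
    (1 / (k.factorial : ℂ)) • ∑ σ : Equiv.Perm (Fin k), f'.domDomCongr σ
  have hG : ∀ A, G A = polarization Φ k A := by
    intro A
    have h1 := sum_neg_one_pow_multilinear f' A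
    have h2 : ∀ B : Matrix (Fin r) (Fin r) ℂ, f' (fun _ => B) =
        matEval (MvPolynomial.homogeneousComponent k Φ) B := fun B => hf (u B)
    simp only [h2] at h1
    rw [polarization, h1]
    simp [G, MultilinearMap.domDomCongr_apply]
  refine ⟨⟨G.restrictScalars ℝ, ?_⟩, hG⟩
  have : (G.restrictScalars ℝ).toFun = polarization Φ k := funext hG
  rw [this]
  exact continuous_polarization Φ k

lemma matEval_homogeneousComponent_conj {Φ : MvPolynomial (Fin r × Fin r) ℂ}
    (hΦ : IsInvariantPolynomial Φ) (k : ℕ) (g : GL (Fin r) ℂ) (A : Matrix (Fin r) (Fin r) ℂ) :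
    matEval (MvPolynomial.homogeneousComponent k Φ) ((g : Matrix (Fin r) (Fin r) ℂ) * A *
      ((g⁻¹ : GL (Fin r) ℂ) : Matrix (Fin r) (Fin r) ℂ)) =
    matEval (MvPolynomial.homogeneousComponent k Φ) A := by
  set B := (g : Matrix (Fin r) (Fin r) ℂ) * A * ((g⁻¹ : GL (Fin r) ℂ) : Matrix (Fin r) (Fin r) ℂ)
  let p : Matrix (Fin r) (Fin r) ℂ → Polynomial ℂ := fun C =>
    ∑ j ∈ Finset.range (Φ.totalDegree + 1),
      Polynomial.monomial j (matEval (MvPolynomial.homogeneousComponent j Φ) C)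
  have heval : ∀ C (x : ℂ), (p C).eval x = matEval Φ (x • C) := by
    intro C x
    have h1 : matEval Φ (x • C) = ∑ j ∈ Finset.range (Φ.totalDegree + 1),
        matEval (MvPolynomial.homogeneousComponent j Φ) (x • C) := by
      conv_lhs => rw [← MvPolynomial.sum_homogeneousComponent Φ]
      simp [matEval, map_sum]
    rw [h1]
    simp only [p, Polynomial.eval_finsetSum, Polynomial.eval_monomial]
    refine Finset.sum_congr rfl fun j _ => ?_
    unfold matEval
    have h3 : (fun ij : Fin r × Fin r => (x • C) ij.1 ij.2) = x • fun ij => C ij.1 ij.2 := rfl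
    rw [h3]
    obtain ⟨f, hf⟩ := exists_multilinear_of_isHomogeneous _
      (MvPolynomial.homogeneousComponent_isHomogeneous j Φ)
    rw [← hf, ← hf]
    have := f.map_smul_univ (fun _ => x) (fun _ : Fin j => fun ij : Fin r × Fin r => C ij.1 ij.2)
    rw [this]
    simp [mul_comm]
  have hp : p B = p A := by
    refine Polynomial.funext fun x => ?_
    rw [heval, heval, ← hΦ g (x • A)]
    congr 1
    simp [B]
  have hc : ∀ C, (p C).coeff k = matEval (MvPolynomial.homogeneousComponent k Φ) C := by
    intro C
    simp only [p, Polynomial.finsetSum_coeff, Polynomial.coeff_monomial]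
    rw [Finset.sum_ite_eq' (Finset.range (Φ.totalDegree + 1)) k]
    split_ifs with h
    · rfl
    · rw [MvPolynomial.homogeneousComponent_eq_zero]
      · simp [matEval]
      · simpa using h
  rw [← hc, ← hc, hp]

lemma polarization_conj {Φ : MvPolynomial (Fin r × Fin r) ℂ}
    (hΦ : IsInvariantPolynomial Φ) (k : ℕ) (g h : Matrix (Fin r) (Fin r) ℂ) (hgh : g * h = 1)
    (A : Fin k → Matrix (Fin r) (Fin r) ℂ) :
    polarization Φ k (fun i => g * A i * h) = polarization Φ k A := by
  let g' : GL (Fin r) ℂ := ⟨g, h, hgh, mul_eq_one_comm.1 hgh⟩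
  unfold polarization
  congr 1
  refine Finset.sum_congr rfl fun S _ => ?_
  rw [← matEval_homogeneousComponent_conj hΦ k g' (∑ i ∈ S, A i)]
  congr 2
  change _ = g * _ * h
  rw [Finset.mul_sum, Finset.sum_mul]

end Polarization

/-! ## Chern–Weil theory of connection forms with values in a normed algebra -/

section SmoothForms

variable {V W : Type*} [NormedAddCommGroup V] [NormedSpace ℝ V] [FiniteDimensional ℝ V]
  [NormedAddCommGroup W] [NormedSpace ℝ W]

/-- A family of alternating forms on a finite-dimensional space is smooth if its values are. -/
lemma exists_camReconstruction (V : Type*) [NormedAddCommGroup V] [NormedSpace ℝ V]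
    [FiniteDimensional ℝ V] (m : ℕ) :
    ∃ (ι : Type) (_ : Fintype ι) (x : ι → Fin m → V) (g : (ι → ℂ) →L[ℝ] V [⋀^Fin m]→L[ℝ] ℂ),
      ∀ f : V [⋀^Fin m]→L[ℝ] ℂ, g (fun i => f (x i)) = f := by
  let b := Module.finBasis ℝ V
  let ev : (V [⋀^Fin m]→L[ℝ] ℂ) →ₗ[ℝ] ((Fin m → Fin (Module.finrank ℝ V)) → ℂ) :=
    { toFun := fun f I => f fun i => b (I i), map_add' := fun _ _ => rfl, map_smul' := fun _ _ => rfl }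
  have hinj : LinearMap.ker ev = ⊥ := by
    rw [LinearMap.ker_eq_bot']
    intro f hf
    have : f.toAlternatingMap = 0 := b.ext_alternating fun I _ => congrFun hf I
    ext v
    exact DFunLike.congr_fun this v
  obtain ⟨g, hg⟩ := ev.exists_leftInverse_of_injective hinj
  refine ⟨Fin m → Fin (Module.finrank ℝ V), inferInstance, fun I i => b (I i),
    LinearMap.toContinuousLinearMap g, fun f => ?_⟩
  exact LinearMap.congr_fun hg f

lemma contDiffOn_cam {m : ℕ} {f : W → V [⋀^Fin m]→L[ℝ] ℂ} {s : Set W} {N : WithTop ℕ∞}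
    (h : ∀ v, ContDiffOn ℝ N (fun x => f x v) s) : ContDiffOn ℝ N f s := by
  obtain ⟨ι, _, x, g, hg⟩ := exists_camReconstruction V m
  have : f = g ∘ fun y i => f y (x i) := by
    funext y; exact (hg (f y)).symm
  rw [this]
  exact g.contDiff.comp_contDiffOn (contDiffOn_pi.2 fun i => h (x i))

lemma contDiffAt_cam {m : ℕ} {f : W → V [⋀^Fin m]→L[ℝ] ℂ} {t : W} {N : WithTop ℕ∞}
    (h : ∀ v, ContDiffAt ℝ N (fun x => f x v) t) : ContDiffAt ℝ N f t := by
  obtain ⟨ι, _, x, g, hg⟩ := exists_camReconstruction V m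
  have : f = g ∘ fun y i => f y (x i) := by
    funext y; exact (hg (f y)).symm
  rw [this]
  exact g.contDiff.contDiffAt.comp t (contDiffAt_pi.2 fun i => h (x i))

lemma contDiffAt_clm {F : Type*} [NormedAddCommGroup F] [NormedSpace ℝ F]
    {f : W → V →L[ℝ] F} {t : W} {N : WithTop ℕ∞}
    (h : ∀ v, ContDiffAt ℝ N (fun x => f x v) t) : ContDiffAt ℝ N f t := by
  simp only [← contDiffWithinAt_univ] at *
  let d := Module.finrank ℝ V
  let e₁ : V ≃L[ℝ] (Fin d → ℝ) := ContinuousLinearEquiv.ofFinrankEq (by simp [d])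
  let e₂ := (e₁.arrowCongr (1 : F ≃L[ℝ] F)).trans (ContinuousLinearEquiv.piRing (Fin d))
  rw [← Function.id_comp f, ← e₂.symm_comp_self]
  exact e₂.symm.contDiff.contDiffAt.comp_contDiffWithinAt t (contDiffWithinAt_pi.2 fun i => h _)

end SmoothForms

section AbstractChernWeil

variable {𝔸 : Type*} [NormedRing 𝔸] [NormedAlgebra ℝ 𝔸]
  {V : Type*} [NormedAddCommGroup V] [NormedSpace ℝ V]
  {W : Type*} [NormedAddCommGroup W] [NormedSpace ℝ W] {k : ℕ}

/-- The curvature `dA + A ∧ A` of a connection form. -/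
def curvature (A : V → V →L[ℝ] 𝔸) (t : V) : V →L[ℝ] V →L[ℝ] 𝔸 :=
  fderiv ℝ A t - (fderiv ℝ A t).flip +
    (((ContinuousLinearMap.mul ℝ 𝔸).bilinearComp (A t) (A t)) -
      ((ContinuousLinearMap.mul ℝ 𝔸).bilinearComp (A t) (A t)).flip)

lemma curvature_apply (A : V → V →L[ℝ] 𝔸) (t u v : V) :
    curvature A t u v = fderiv ℝ A t u v - fderiv ℝ A t v u + (A t u * A t v - A t v * A t u) := by
  simp [curvature]

lemma two_le_smooth : minSmoothness ℝ 2 ≤ (∞ : WithTop ℕ∞) := by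
  rw [minSmoothness_of_isRCLikeNormedField]
  exact WithTop.coe_le_coe.2 (le_top : (2 : ℕ∞) ≤ ⊤)

lemma contDiffAt_curvature [FiniteDimensional ℝ V] {A : V → V →L[ℝ] 𝔸} {t : V}
    (hA : ContDiffAt ℝ ∞ A t) : ContDiffAt ℝ ∞ (curvature A) t := by
  have h1 : ContDiffAt ℝ ∞ (fderiv ℝ A) t := hA.fderiv_right (by simp)
  have h2 : ∀ x y, ContDiffAt ℝ ∞ (fun t => fderiv ℝ A t x y) t := fun x y =>
    (h1.clm_apply contDiffAt_const).clm_apply contDiffAt_const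
  have h3 : ∀ x, ContDiffAt ℝ ∞ (fun t => A t x) t := fun x => hA.clm_apply contDiffAt_const
  refine contDiffAt_clm fun u => contDiffAt_clm fun v => ?_
  simp only [curvature_apply]
  exact ((h2 u v).sub (h2 v u)).add (((h3 u).mul (h3 v)).sub ((h3 v).mul (h3 u)))

lemma fderiv_fderiv_swap {A : V → V →L[ℝ] 𝔸} {t : V} (hA : ContDiffAt ℝ ∞ A t) (u v : V) :
    fderiv ℝ (fderiv ℝ A) t u v = fderiv ℝ (fderiv ℝ A) t v u :=
  (hA.isSymmSndFDerivAt two_le_smooth) u v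

lemma fderiv_curvature_apply [FiniteDimensional ℝ V] {A : V → V →L[ℝ] 𝔸} {t : V} (hA : ContDiffAt ℝ ∞ A t) (u v w : V) :
    fderiv ℝ (curvature A) t u v w =
      fderiv ℝ (fderiv ℝ A) t u v w - fderiv ℝ (fderiv ℝ A) t u w v +
      (fderiv ℝ A t u v * A t w + A t v * fderiv ℝ A t u w -
        (fderiv ℝ A t u w * A t v + A t w * fderiv ℝ A t u v)) := by
  have hF := (contDiffAt_curvature hA).differentiableAt (by simp)
  have h1 : ContDiffAt ℝ ∞ (fderiv ℝ A) t := hA.fderiv_right (by simp)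
  have hd := (h1.differentiableAt (by simp)).hasFDerivAt
  have hd0 := (hA.differentiableAt (by simp)).hasFDerivAt
  have key : HasFDerivAt (fun t => curvature A t v w) _ t :=
    ((hF.hasFDerivAt.clm_apply (hasFDerivAt_const v t)).clm_apply (hasFDerivAt_const w t))
  have e1 : ∀ x, HasFDerivAt (fun t => A t x) ((fderiv ℝ A t).flip x) t := fun x => by
    simpa using hd0.clm_apply (hasFDerivAt_const x t)
  have e2 : ∀ x y, HasFDerivAt (fun t => fderiv ℝ A t x y)
      (((fderiv ℝ (fderiv ℝ A) t).flip x).flip y) t := fun x y => by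
    have := (hd.clm_apply (hasFDerivAt_const x t)).clm_apply (hasFDerivAt_const y t)
    exact this.congr_fderiv (by ext z; simp)
  have key2 : HasFDerivAt (fun t => fderiv ℝ A t v w - fderiv ℝ A t w v +
      (A t v * A t w - A t w * A t v)) _ t :=
    ((e2 v w).sub (e2 w v)).add (((e1 v).mul' (e1 w)).sub ((e1 w).mul' (e1 v)))
  have heq : (fun t => curvature A t v w) = (fun t => fderiv ℝ A t v w - fderiv ℝ A t w v +
      (A t v * A t w - A t w * A t v)) := funext fun t => curvature_apply A t v w
  rw [heq] at key
  have := congrArg (fun L : V →L[ℝ] 𝔸 => L u) (key.unique key2)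
  simp at this
  rw [this]
  abel

/-- The Bianchi identity. -/
lemma bianchi [FiniteDimensional ℝ V] {A : V → V →L[ℝ] 𝔸} {t : V} (hA : ContDiffAt ℝ ∞ A t) (u v w : V) :
    (fderiv ℝ (curvature A) t u v w - (curvature A t v w * A t u - A t u * curvature A t v w)) +
    (fderiv ℝ (curvature A) t v w u - (curvature A t w u * A t v - A t v * curvature A t w u)) +
    (fderiv ℝ (curvature A) t w u v - (curvature A t u v * A t w - A t w * curvature A t u v)) =
      0 := by
  simp only [fderiv_curvature_apply hA, curvature_apply]
  rw [fderiv_fderiv_swap hA u v, fderiv_fderiv_swap hA u w, fderiv_fderiv_swap hA v w]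
  noncomm_ring

lemma update_pairs {V 𝔸 : Type*} (F : V → V → 𝔸) (v : Fin (2 * k) → V) (j : Fin (2 * k)) (x : V) :
    (fun i : Fin k => F (Function.update v j x ⟨2 * i, by omega⟩)
      (Function.update v j x ⟨2 * i + 1, by omega⟩)) =
    Function.update (fun i : Fin k => F (v ⟨2 * i, by omega⟩) (v ⟨2 * i + 1, by omega⟩))
      ⟨j / 2, by omega⟩
      (if (j : ℕ) % 2 = 0 then F x (v ⟨2 * (j / 2) + 1, by omega⟩)
        else F (v ⟨2 * (j / 2), by omega⟩) x) := by
  funext i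
  by_cases hi : i = ⟨j / 2, by omega⟩
  · subst hi
    rw [Function.update_self]
    split_ifs with h
    · have h1 : (⟨2 * (j / 2), by omega⟩ : Fin (2 * k)) = j := Fin.ext (by simp; omega)
      have h2 : (⟨2 * (j / 2) + 1, by omega⟩ : Fin (2 * k)) ≠ j := fun h' => by
        have := congrArg Fin.val h'; simp at this; omega
      simp only [h1, Function.update_self, Function.update_of_ne h2]
    · have h1 : (⟨2 * (j / 2) + 1, by omega⟩ : Fin (2 * k)) = j := Fin.ext (by simp; omega)
      have h2 : (⟨2 * (j / 2), by omega⟩ : Fin (2 * k)) ≠ j := fun h' => by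
        have := congrArg Fin.val h'; simp at this; omega
      simp only [h1, Function.update_self, Function.update_of_ne h2]
  · have hi' : (i : ℕ) ≠ j / 2 := fun h => hi (Fin.ext h)
    have h1 : (⟨2 * i + 1, by omega⟩ : Fin (2 * k)) ≠ j := fun h' => by
      have := congrArg Fin.val h'; simp at this; omega
    have h2 : (⟨2 * i, by omega⟩ : Fin (2 * k)) ≠ j := fun h' => by
      have := congrArg Fin.val h'; simp at this; omega
    rw [Function.update_of_ne hi, Function.update_of_ne h1, Function.update_of_ne h2]

/-- The multilinear form `(v₀, …, v_{2k-1}) ↦ Ψ(F(v₀, v₁), F(v₂, v₃), …)`. -/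
def pairedForm (Ψ : ContinuousMultilinearMap ℝ (fun _ : Fin k => 𝔸) ℂ) (F : V →L[ℝ] V →L[ℝ] 𝔸) :
    ContinuousMultilinearMap ℝ (fun _ : Fin (2 * k) => V) ℂ where
  toFun v := Ψ fun i => F (v ⟨2 * i, by omega⟩) (v ⟨2 * i + 1, by omega⟩)
  map_update_add' := by
    intro inst v j x y
    rw [Subsingleton.elim inst (instDecidableEqFin _)]
    rw [update_pairs (fun a b => F a b), update_pairs (fun a b => F a b),
      update_pairs (fun a b => F a b), ← Ψ.map_update_add]
    split_ifs <;> simp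
  map_update_smul' := by
    intro inst v j c x
    rw [Subsingleton.elim inst (instDecidableEqFin _)]
    rw [update_pairs (fun a b => F a b), update_pairs (fun a b => F a b),
      ← Ψ.map_update_smul]
    split_ifs <;> simp
  cont := by
    refine Ψ.cont.comp (continuous_pi fun i => ?_)
    fun_prop

/-- The form `Ψ(F, …, F)` of degree `2k`, for a 2-form `F`. -/
def cwForm (Ψ : ContinuousMultilinearMap ℝ (fun _ : Fin k => 𝔸) ℂ) (F : V →L[ℝ] V →L[ℝ] 𝔸) :
    V [⋀^Fin (2 * k)]→L[ℝ] ℂ :=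
  (1 / (2 : ℂ) ^ k) • ContinuousMultilinearMap.alternatization (pairedForm Ψ F)

lemma cwForm_apply (Ψ : ContinuousMultilinearMap ℝ (fun _ : Fin k => 𝔸) ℂ)
    (F : V →L[ℝ] V →L[ℝ] 𝔸) (v : Fin (2 * k) → V) :
    cwForm Ψ F v = (1 / (2 : ℂ) ^ k) * ∑ σ : Equiv.Perm (Fin (2 * k)),
      ((Equiv.Perm.sign σ : ℤ) : ℂ) *
        Ψ fun i => F (v (σ ⟨2 * i, by omega⟩)) (v (σ ⟨2 * i + 1, by omega⟩)) := by
  change (1 / (2 : ℂ) ^ k) • (ContinuousMultilinearMap.alternatization (pairedForm Ψ F) v) = _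
  rw [ContinuousMultilinearMap.alternatization_apply_apply, smul_eq_mul]
  congr 1
  refine Finset.sum_congr rfl fun σ _ => ?_
  rw [Units.smul_def, zsmul_eq_mul]
  rfl

lemma cwForm_comp (Ψ : ContinuousMultilinearMap ℝ (fun _ : Fin k => 𝔸) ℂ)
    (F : V →L[ℝ] V →L[ℝ] 𝔸) (F' : W →L[ℝ] W →L[ℝ] 𝔸) (L : W →L[ℝ] V)
    (h : ∀ u v, F' u v = F (L u) (L v)) :
    cwForm Ψ F' = (cwForm Ψ F).compContinuousLinearMap L := by
  ext v
  simp [cwForm_apply, h]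

/-- Invariance of a multilinear form on an algebra under conjugation. -/
def IsConjInvariant (Ψ : ContinuousMultilinearMap ℝ (fun _ : Fin k => 𝔸) ℂ) : Prop :=
  ∀ g h : 𝔸, g * h = 1 → h * g = 1 → ∀ X, Ψ (fun i => g * X i * h) = Ψ X

lemma IsConjInvariant.sum_comm_eq_zero [CompleteSpace 𝔸]
    {Ψ : ContinuousMultilinearMap ℝ (fun _ : Fin k => 𝔸) ℂ}
    (hΨ : IsConjInvariant Ψ) (X : Fin k → 𝔸) (B : 𝔸) :
    ∑ i, Ψ (Function.update X i (X i * B - B * X i)) = 0 := by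
  have hR : ∀ Z : Fin k → 𝔸, HasFDerivAt (fun s : ℝ => Ψ fun i => X i + s • Z i)
      (∑ i : Fin k, (Ψ.toContinuousLinearMap (fun j => X j + (0 : ℝ) • Z j) i) ∘L
        ((1 : ℝ →L[ℝ] ℝ).smulRight (Z i))) 0 := by
    intro Z
    refine HasFDerivAt.multilinear_comp (f := Ψ) (g := fun i (s : ℝ) => X i + s • Z i) fun i => ?_
    exact (((1 : ℝ →L[ℝ] ℝ).smulRight (Z i)).hasFDerivAt).const_add (X i)
  have hev : (fun s : ℝ => Ψ fun i => X i + s • (X i * B)) =ᶠ[𝓝 0]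
      fun s : ℝ => Ψ fun i => X i + s • (B * X i) := by
    have hc : Continuous fun s : ℝ => (1 : 𝔸) + s • B := by fun_prop
    have hn : ∀ᶠ s in 𝓝 (0 : ℝ), IsUnit ((1 : 𝔸) + s • B) := by
      have : IsOpen {s : ℝ | IsUnit ((1 : 𝔸) + s • B)} := Units.isOpen.preimage hc
      exact this.mem_nhds (by simp)
    filter_upwards [hn] with s hs
    obtain ⟨g, hg⟩ := hs
    have := hΨ g (g⁻¹ : 𝔸ˣ) (by simp) (by simp) (fun i => X i * (g : 𝔸))
    have h1 : ∀ i, X i + s • (X i * B) = X i * (g : 𝔸) := fun i => by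
      rw [hg]; simp [mul_add]
    have h2 : ∀ i, X i + s • (B * X i) = (g : 𝔸) * (X i * (g : 𝔸)) * (g⁻¹ : 𝔸ˣ) := fun i => by
      rw [mul_assoc, mul_assoc, Units.mul_inv, mul_one, hg]; simp [add_mul]
    simp only [h1, h2, this]
  have h1 := (hR fun i => X i * B).congr_of_eventuallyEq hev.symm
  have h2 := h1.unique (hR fun i => B * X i)
  have h3 := congrArg (fun L : ℝ →L[ℝ] ℂ => L 1) h2
  simp [ContinuousMultilinearMap.toContinuousLinearMap] at h3
  simp only [Ψ.map_update_sub, Finset.sum_sub_distrib]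
  exact sub_eq_zero.2 h3

lemma cwForm_conj {Ψ : ContinuousMultilinearMap ℝ (fun _ : Fin k => 𝔸) ℂ}
    (hΨ : IsConjInvariant Ψ) (F F' : V →L[ℝ] V →L[ℝ] 𝔸) (g h : 𝔸) (hgh : g * h = 1)
    (hhg : h * g = 1) (hF : ∀ u v, F' u v = g * F u v * h) : cwForm Ψ F' = cwForm Ψ F := by
  ext v
  simp only [cwForm_apply, hF, hΨ g h hgh hhg]

lemma contDiffAt_cwForm [FiniteDimensional ℝ V]
    (Ψ : ContinuousMultilinearMap ℝ (fun _ : Fin k => 𝔸) ℂ)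
    {F : W → V →L[ℝ] V →L[ℝ] 𝔸} {t : W} (hF : ContDiffAt ℝ ∞ F t) :
    ContDiffAt ℝ ∞ (fun t => cwForm Ψ (F t)) t := by
  refine contDiffAt_cam fun v => ?_
  simp only [cwForm_apply]
  refine contDiffAt_const.mul (ContDiffAt.sum fun σ _ => contDiffAt_const.mul ?_)
  refine Ψ.contDiff.contDiffAt.comp t (contDiffAt_pi.2 fun i => ?_)
  exact (hF.clm_apply contDiffAt_const).clm_apply contDiffAt_const

lemma fderiv_cwForm_apply (Ψ : ContinuousMultilinearMap ℝ (fun _ : Fin k => 𝔸) ℂ)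
    {F : W → V →L[ℝ] V →L[ℝ] 𝔸} {t : W} (hF : DifferentiableAt ℝ F t) (u : W)
    (v : Fin (2 * k) → V) :
    fderiv ℝ (fun t => cwForm Ψ (F t) v) t u = (1 / (2 : ℂ) ^ k) * ∑ σ : Equiv.Perm (Fin (2 * k)),
      ((Equiv.Perm.sign σ : ℤ) : ℂ) * ∑ j : Fin k,
        Ψ (Function.update (fun i => F t (v (σ ⟨2 * i, by omega⟩)) (v (σ ⟨2 * i + 1, by omega⟩))) j
          (fderiv ℝ F t u (v (σ ⟨2 * j, by omega⟩)) (v (σ ⟨2 * j + 1, by omega⟩)))) := by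
  have h1 : ∀ x y, HasFDerivAt (fun t => F t x y) (((fderiv ℝ F t).flip x).flip y) t := fun x y => by
    have := (hF.hasFDerivAt.clm_apply (hasFDerivAt_const x t)).clm_apply (hasFDerivAt_const y t)
    exact this.congr_fderiv (by ext z; simp)
  have h2 : HasFDerivAt (fun t => cwForm Ψ (F t) v) ((1 / (2 : ℂ) ^ k) •
      ∑ σ : Equiv.Perm (Fin (2 * k)), ((Equiv.Perm.sign σ : ℤ) : ℂ) • ∑ j : Fin k,
        (Ψ.toContinuousLinearMap (fun i => F t (v (σ ⟨2 * i, by omega⟩))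
          (v (σ ⟨2 * i + 1, by omega⟩))) j) ∘L (((fderiv ℝ F t).flip
            (v (σ ⟨2 * j, by omega⟩))).flip (v (σ ⟨2 * j + 1, by omega⟩)))) t := by
    simp only [cwForm_apply]
    refine HasFDerivAt.const_mul ?_ _
    refine HasFDerivAt.fun_sum fun σ _ => HasFDerivAt.const_mul ?_ _
    exact HasFDerivAt.multilinear_comp (f := Ψ) fun i => h1 _ _
  rw [h2.fderiv]
  simp [ContinuousMultilinearMap.toContinuousLinearMap]

/-- Chern–Weil forms are closed. -/
lemma extDeriv_cwForm_curvature [CompleteSpace 𝔸] [FiniteDimensional ℝ V]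
    {Ψ : ContinuousMultilinearMap ℝ (fun _ : Fin k => 𝔸) ℂ}
    (hΨ : IsConjInvariant Ψ) {A : V → V →L[ℝ] 𝔸} {t : V} (hA : ContDiffAt ℝ ∞ A t) :
    extDeriv (fun t => cwForm Ψ (curvature A t)) t = 0 := by
  have hF := contDiffAt_curvature hA
  ext v
  rw [extDeriv_apply ((contDiffAt_cwForm Ψ hF).differentiableAt (by simp))]
  simp only [fderiv_cwForm_apply Ψ (hF.differentiableAt (by simp))]
  change _ = (0 : ℂ)
  set DF := fderiv ℝ (curvature A) t
  let e : V → V → V → 𝔸 := fun u v w =>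
    DF u v w - (curvature A t v w * A t u - A t u * curvature A t v w)
  have he : ∀ u v w, e u v w + e v w u + e w u v = 0 := fun u v w => bianchi hA u v w
  let X : (Fin (2 * k + 1) → V) → Fin k → 𝔸 := fun v i =>
    curvature A t (v (Fin.succ ⟨2 * i, by omega⟩)) (v (Fin.succ ⟨2 * i + 1, by omega⟩))
  let h : Fin k → (Fin (2 * k + 1) → V) → ℂ := fun j v =>
    Ψ (Function.update (X v) j (e (v 0) (v (Fin.succ ⟨2 * j, by omega⟩))
      (v (Fin.succ ⟨2 * j + 1, by omega⟩))))
  have hh : ∀ (j : Fin k) (v : Fin (2 * k + 1) → V), ∑ τ : Equiv.Perm (Fin (2 * k + 1)),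
      ((Equiv.Perm.sign τ : ℤ) : ℂ) * h j (fun i => v (τ i)) = 0 := by
    intro j v
    let a : Fin (2 * k + 1) := 0
    let b : Fin (2 * k + 1) := Fin.succ ⟨2 * j, by omega⟩
    let c : Fin (2 * k + 1) := Fin.succ ⟨2 * j + 1, by omega⟩
    have hab : a ≠ b := (Fin.succ_ne_zero _).symm
    have hac : a ≠ c := (Fin.succ_ne_zero _).symm
    have hbc : b ≠ c := fun h => by simp [b, c] at h
    let p : Equiv.Perm (Fin (2 * k + 1)) := Equiv.swap a b * Equiv.swap b c
    have pa : p a = b := by simp [p, Equiv.swap_apply_of_ne_of_ne hab hac]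
    have pb : p b = c := by simp [p, Equiv.swap_apply_of_ne_of_ne hac.symm hbc.symm]
    have pc : p c = a := by simp [p]
    have po : ∀ x, x ≠ a → x ≠ b → x ≠ c → p x = x := fun x h1 h2 h3 => by
      simp [p, Equiv.swap_apply_of_ne_of_ne h2 h3, Equiv.swap_apply_of_ne_of_ne h1 h2]
    refine sum_perm_eq_zero_of_cyclic (h j) p ?_ (fun v => ?_) v
    · simp [p, Equiv.Perm.sign_swap hab, Equiv.Perm.sign_swap hbc]
    · have hX : ∀ (v' : Fin (2 * k + 1) → V) (y : 𝔸), (∀ x, x ≠ a → x ≠ b → x ≠ c → v' x = v x) →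
          Function.update (X v') j y = Function.update (X v) j y := by
        intro v' y hv'
        funext i
        by_cases hij : i = j
        · subst hij; simp
        · have hij' : (i : ℕ) ≠ j := fun h => hij (Fin.ext h)
          rw [Function.update_of_ne hij, Function.update_of_ne hij]
          simp only [X]
          rw [hv', hv']
          all_goals first
            | exact Fin.succ_ne_zero _
            | (intro h'; simp [b, c] at h'; omega)
      simp only [h]
      rw [hX (fun i => v (p i)) _ fun x h1 h2 h3 => by simp only [po x h1 h2 h3],
        hX (fun i => v (p (p i))) _ fun x h1 h2 h3 => by simp only [po x h1 h2 h3],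
        ← Ψ.map_update_add, ← Ψ.map_update_add]
      change Ψ (Function.update (X v) j (e (v a) (v b) (v c) + e (v (p a)) (v (p b)) (v (p c)) +
        e (v (p (p a))) (v (p (p b))) (v (p (p c))))) = 0
      rw [pa, pb, pc, pa, he]
      exact Ψ.toMultilinearMap.map_update_zero _ _
  have hsplit : ∀ v : Fin (2 * k + 1) → V, ∑ j, Ψ (Function.update (X v) j (DF (v 0)
      (v (Fin.succ ⟨2 * j, by omega⟩)) (v (Fin.succ ⟨2 * j + 1, by omega⟩)))) = ∑ j, h j v := by
    intro v
    have h0 := hΨ.sum_comm_eq_zero (X v) (A t (v 0))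
    rw [← add_zero (∑ j, h j v), ← h0, ← Finset.sum_add_distrib]
    refine Finset.sum_congr rfl fun j _ => ?_
    simp only [h, ← Ψ.map_update_add]
    congr 2
    simp only [e, X]
    abel
  have hfin : ∑ τ : Equiv.Perm (Fin (2 * k + 1)), ((Equiv.Perm.sign τ : ℤ) : ℂ) *
      (∑ j, h j (fun i => v (τ i))) = 0 := by
    simp_rw [Finset.mul_sum]
    rw [Finset.sum_comm]
    exact Finset.sum_eq_zero fun j _ => hh j v
  rw [sum_perm_succ_apply (fun v => ∑ j, h j v) v] at hfin
  simp only [← hsplit] at hfin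
  have hgoal := congrArg (fun z => (1 / (2 : ℂ) ^ k) * z) hfin
  simp only [mul_zero] at hgoal
  rw [← hgoal, Finset.mul_sum]
  refine Finset.sum_congr rfl fun j _ => ?_
  simp only [X, Fin.cons_zero, Fin.cons_succ, zsmul_eq_mul]
  push_cast
  ring

end AbstractChernWeil

/-! ## Integrals depending on a parameter, and transgression -/

section ParametricIntegral

variable {H E : Type*} [NormedAddCommGroup H] [NormedSpace ℝ H] [FiniteDimensional ℝ H]
  [NormedAddCommGroup E] [NormedSpace ℝ E] [CompleteSpace E]

lemma hasFDerivAt_integral_unitInterval {f : H × ℝ → E} {Ω : Set (H × ℝ)} (hΩ : IsOpen Ω)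
    (hf : ContDiffOn ℝ ∞ f Ω) {t : H} (hsub : ∀ s ∈ Set.Icc (0 : ℝ) 1, (t, s) ∈ Ω) :
    HasFDerivAt (fun t => ∫ s in (0 : ℝ)..1, f (t, s))
      (∫ s in (0 : ℝ)..1, (fderiv ℝ f (t, s)).comp (ContinuousLinearMap.inl ℝ H ℝ)) t ∧
    IntervalIntegrable (fun s => (fderiv ℝ f (t, s)).comp (ContinuousLinearMap.inl ℝ H ℝ))
      MeasureTheory.volume 0 1 := by
  obtain ⟨u, w, hu, -, htu, hw, huw⟩ := generalized_tube_lemma (isCompact_singleton (x := t))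
    (isCompact_Icc (a := (0 : ℝ)) (b := 1)) hΩ
    (by rintro ⟨a, b⟩ ⟨ha, hb⟩; obtain rfl : a = t := ha; exact hsub b hb)
  obtain ⟨ε, hε, hball⟩ := Metric.nhds_basis_closedBall.mem_iff.1 (hu.mem_nhds (htu rfl))
  have hKΩ : Metric.closedBall t ε ×ˢ Set.Icc (0 : ℝ) 1 ⊆ Ω := fun p hp =>
    huw ⟨hball hp.1, hw hp.2⟩
  have hK : IsCompact (Metric.closedBall t ε ×ˢ Set.Icc (0 : ℝ) 1) :=
    (isCompact_closedBall t ε).prod isCompact_Icc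
  have hc' : ContinuousOn (fun p => (fderiv ℝ f p).comp (ContinuousLinearMap.inl ℝ H ℝ)) Ω := by
    have := hf.continuousOn_fderiv_of_isOpen hΩ (by simp)
    exact this.clm_comp continuousOn_const
  obtain ⟨C, hC⟩ := hK.exists_bound_of_continuousOn (hc'.mono hKΩ)
  have hI : Set.uIoc (0 : ℝ) 1 = Set.Ioc 0 1 := Set.uIoc_of_le zero_le_one
  have hIcc : Set.uIcc (0 : ℝ) 1 = Set.Icc 0 1 := Set.uIcc_of_le zero_le_one
  have hcx : ∀ x ∈ Metric.closedBall t ε, ContinuousOn (fun s => f (x, s)) (Set.Icc 0 1) :=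
    fun x hx => hf.continuousOn.comp (by fun_prop) fun s hs => hKΩ ⟨hx, hs⟩
  have hcx' : ContinuousOn (fun s => (fderiv ℝ f (t, s)).comp (ContinuousLinearMap.inl ℝ H ℝ))
      (Set.Icc (0 : ℝ) 1) :=
    hc'.comp (f := fun s => (t, s)) (by fun_prop) fun s hs =>
      hKΩ ⟨Metric.mem_closedBall_self hε.le, hs⟩
  refine ⟨intervalIntegral.hasFDerivAt_integral_of_dominated_of_fderiv_le
    (F := fun x s => f (x, s))
    (F' := fun x s => (fderiv ℝ f (x, s)).comp (ContinuousLinearMap.inl ℝ H ℝ))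
    (s := Metric.ball t ε) (bound := fun _ => C) (Metric.ball_mem_nhds t hε) ?_ ?_ ?_ ?_ ?_ ?_, ?_⟩
  · filter_upwards [Metric.ball_mem_nhds t hε] with x hx
    rw [hI]
    exact ((hcx x (Metric.ball_subset_closedBall hx)).mono Set.Ioc_subset_Icc_self).aestronglyMeasurable
      measurableSet_Ioc
  · exact ContinuousOn.intervalIntegrable (by rw [hIcc]; exact hcx t (Metric.mem_closedBall_self hε.le))
  · rw [hI]
    exact (hcx'.mono Set.Ioc_subset_Icc_self).aestronglyMeasurable measurableSet_Ioc
  · refine Filter.Eventually.of_forall fun s hs x hx => ?_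
    rw [hI] at hs
    exact hC (x, s) ⟨Metric.ball_subset_closedBall hx, Set.Ioc_subset_Icc_self hs⟩
  · exact intervalIntegrable_const
  · refine Filter.Eventually.of_forall fun s hs x hx => ?_
    rw [hI] at hs
    have hmem : (x, s) ∈ Ω := hKΩ ⟨Metric.ball_subset_closedBall hx, Set.Ioc_subset_Icc_self hs⟩
    have h1 : HasFDerivAt f (fderiv ℝ f (x, s)) (x, s) :=
      ((hf.contDiffAt (hΩ.mem_nhds hmem)).differentiableAt (by simp)).hasFDerivAt
    exact h1.comp x (hasFDerivAt_prodMk_left x s)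
  · exact ContinuousOn.intervalIntegrable (by rw [hIcc]; exact hcx')

/-- An integral over `[0, 1]` depends smoothly on parameters. -/
lemma contDiffOn_integral_unitInterval {f : H × ℝ → E} {Ω : Set (H × ℝ)} (hΩ : IsOpen Ω)
    (hf : ContDiffOn ℝ ∞ f Ω) {U : Set H} (hU : IsOpen U)
    (hsub : ∀ t ∈ U, ∀ s ∈ Set.Icc (0 : ℝ) 1, (t, s) ∈ Ω) :
    ContDiffOn ℝ ∞ (fun t => ∫ s in (0 : ℝ)..1, f (t, s)) U := by
  rw [contDiffOn_infty]
  intro n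
  induction n generalizing f with
  | zero =>
    simp only [Nat.cast_zero, contDiffOn_zero]
    exact fun t ht =>
      (hasFDerivAt_integral_unitInterval hΩ hf (hsub t ht)).1.continuousAt.continuousWithinAt
  | succ n ih =>
    push_cast
    refine contDiffOn_succ_of_fderiv_apply (fun t ht =>
      (hasFDerivAt_integral_unitInterval hΩ hf (hsub t ht)).1.differentiableAt.differentiableWithinAt)
      (by simp) fun y => ?_
    have h1 : ContDiffOn ℝ ∞ (fun p => fderiv ℝ f p (y, 0)) Ω :=
      (hf.fderiv_of_isOpen hΩ (by simp)).clm_apply contDiffOn_const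
    refine (ih h1).congr fun t ht => ?_
    obtain ⟨h2, h3⟩ := hasFDerivAt_integral_unitInterval hΩ hf (hsub t ht)
    rw [fderivWithin_of_isOpen hU ht, h2.fderiv, ContinuousLinearMap.intervalIntegral_apply h3]
    rfl

end ParametricIntegral

section FibreIntegral

variable {V : Type*} [NormedAddCommGroup V] [NormedSpace ℝ V] [FiniteDimensional ℝ V] {m : ℕ}

/-- The integral along `[0, 1]` of a form on `V × ℝ`. -/
def fibreIntegral (Ω : V × ℝ → (V × ℝ) [⋀^Fin (m + 1)]→L[ℝ] ℂ) (t : V) : V [⋀^Fin m]→L[ℝ] ℂ :=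
  ∫ s in (0 : ℝ)..1, ((Ω (t, s)).curryLeft (0, 1)).compContinuousLinearMap
    (ContinuousLinearMap.inl ℝ V ℝ)

lemma contDiffOn_fibreIntegrand {Ω : V × ℝ → (V × ℝ) [⋀^Fin (m + 1)]→L[ℝ] ℂ} {U : Set V}
    (hΩ : ContDiffOn ℝ ∞ Ω (U ×ˢ Set.univ)) :
    ContDiffOn ℝ ∞ (fun p => ((Ω p).curryLeft (0, 1)).compContinuousLinearMap
      (ContinuousLinearMap.inl ℝ V ℝ)) (U ×ˢ Set.univ) := by
  refine contDiffOn_cam fun v => ?_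
  exact (ContinuousAlternatingMap.apply ℝ (V × ℝ) ℂ
    (Fin.cons (0, 1) fun i => (v i, 0))).contDiff.comp_contDiffOn hΩ

lemma contDiffOn_fibreIntegral {Ω : V × ℝ → (V × ℝ) [⋀^Fin (m + 1)]→L[ℝ] ℂ} {U : Set V}
    (hU : IsOpen U) (hΩ : ContDiffOn ℝ ∞ Ω (U ×ˢ Set.univ)) :
    ContDiffOn ℝ ∞ (fibreIntegral Ω) U :=
  contDiffOn_integral_unitInterval (hU.prod isOpen_univ) (contDiffOn_fibreIntegrand hΩ) hU
    fun _ ht _ _ => ⟨ht, Set.mem_univ _⟩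

lemma fibreIntegral_apply {Ω : V × ℝ → (V × ℝ) [⋀^Fin (m + 1)]→L[ℝ] ℂ} {U : Set V}
    (hΩ : ContDiffOn ℝ ∞ Ω (U ×ˢ Set.univ)) {t : V} (ht : t ∈ U) (v : Fin m → V) :
    fibreIntegral Ω t v = ∫ s in (0 : ℝ)..1, Ω (t, s) (Fin.cons (0, 1) fun i => (v i, 0)) := by
  have h1 : IntervalIntegrable (fun s => ((Ω (t, s)).curryLeft (0, 1)).compContinuousLinearMap
      (ContinuousLinearMap.inl ℝ V ℝ)) MeasureTheory.volume 0 1 := by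
    refine ContinuousOn.intervalIntegrable ?_
    exact (contDiffOn_fibreIntegrand hΩ).continuousOn.comp (f := fun s => (t, s)) (by fun_prop)
      fun s _ => ⟨ht, Set.mem_univ _⟩
  have := (ContinuousAlternatingMap.apply ℝ V ℂ v).intervalIntegral_comp_comm h1
  exact this.symm

/-- The homotopy formula for closed forms. -/
lemma extDeriv_fibreIntegral {Ω : V × ℝ → (V × ℝ) [⋀^Fin (m + 1)]→L[ℝ] ℂ} {U : Set V}
    (hU : IsOpen U) (hΩ : ContDiffOn ℝ ∞ Ω (U ×ˢ Set.univ))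
    (hcl : ∀ p ∈ U ×ˢ (Set.univ : Set ℝ), extDeriv Ω p = 0) {t : V} (ht : t ∈ U) :
    extDeriv (fibreIntegral Ω) t =
      (Ω (t, 1)).compContinuousLinearMap (ContinuousLinearMap.inl ℝ V ℝ) -
      (Ω (t, 0)).compContinuousLinearMap (ContinuousLinearMap.inl ℝ V ℝ) := by
  have hO : IsOpen (U ×ˢ (Set.univ : Set ℝ)) := hU.prod isOpen_univ
  have hd : ∀ s, DifferentiableAt ℝ Ω (t, s) := fun s =>
    (hΩ.contDiffAt (hO.mem_nhds ⟨ht, Set.mem_univ _⟩)).differentiableAt (by simp)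
  have hev : ∀ w, ContDiffOn ℝ ∞ (fun p => Ω p w) (U ×ˢ Set.univ) := fun w =>
    (ContinuousAlternatingMap.apply ℝ (V × ℝ) ℂ w).contDiff.comp_contDiffOn hΩ
  ext v
  rw [extDeriv_apply (((contDiffOn_fibreIntegral hU hΩ).contDiffAt
    (hU.mem_nhds ht)).differentiableAt (by simp))]
  let w : Fin (m + 1) → Fin (m + 1) → V × ℝ := fun j =>
    Fin.cons (0, 1) fun i => (j.removeNth v i, 0)
  have h1 : ∀ j : Fin (m + 1), fderiv ℝ (fun x => fibreIntegral Ω x (j.removeNth v)) t (v j) =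
      ∫ s in (0 : ℝ)..1, fderiv ℝ (fun p => Ω p (w j)) (t, s) (v j, 0) := by
    intro j
    obtain ⟨h2, h3⟩ := hasFDerivAt_integral_unitInterval hO (hev (w j)) (t := t)
      fun s _ => ⟨ht, Set.mem_univ _⟩
    have h4 : (fun x => fibreIntegral Ω x (j.removeNth v)) =ᶠ[𝓝 t]
        fun x => ∫ s in (0 : ℝ)..1, Ω (x, s) (w j) := by
      filter_upwards [hU.mem_nhds ht] with x hx
      exact fibreIntegral_apply hΩ hx _
    rw [h4.fderiv_eq, h2.fderiv, ContinuousLinearMap.intervalIntegral_apply h3]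
    rfl
  have hint : ∀ j : Fin (m + 1), IntervalIntegrable
      (fun s => fderiv ℝ (fun p => Ω p (w j)) (t, s) (v j, 0)) MeasureTheory.volume 0 1 := by
    intro j
    refine ContinuousOn.intervalIntegrable ?_
    have := ((hev (w j)).continuousOn_fderiv_of_isOpen hO (by simp)).clm_apply
      (continuousOn_const (c := ((v j, 0) : V × ℝ)))
    exact this.comp (f := fun s => (t, s)) (by fun_prop) fun s _ => ⟨ht, Set.mem_univ _⟩
  have hpt : ∀ s : ℝ, ∑ j : Fin (m + 1), (-1 : ℤ) ^ (j : ℕ) •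
      fderiv ℝ (fun p => Ω p (w j)) (t, s) (v j, 0) =
      fderiv ℝ (fun p => Ω p fun i => (v i, 0)) (t, s) (0, 1) := by
    intro s
    have h5 := congrArg (fun L => L (Fin.cons (0, 1) fun i => (v i, 0)))
      (hcl (t, s) ⟨ht, Set.mem_univ _⟩)
    simp only [extDeriv_apply (hd s)] at h5
    rw [Fin.sum_univ_succ] at h5
    have h6 : ∀ j : Fin (m + 1), (Fin.succ j).removeNth
        (Fin.cons (0, 1) fun i => (v i, 0) : Fin (m + 2) → V × ℝ) = w j := by
      intro j
      funext i
      refine Fin.cases ?_ (fun i => ?_) i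
      · simp [Fin.removeNth, w]
      · simp [Fin.removeNth, w]
    have h7 : (0 : Fin (m + 2)).removeNth
        (Fin.cons (0, 1) fun i => (v i, 0) : Fin (m + 2) → V × ℝ) = fun i => (v i, 0) := by
      funext i
      simp [Fin.removeNth]
    simp only [h6, h7, Fin.val_zero, pow_zero, one_smul, Fin.cons_zero, Fin.cons_succ,
      Fin.val_succ, pow_succ, mul_neg, mul_one, neg_smul, Finset.sum_neg_distrib] at h5
    change _ = (0 : ℂ) at h5
    linear_combination -h5
  have hftc : ∫ s in (0 : ℝ)..1, fderiv ℝ (fun p => Ω p fun i => (v i, 0)) (t, s) (0, 1) =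
      Ω (t, 1) (fun i => (v i, 0)) - Ω (t, 0) (fun i => (v i, 0)) := by
    refine intervalIntegral.integral_eq_sub_of_hasDerivAt
      (f := fun s => Ω (t, s) fun i => (v i, 0)) (fun s _ => ?_) ?_
    · have h8 : HasFDerivAt (fun p => Ω p fun i => (v i, 0)) _ (t, s) :=
        ((hev fun i => (v i, 0)).contDiffAt
          (hO.mem_nhds (show (t, s) ∈ U ×ˢ Set.univ from ⟨ht, Set.mem_univ _⟩))).differentiableAt
          (by simp) |>.hasFDerivAt
      have h9 := (h8.comp s (hasFDerivAt_prodMk_right t s)).hasDerivAt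
      simpa [Function.comp_def] using h9
    · refine ContinuousOn.intervalIntegrable ?_
      have := ((hev fun i => (v i, 0)).continuousOn_fderiv_of_isOpen hO (by simp)).clm_apply
        (continuousOn_const (c := ((0, 1) : V × ℝ)))
      exact this.comp (f := fun s => (t, s)) (by fun_prop) fun s _ => ⟨ht, Set.mem_univ _⟩
  simp only [h1]
  calc _ = ∫ s in (0 : ℝ)..1, ∑ j : Fin (m + 1), (-1 : ℤ) ^ (j : ℕ) •
        fderiv ℝ (fun p => Ω p (w j)) (t, s) (v j, 0) := by
        rw [intervalIntegral.integral_finsetSum]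
        · refine Finset.sum_congr rfl fun j _ => ?_
          rcases neg_one_pow_eq_or ℤ (j : ℕ) with h | h <;> simp [h]
        · intro j _
          rcases neg_one_pow_eq_or ℤ (j : ℕ) with h | h
          · simpa [h] using hint j
          · have := (hint j).neg
            simp only [h, neg_smul, one_smul]
            exact this
    _ = _ := by
        simp only [hpt]
        rw [hftc]
        rfl

end FibreIntegral

section Gauge

variable {𝔸 : Type*} [NormedRing 𝔸] [NormedAlgebra ℝ 𝔸]
  {V : Type*} [NormedAddCommGroup V] [NormedSpace ℝ V] [FiniteDimensional ℝ V]
  {W : Type*} [NormedAddCommGroup W] [NormedSpace ℝ W] [FiniteDimensional ℝ W] {k : ℕ}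

/-- `A'` is, near `t`, the connection form obtained from `A` by the change of variables `ψ` and the
change of frame `g`, with inverse `h`. -/
structure IsGaugeTransform (A : V → V →L[ℝ] 𝔸) (A' : W → W →L[ℝ] 𝔸) (ψ : W → V) (g h : W → 𝔸)
    (t : W) : Prop where
  smooth : ContDiffAt ℝ ∞ A (ψ t)
  smooth_map : ContDiffAt ℝ ∞ ψ t
  smooth_frame : ContDiffAt ℝ ∞ g t
  smooth_inv : ContDiffAt ℝ ∞ h t
  mul_inv : ∀ᶠ x in 𝓝 t, g x * h x = 1
  inv_mul : ∀ᶠ x in 𝓝 t, h x * g x = 1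
  eq : ∀ᶠ x in 𝓝 t, ∀ ξ, A' x ξ = h x * A (ψ x) (fderiv ℝ ψ x ξ) * g x + h x * fderiv ℝ g x ξ

lemma IsGaugeTransform.contDiffAt {A : V → V →L[ℝ] 𝔸} {A' : W → W →L[ℝ] 𝔸} {ψ : W → V}
    {g h : W → 𝔸} {t : W} (H : IsGaugeTransform A A' ψ g h t) : ContDiffAt ℝ ∞ A' t := by
  refine contDiffAt_clm fun ξ => ?_
  have h1 : ContDiffAt ℝ ∞ (fun x => h x * A (ψ x) (fderiv ℝ ψ x ξ) * g x + h x * fderiv ℝ g x ξ) t := by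
    have h2 : ContDiffAt ℝ ∞ (fun x => fderiv ℝ ψ x ξ) t :=
      (H.smooth_map.fderiv_right (m := ∞) (by simp)).clm_apply contDiffAt_const
    have h3 : ContDiffAt ℝ ∞ (fun x => fderiv ℝ g x ξ) t :=
      (H.smooth_frame.fderiv_right (m := ∞) (by simp)).clm_apply contDiffAt_const
    exact ((H.smooth_inv.mul ((H.smooth.comp t H.smooth_map).clm_apply h2)).mul H.smooth_frame).add
      (H.smooth_inv.mul h3)
  refine h1.congr_of_eventuallyEq ?_
  filter_upwards [H.eq] with x hx using hx ξ

/-- The curvature transforms by conjugation. -/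
lemma IsGaugeTransform.curvature_eq {A : V → V →L[ℝ] 𝔸} {A' : W → W →L[ℝ] 𝔸} {ψ : W → V}
    {g h : W → 𝔸} {t : W} (H : IsGaugeTransform A A' ψ g h t) (ξ ζ : W) :
    curvature A' t ξ ζ =
      h t * curvature A (ψ t) (fderiv ℝ ψ t ξ) (fderiv ℝ ψ t ζ) * g t := by
  have hg := (H.smooth_frame.differentiableAt (by simp)).hasFDerivAt
  have hh := (H.smooth_inv.differentiableAt (by simp)).hasFDerivAt
  have hψ := (H.smooth_map.differentiableAt (by simp)).hasFDerivAt
  have hA := (H.smooth.differentiableAt (by simp)).hasFDerivAt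
  have hdψ := ((H.smooth_map.fderiv_right (m := ∞) (by simp)).differentiableAt (by simp)).hasFDerivAt
  have hdg := ((H.smooth_frame.fderiv_right (m := ∞) (by simp)).differentiableAt (by simp)).hasFDerivAt
  have hA' := (H.contDiffAt.differentiableAt (by simp)).hasFDerivAt
  have hgh := H.mul_inv.self_of_nhds
  have hhg := H.inv_mul.self_of_nhds
  have hdh : ∀ u, fderiv ℝ h t u = - (h t * fderiv ℝ g t u * h t) := by
    intro u
    have h1 : HasFDerivAt (fun x => h x * g x) _ t := hh.mul' hg
    have h2 : (fun x => h x * g x) =ᶠ[𝓝 t] fun _ => 1 := H.inv_mul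
    have h3 := h1.unique ((hasFDerivAt_const (1 : 𝔸) t).congr_of_eventuallyEq h2)
    have h4 := congrArg (fun L : W →L[ℝ] 𝔸 => L u * h t) h3
    simp only [FunLike.coe_add, FunLike.coe_smul, Pi.add_apply, Pi.smul_apply, smul_eq_mul, MulOpposite.smul_eq_mul_unop,
      MulOpposite.unop_op, FunLike.coe_zero, Pi.zero_apply, zero_mul, add_mul] at h4
    rw [mul_assoc (fderiv ℝ h t u), hgh, mul_one] at h4
    exact eq_neg_of_add_eq_zero_right h4
  have hD : ∀ u v, fderiv ℝ A' t u v =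
      fderiv ℝ h t u * A (ψ t) (fderiv ℝ ψ t v) * g t +
      h t * (fderiv ℝ A (ψ t) (fderiv ℝ ψ t u) (fderiv ℝ ψ t v) +
        A (ψ t) (fderiv ℝ (fderiv ℝ ψ) t u v)) * g t +
      h t * A (ψ t) (fderiv ℝ ψ t v) * fderiv ℝ g t u +
      (fderiv ℝ h t u * fderiv ℝ g t v + h t * fderiv ℝ (fderiv ℝ g) t u v) := by
    intro u v
    have h1 : HasFDerivAt (fun x => A' x v) _ t := hA'.clm_apply (hasFDerivAt_const v t)
    have h2 : (fun x => A' x v) =ᶠ[𝓝 t]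
        fun x => h x * A (ψ x) (fderiv ℝ ψ x v) * g x + h x * fderiv ℝ g x v := by
      filter_upwards [H.eq] with x hx using hx v
    have h3 : HasFDerivAt (fun x => A (ψ x) (fderiv ℝ ψ x v)) _ t :=
      (hA.comp t hψ).clm_apply (hdψ.clm_apply (hasFDerivAt_const v t))
    have h4 : HasFDerivAt (fun x => h x * A (ψ x) (fderiv ℝ ψ x v) * g x + h x * fderiv ℝ g x v) _ t :=
      ((hh.mul' h3).mul' hg).add (hh.mul' (hdg.clm_apply (hasFDerivAt_const v t)))
    have h5 := congrArg (fun L : W →L[ℝ] 𝔸 => L u) (h1.unique (h4.congr_of_eventuallyEq h2))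
    simp at h5
    rw [h5]
    noncomm_ring
  have hsψ : fderiv ℝ (fderiv ℝ ψ) t ξ ζ = fderiv ℝ (fderiv ℝ ψ) t ζ ξ :=
    (H.smooth_map.isSymmSndFDerivAt two_le_smooth) ξ ζ
  have hsg : fderiv ℝ (fderiv ℝ g) t ξ ζ = fderiv ℝ (fderiv ℝ g) t ζ ξ :=
    (H.smooth_frame.isSymmSndFDerivAt two_le_smooth) ξ ζ
  have hE := H.eq.self_of_nhds
  rw [curvature_apply, curvature_apply, hD, hD, hE, hE, hsψ, hsg]
  simp only [hdh]
  generalize A (ψ t) (fderiv ℝ ψ t ξ) = a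
  generalize A (ψ t) (fderiv ℝ ψ t ζ) = b
  generalize fderiv ℝ g t ξ = p
  generalize fderiv ℝ g t ζ = q
  generalize h t = h at *
  generalize g t = g at *
  have hr : ∀ x, g * (h * x) = x := fun x => by rw [← mul_assoc, hgh, one_mul]
  simp only [mul_add, add_mul, mul_sub, sub_mul, mul_assoc, hr, neg_mul]
  abel

lemma IsGaugeTransform.cwForm_eq {A : V → V →L[ℝ] 𝔸} {A' : W → W →L[ℝ] 𝔸} {ψ : W → V}
    {g h : W → 𝔸} {t : W} (H : IsGaugeTransform A A' ψ g h t)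
    {Ψ : ContinuousMultilinearMap ℝ (fun _ : Fin k => 𝔸) ℂ} (hΨ : IsConjInvariant Ψ) :
    cwForm Ψ (curvature A' t) =
      (cwForm Ψ (curvature A (ψ t))).compContinuousLinearMap (fderiv ℝ ψ t) := by
  rw [← cwForm_comp Ψ _ ((curvature A (ψ t)).bilinearComp (fderiv ℝ ψ t) (fderiv ℝ ψ t)) _
    fun u v => by simp]
  exact cwForm_conj hΨ _ _ (h t) (g t) H.inv_mul.self_of_nhds H.mul_inv.self_of_nhds
    fun u v => by rw [H.curvature_eq]; simp

/-- The affine path between two connections, as a connection on `V × ℝ`. -/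
def pathConnection (A₀ A₁ : V → V →L[ℝ] 𝔸) (p : V × ℝ) : V × ℝ →L[ℝ] 𝔸 :=
  (A₀ p.1 + p.2 • (A₁ p.1 - A₀ p.1)).comp (ContinuousLinearMap.fst ℝ V ℝ)

lemma contDiffAt_pathConnection {A₀ A₁ : V → V →L[ℝ] 𝔸} {t : V} (h₀ : ContDiffAt ℝ ∞ A₀ t)
    (h₁ : ContDiffAt ℝ ∞ A₁ t) (s : ℝ) : ContDiffAt ℝ ∞ (pathConnection A₀ A₁) (t, s) := by
  have e₀ : ContDiffAt ℝ ∞ (fun p : V × ℝ => A₀ p.1) (t, s) := h₀.comp (t, s) contDiffAt_fst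
  have e₁ : ContDiffAt ℝ ∞ (fun p : V × ℝ => A₁ p.1) (t, s) := h₁.comp (t, s) contDiffAt_fst
  exact (e₀.add (contDiffAt_snd.smul (e₁.sub e₀))).clm_comp contDiffAt_const

/-- The Chern–Weil form of the affine path between two connections. -/
def pathForm (Ψ : ContinuousMultilinearMap ℝ (fun _ : Fin (k + 1) => 𝔸) ℂ)
    (A₀ A₁ : V → V →L[ℝ] 𝔸) (p : V × ℝ) : (V × ℝ) [⋀^Fin (2 * k + 1 + 1)]→L[ℝ] ℂ :=
  cwForm Ψ (curvature (pathConnection A₀ A₁) p)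

/-- The transgression form of a pair of connections. -/
def transgression (Ψ : ContinuousMultilinearMap ℝ (fun _ : Fin (k + 1) => 𝔸) ℂ)
    (A₀ A₁ : V → V →L[ℝ] 𝔸) (t : V) : V [⋀^Fin (2 * k + 1)]→L[ℝ] ℂ :=
  fibreIntegral (pathForm Ψ A₀ A₁) t

variable {Ψ : ContinuousMultilinearMap ℝ (fun _ : Fin (k + 1) => 𝔸) ℂ}

lemma contDiffOn_pathForm {A₀ A₁ : V → V →L[ℝ] 𝔸} {U : Set V}
    (h₀ : ∀ t ∈ U, ContDiffAt ℝ ∞ A₀ t) (h₁ : ∀ t ∈ U, ContDiffAt ℝ ∞ A₁ t) :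
    ContDiffOn ℝ ∞ (pathForm Ψ A₀ A₁) (U ×ˢ Set.univ) := by
  rintro ⟨t, s⟩ ⟨ht, -⟩
  have h : ContDiffAt ℝ ∞ (fun p => cwForm Ψ (curvature (pathConnection A₀ A₁) p)) (t, s) :=
    contDiffAt_cwForm Ψ (contDiffAt_curvature (contDiffAt_pathConnection (h₀ t ht) (h₁ t ht) s))
  exact ContDiffAt.contDiffWithinAt h

lemma extDeriv_pathForm [CompleteSpace 𝔸] (hΨ : IsConjInvariant Ψ) {A₀ A₁ : V → V →L[ℝ] 𝔸}
    {t : V} (h₀ : ContDiffAt ℝ ∞ A₀ t) (h₁ : ContDiffAt ℝ ∞ A₁ t) (s : ℝ) :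
    extDeriv (pathForm Ψ A₀ A₁) (t, s) = 0 :=
  extDeriv_cwForm_curvature hΨ (contDiffAt_pathConnection h₀ h₁ s)

lemma contDiffOn_transgression {A₀ A₁ : V → V →L[ℝ] 𝔸} {U : Set V} (hU : IsOpen U)
    (h₀ : ∀ t ∈ U, ContDiffAt ℝ ∞ A₀ t) (h₁ : ∀ t ∈ U, ContDiffAt ℝ ∞ A₁ t) :
    ContDiffOn ℝ ∞ (transgression Ψ A₀ A₁) U :=
  contDiffOn_fibreIntegral hU (contDiffOn_pathForm h₀ h₁)

lemma curvature_pathConnection_inl {A₀ A₁ : V → V →L[ℝ] 𝔸} {t : V} (h₀ : ContDiffAt ℝ ∞ A₀ t)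
    (h₁ : ContDiffAt ℝ ∞ A₁ t) (s : ℝ) (u v : V) :
    curvature (pathConnection A₀ A₁) (t, s) (u, 0) (v, 0) =
      curvature (fun x => A₀ x + s • (A₁ x - A₀ x)) t u v := by
  have hp := (contDiffAt_pathConnection h₀ h₁ s).differentiableAt (by simp)
  have hd : ∀ a b, fderiv ℝ (pathConnection A₀ A₁) (t, s) (a, 0) (b, 0) =
      fderiv ℝ (fun x => A₀ x + s • (A₁ x - A₀ x)) t a b := by
    intro a b
    have e0 : HasFDerivAt (fun x => pathConnection A₀ A₁ (x, s)) _ t :=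
      HasFDerivAt.comp (g := pathConnection A₀ A₁) (f := fun x => (x, s)) t hp.hasFDerivAt
        (hasFDerivAt_prodMk_left t s)
    have e1 : HasFDerivAt (fun x => pathConnection A₀ A₁ (x, s) (b, 0)) _ t :=
      e0.clm_apply (hasFDerivAt_const (b, 0) t)
    have e2 : DifferentiableAt ℝ (fun x => A₀ x + s • (A₁ x - A₀ x)) t :=
      (h₀.differentiableAt (by simp)).add
        (((h₁.differentiableAt (by simp)).sub (h₀.differentiableAt (by simp))).const_smul s)
    have e3 : HasFDerivAt (fun x => (A₀ x + s • (A₁ x - A₀ x)) b) _ t :=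
      e2.hasFDerivAt.clm_apply (hasFDerivAt_const b t)
    have e4 := congrArg (fun L : V →L[ℝ] 𝔸 => L a) (e1.unique e3)
    simpa using e4
  rw [curvature_apply, curvature_apply, hd, hd]
  rfl

lemma extDeriv_transgression [CompleteSpace 𝔸] (hΨ : IsConjInvariant Ψ) {A₀ A₁ : V → V →L[ℝ] 𝔸}
    {U : Set V} (hU : IsOpen U) (h₀ : ∀ t ∈ U, ContDiffAt ℝ ∞ A₀ t)
    (h₁ : ∀ t ∈ U, ContDiffAt ℝ ∞ A₁ t) {t : V} (ht : t ∈ U) :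
    extDeriv (transgression Ψ A₀ A₁) t =
      cwForm Ψ (curvature A₁ t) - cwForm Ψ (curvature A₀ t) := by
  have h := extDeriv_fibreIntegral hU (contDiffOn_pathForm (Ψ := Ψ) h₀ h₁)
    (fun p hp => extDeriv_pathForm hΨ (h₀ _ hp.1) (h₁ _ hp.1) p.2) ht
  refine h.trans ?_
  have hc : ∀ (s : ℝ) (C : V →L[ℝ] V →L[ℝ] 𝔸),
      (∀ u v, C u v = curvature (pathConnection A₀ A₁) (t, s) (u, 0) (v, 0)) →
      (pathForm Ψ A₀ A₁ (t, s)).compContinuousLinearMap (ContinuousLinearMap.inl ℝ V ℝ) =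
        cwForm Ψ C := fun s C hC => (cwForm_comp Ψ _ C (ContinuousLinearMap.inl ℝ V ℝ) hC).symm
  rw [hc 1 (curvature A₁ t) fun u v => ?_, hc 0 (curvature A₀ t) fun u v => ?_]
  · have e : (fun x => A₀ x + (0 : ℝ) • (A₁ x - A₀ x)) = A₀ := by
      funext x; ext; simp
    have := (curvature_pathConnection_inl (h₀ t ht) (h₁ t ht) 0 u v).symm
    rwa [e] at this
  · have e : (fun x => A₀ x + (1 : ℝ) • (A₁ x - A₀ x)) = A₁ := by
      funext x; ext; simp
    have := (curvature_pathConnection_inl (h₀ t ht) (h₁ t ht) 1 u v).symm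
    rwa [e] at this

lemma IsGaugeTransform.pathConnection {A₀ A₁ : V → V →L[ℝ] 𝔸} {A₀' A₁' : W → W →L[ℝ] 𝔸}
    {ψ : W → V} {g h : W → 𝔸} {t : W} (H₀ : IsGaugeTransform A₀ A₀' ψ g h t)
    (H₁ : IsGaugeTransform A₁ A₁' ψ g h t) (s : ℝ) :
    IsGaugeTransform (pathConnection A₀ A₁) (pathConnection A₀' A₁')
      (fun p => (ψ p.1, p.2)) (fun p => g p.1) (fun p => h p.1) (t, s) := by
  have hfst : Filter.Tendsto (Prod.fst : W × ℝ → W) (𝓝 (t, s)) (𝓝 t) := continuousAt_fst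
  refine ⟨contDiffAt_pathConnection H₀.smooth H₁.smooth s,
    (H₀.smooth_map.comp (t, s) contDiffAt_fst).prodMk contDiffAt_snd,
    H₀.smooth_frame.comp (t, s) contDiffAt_fst, H₀.smooth_inv.comp (t, s) contDiffAt_fst,
    hfst.eventually H₀.mul_inv, hfst.eventually H₀.inv_mul, ?_⟩
  have hψ := hfst.eventually ((H₀.smooth_map.of_le (m := 1) (by simp)).eventually (by simp))
  have hg := hfst.eventually ((H₀.smooth_frame.of_le (m := 1) (by simp)).eventually (by simp))
  filter_upwards [hfst.eventually H₀.eq, hfst.eventually H₁.eq, hψ, hg] with p e₀ e₁ hψ hg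
  rintro ⟨ξ, τ⟩
  have d1 : HasFDerivAt (fun p : W × ℝ => (ψ p.1, p.2)) _ p :=
    ((hψ.differentiableAt (by simp)).hasFDerivAt.comp p hasFDerivAt_fst).prodMk hasFDerivAt_snd
  have d2 : HasFDerivAt (fun p : W × ℝ => g p.1) _ p :=
    (hg.differentiableAt (by simp)).hasFDerivAt.comp p hasFDerivAt_fst
  rw [d1.fderiv, d2.fderiv]
  simp only [ParChernWeil.pathConnection]
  simp [e₀, e₁]
  simp only [mul_add, add_mul, mul_sub, sub_mul, smul_sub, mul_assoc, mul_smul_comm, smul_mul_assoc]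
  abel

/-- Transgression forms are natural under changes of variables and of frames. -/
lemma transgression_eq (hΨ : IsConjInvariant Ψ) {A₀ A₁ : V → V →L[ℝ] 𝔸} {A₀' A₁' : W → W →L[ℝ] 𝔸}
    {ψ : W → V} {g h : W → 𝔸} {t : W} (H₀ : IsGaugeTransform A₀ A₀' ψ g h t)
    (H₁ : IsGaugeTransform A₁ A₁' ψ g h t) :
    transgression Ψ A₀' A₁' t =
      (transgression Ψ A₀ A₁ (ψ t)).compContinuousLinearMap (fderiv ℝ ψ t) := by
  have hd := (H₀.smooth_map.differentiableAt (by simp)).hasFDerivAt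
  have key : ∀ s : ℝ, pathForm Ψ A₀' A₁' (t, s) =
      (pathForm Ψ A₀ A₁ (ψ t, s)).compContinuousLinearMap
        (((fderiv ℝ ψ t).comp (ContinuousLinearMap.fst ℝ W ℝ)).prod
          (ContinuousLinearMap.snd ℝ W ℝ)) := by
    intro s
    have d1 : HasFDerivAt (fun p : W × ℝ => (ψ p.1, p.2)) _ (t, s) :=
      (HasFDerivAt.comp (t, s) hd hasFDerivAt_fst).prodMk hasFDerivAt_snd
    rw [← d1.fderiv]
    exact (H₀.pathConnection H₁ s).cwForm_eq hΨ
  ext v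
  have m0 : ∀ x ∈ ({x | ContDiffAt ℝ ∞ A₀ x ∧ ContDiffAt ℝ ∞ A₁ x} : Set V), ContDiffAt ℝ ∞ A₀ x := fun _ h => h.1
  have m1 : ∀ x ∈ ({x | ContDiffAt ℝ ∞ A₀ x ∧ ContDiffAt ℝ ∞ A₁ x} : Set V), ContDiffAt ℝ ∞ A₁ x := fun _ h => h.2
  have m0' : ∀ x ∈ ({x | ContDiffAt ℝ ∞ A₀' x ∧ ContDiffAt ℝ ∞ A₁' x} : Set W), ContDiffAt ℝ ∞ A₀' x := fun _ h => h.1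
  have m1' : ∀ x ∈ ({x | ContDiffAt ℝ ∞ A₀' x ∧ ContDiffAt ℝ ∞ A₁' x} : Set W), ContDiffAt ℝ ∞ A₁' x := fun _ h => h.2
  have e1 := fibreIntegral_apply (contDiffOn_pathForm (Ψ := Ψ) m0' m1')
    (t := t) ⟨H₀.contDiffAt, H₁.contDiffAt⟩ v
  have e2 := fibreIntegral_apply (contDiffOn_pathForm (Ψ := Ψ) m0 m1)
    (t := ψ t) ⟨H₀.smooth, H₁.smooth⟩ fun i => fderiv ℝ ψ t (v i)
  refine e1.trans (Eq.trans ?_ e2.symm)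
  refine intervalIntegral.integral_congr fun s _ => ?_
  simp only [key s]
  rw [ContinuousAlternatingMap.compContinuousLinearMap_apply]
  congr 1
  funext i
  refine Fin.cases ?_ (fun i => ?_) i
  · simp
  · simp

end Gauge

/-! ## The Chern connection of a Gram matrix -/

section Chern

/-- The `L^∞` operator norm on square matrices, with the product topology. -/
@[reducible] def matNormedRing (r : ℕ) : NormedRing (Matrix (Fin r) (Fin r) ℂ) :=
  { (Matrix.instRing : Ring (Matrix (Fin r) (Fin r) ℂ)) with
    norm := (Matrix.linftyOpNormedRing : NormedRing (Matrix (Fin r) (Fin r) ℂ)).norm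
    toMetricSpace := @MetricSpace.replaceTopology _ instTopologicalSpaceMatrix
      (Matrix.linftyOpNormedRing : NormedRing (Matrix (Fin r) (Fin r) ℂ)).toMetricSpace rfl
    dist_eq := (Matrix.linftyOpNormedRing : NormedRing (Matrix (Fin r) (Fin r) ℂ)).dist_eq
    norm_mul_le := (Matrix.linftyOpNormedRing : NormedRing (Matrix (Fin r) (Fin r) ℂ)).norm_mul_le }

attribute [local instance] matNormedRing

/-- The normed algebra of square matrices. -/
@[reducible] def matNormedAlgebra (K : Type) [NormedField K] [NormedAlgebra K ℂ] (r : ℕ) :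
    NormedAlgebra K (Matrix (Fin r) (Fin r) ℂ) :=
  { (Matrix.instAlgebra : Algebra K (Matrix (Fin r) (Fin r) ℂ)) with
    norm_smul_le :=
      (Matrix.linftyOpNormedAlgebra : NormedAlgebra K (Matrix (Fin r) (Fin r) ℂ)).norm_smul_le }

attribute [local instance] matNormedAlgebra

open scoped Matrix

variable {n m r : ℕ}

lemma contDiffAt_matrix {W : Type*} [NormedAddCommGroup W] [NormedSpace ℝ W]
    {h : W → Matrix (Fin r) (Fin r) ℂ} {t : W} {N : WithTop ℕ∞} :
    ContDiffAt ℝ N h t ↔ ∀ i j, ContDiffAt ℝ N (fun x => h x i j) t := by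
  constructor
  · intro hh i j
    let e : Matrix (Fin r) (Fin r) ℂ →ₗ[ℝ] ℂ :=
      { toFun := fun A => A i j, map_add' := fun _ _ => rfl, map_smul' := fun _ _ => rfl }
    exact (LinearMap.toContinuousLinearMap e).contDiff.contDiffAt.comp t hh
  · intro hh
    have : h = fun x => ∑ i, ∑ j, Matrix.single i j (h x i j) := by
      funext x; exact Matrix.matrix_eq_sum_single (h x)
    rw [this]
    refine ContDiffAt.sum fun i _ => ContDiffAt.sum fun j _ => ?_
    let e : ℂ →ₗ[ℝ] Matrix (Fin r) (Fin r) ℂ :=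
      { toFun := fun c => Matrix.single i j c, map_add' := fun a b => Matrix.single_add i j a b,
        map_smul' := fun a b => (Matrix.smul_single a i j b).symm }
    exact (LinearMap.toContinuousLinearMap e).contDiff.contDiffAt.comp t (hh i j)

/-- The entrywise evaluation as a continuous linear map. -/
def entryCLM (i j : Fin r) : Matrix (Fin r) (Fin r) ℂ →L[ℝ] ℂ :=
  LinearMap.toContinuousLinearMap
    { toFun := fun A => A i j, map_add' := fun _ _ => rfl, map_smul' := fun _ _ => rfl }

lemma fderiv_matrix_apply {W : Type*} [NormedAddCommGroup W] [NormedSpace ℝ W]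
    {h : W → Matrix (Fin r) (Fin r) ℂ} {t : W} (hh : DifferentiableAt ℝ h t) (ξ : W) (i j : Fin r) :
    fderiv ℝ h t ξ i j = fderiv ℝ (fun x => h x i j) t ξ := by
  have : HasFDerivAt (fun x => h x i j) _ t := (entryCLM i j).hasFDerivAt.comp t hh.hasFDerivAt
  rw [this.fderiv]; rfl

lemma contDiffAt_matrix_inv {W : Type*} [NormedAddCommGroup W] [NormedSpace ℝ W]
    {h : W → Matrix (Fin r) (Fin r) ℂ} {t : W} {N : WithTop ℕ∞} (hh : ContDiffAt ℝ N h t)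
    (hu : IsUnit (h t)) : ContDiffAt ℝ N (fun x => (h x)⁻¹) t := by
  simp only [Matrix.nonsing_inv_eq_ringInverse]
  obtain ⟨u, hu⟩ := hu
  have : CompleteSpace (Matrix (Fin r) (Fin r) ℂ) := FiniteDimensional.complete ℝ _
  have := contDiffAt_ringInverse ℝ (n := N) u
  rw [hu] at this
  exact this.comp t hh

lemma eventually_isUnit_matrix {W : Type*} [TopologicalSpace W]
    {h : W → Matrix (Fin r) (Fin r) ℂ} {t : W} (hh : ContinuousAt h t) (hu : IsUnit (h t)) :
    ∀ᶠ x in 𝓝 t, IsUnit (h x) := by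
  have : CompleteSpace (Matrix (Fin r) (Fin r) ℂ) := FiniteDimensional.complete ℝ _
  exact hh.eventually (Units.isOpen.mem_nhds hu)

section PartialDerivatives

variable {F : Type*} [NormedAddCommGroup F] [NormedSpace ℝ F] [NormedSpace ℂ F]

/-- The operator `∂` on vector-valued functions. -/
def pd (f : (Fin n → ℂ) → F) (t ξ : Fin n → ℂ) : F :=
  (1 / 2 : ℂ) • (fderiv ℝ f t ξ - Complex.I • fderiv ℝ f t (Complex.I • ξ))

/-- The operator `∂̄` on vector-valued functions. -/
def pdbar (f : (Fin n → ℂ) → F) (t ξ : Fin n → ℂ) : F :=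
  (1 / 2 : ℂ) • (fderiv ℝ f t ξ + Complex.I • fderiv ℝ f t (Complex.I • ξ))

lemma pd_add_pdbar (f : (Fin n → ℂ) → F) (t ξ : Fin n → ℂ) :
    pd f t ξ + pdbar f t ξ = fderiv ℝ f t ξ := by
  rw [pd, pdbar]
  module

end PartialDerivatives

lemma of_del_eq_pd {h : (Fin n → ℂ) → Matrix (Fin r) (Fin r) ℂ} {t : Fin n → ℂ}
    (hh : DifferentiableAt ℝ h t) (ξ : Fin n → ℂ) :
    (Matrix.of fun i j => del (fun t' => h t' i j) t ξ) = pd h t ξ := by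
  ext i j
  simp [pd, del, fderiv_matrix_apply hh]

lemma of_delbar_eq_pdbar {h : (Fin n → ℂ) → Matrix (Fin r) (Fin r) ℂ} {t : Fin n → ℂ}
    (hh : DifferentiableAt ℝ h t) (ξ : Fin n → ℂ) :
    (Matrix.of fun i j => delbar (fun t' => h t' i j) t ξ) = pdbar h t ξ := by
  ext i j
  simp [pdbar, delbar, fderiv_matrix_apply hh]

/-- The Chern connection of a Gram matrix as a matrix-valued real 1-form. -/
def chernConnection (h : (Fin n → ℂ) → Matrix (Fin r) (Fin r) ℂ) (t : Fin n → ℂ) :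
    (Fin n → ℂ) →L[ℝ] Matrix (Fin r) (Fin r) ℂ :=
  LinearMap.toContinuousLinearMap
    { toFun := connMatrix h t
      map_add' := fun a b => by
        rw [connMatrix, connMatrix, connMatrix, ← mul_add]
        congr 1
        ext i j
        simp [del]
        ring
      map_smul' := fun c a => by
        rw [connMatrix, connMatrix, RingHom.id_apply, ← mul_smul_comm]
        congr 1
        ext i j
        simp [del, smul_comm Complex.I c]
        ring }

lemma chernConnection_apply (h : (Fin n → ℂ) → Matrix (Fin r) (Fin r) ℂ) (t ξ : Fin n → ℂ) :
    chernConnection h t ξ = connMatrix h t ξ := rfl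

/-- `h` is smooth near `t`, with invertible value at `t`. -/
structure IsGramAt (h : (Fin n → ℂ) → Matrix (Fin r) (Fin r) ℂ) (t : Fin n → ℂ) : Prop where
  smooth : ∀ i j, ContDiffAt ℝ ∞ (fun x => h x i j) t
  isUnit : IsUnit (h t)

variable {h : (Fin n → ℂ) → Matrix (Fin r) (Fin r) ℂ} {t : Fin n → ℂ}

lemma IsGramAt.contDiffAt (H : IsGramAt h t) : ContDiffAt ℝ ∞ h t := contDiffAt_matrix.2 H.smooth

lemma eventually_differentiableAt {W F : Type*} [NormedAddCommGroup W] [NormedSpace ℝ W]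
    [NormedAddCommGroup F] [NormedSpace ℝ F] {f : W → F} {t : W} (hf : ContDiffAt ℝ ∞ f t) :
    ∀ᶠ x in 𝓝 t, DifferentiableAt ℝ f x := by
  filter_upwards [(hf.of_le (m := 1) (by simp)).eventually (by simp)] with x hx
  exact hx.differentiableAt (by simp)

lemma IsGramAt.connMatrix_eq (H : IsGramAt h t) (ξ : Fin n → ℂ) :
    connMatrix h t ξ = (h t)⁻¹ * pd h t ξ := by
  rw [connMatrix, of_del_eq_pd (H.contDiffAt.differentiableAt (by simp))]

lemma IsGramAt.eventually_connMatrix_eq (H : IsGramAt h t) :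
    ∀ᶠ x in 𝓝 t, ∀ ξ, connMatrix h x ξ = (h x)⁻¹ * pd h x ξ := by
  filter_upwards [eventually_differentiableAt H.contDiffAt] with x hx ξ
  rw [connMatrix, of_del_eq_pd hx]

lemma contDiffAt_pd {F : Type*} [NormedAddCommGroup F] [NormedSpace ℝ F] [NormedSpace ℂ F]
    [IsScalarTower ℝ ℂ F] {f : (Fin n → ℂ) → F} (hf : ContDiffAt ℝ ∞ f t) (ξ : Fin n → ℂ) :
    ContDiffAt ℝ ∞ (fun x => pd f x ξ) t := by
  have h1 : ∀ ζ, ContDiffAt ℝ ∞ (fun x => fderiv ℝ f x ζ) t := fun ζ =>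
    (hf.fderiv_right (m := ∞) (by simp)).clm_apply contDiffAt_const
  unfold pd
  exact ((h1 ξ).sub ((h1 _).const_smul Complex.I)).const_smul (1 / 2 : ℂ)

lemma IsGramAt.contDiffAt_chernConnection (H : IsGramAt h t) :
    ContDiffAt ℝ ∞ (chernConnection h) t := by
  refine contDiffAt_clm fun ξ => ?_
  have h1 : ContDiffAt ℝ ∞ (fun x => (h x)⁻¹ * pd h x ξ) t :=
    (contDiffAt_matrix_inv H.contDiffAt H.isUnit).mul (contDiffAt_pd H.contDiffAt ξ)
  refine h1.congr_of_eventuallyEq ?_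
  filter_upwards [H.eventually_connMatrix_eq] with x hx
  rw [chernConnection_apply, hx]

lemma pd_mul {f g : (Fin n → ℂ) → Matrix (Fin r) (Fin r) ℂ} (hf : DifferentiableAt ℝ f t)
    (hg : DifferentiableAt ℝ g t) (ξ : Fin n → ℂ) :
    pd (fun x => f x * g x) t ξ = pd f t ξ * g t + f t * pd g t ξ := by
  have : HasFDerivAt (fun x => f x * g x) _ t := hf.hasFDerivAt.mul' hg.hasFDerivAt
  rw [pd, this.fderiv]
  simp only [pd, FunLike.coe_add, FunLike.coe_smul, Pi.add_apply, Pi.smul_apply, smul_eq_mul,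
    MulOpposite.smul_eq_mul_unop, MulOpposite.unop_op, smul_mul_assoc, mul_smul_comm, sub_mul,
    mul_sub]
  module

lemma IsGramAt.eventually_isUnit (H : IsGramAt h t) : ∀ᶠ x in 𝓝 t, IsUnit (h x) :=
  eventually_isUnit_matrix H.contDiffAt.continuousAt H.isUnit

lemma isUnit_det {A : Matrix (Fin r) (Fin r) ℂ} (hA : IsUnit A) : IsUnit A.det :=
  (Matrix.isUnit_iff_isUnit_det A).1 hA

lemma IsGramAt.pd_inv (H : IsGramAt h t) (ξ : Fin n → ℂ) :
    pd (fun x => (h x)⁻¹) t ξ = - ((h t)⁻¹ * pd h t ξ * (h t)⁻¹) := by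
  have h1 := (contDiffAt_matrix_inv H.contDiffAt H.isUnit).differentiableAt (by simp)
  have h2 := pd_mul h1 (H.contDiffAt.differentiableAt (by simp)) ξ
  have h3 : (fun x => (h x)⁻¹ * h x) =ᶠ[𝓝 t] fun _ => 1 := by
    filter_upwards [H.eventually_isUnit] with x hx
    exact Matrix.nonsing_inv_mul _ (isUnit_det hx)
  have h4 : pd (fun x => (h x)⁻¹ * h x) t ξ = 0 := by
    rw [pd, h3.fderiv_eq]
    simp
  rw [h4] at h2
  have h5 := congrArg (fun A => A * (h t)⁻¹) h2
  simp only [zero_mul, add_mul] at h5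
  rw [mul_assoc (pd _ t ξ), Matrix.mul_nonsing_inv _ (isUnit_det H.isUnit), mul_one] at h5
  exact eq_neg_of_add_eq_zero_left h5.symm

lemma pd_pd_symm {f : (Fin n → ℂ) → Matrix (Fin r) (Fin r) ℂ} (hf : ContDiffAt ℝ ∞ f t)
    (ξ ζ : Fin n → ℂ) :
    pd (fun x => pd f x ζ) t ξ = pd (fun x => pd f x ξ) t ζ := by
  have h1 : ContDiffAt ℝ ∞ (fderiv ℝ f) t := hf.fderiv_right (m := ∞) (by simp)
  have hd := (h1.differentiableAt (by simp)).hasFDerivAt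
  have h2 : ∀ u v, fderiv ℝ (fun x => pd f x v) t u = (1 / 2 : ℂ) •
      (fderiv ℝ (fderiv ℝ f) t u v - Complex.I • fderiv ℝ (fderiv ℝ f) t u (Complex.I • v)) := by
    intro u v
    have h3 : ∀ w, HasFDerivAt (fun x => fderiv ℝ f x w) ((fderiv ℝ (fderiv ℝ f) t).flip w) t :=
      fun w => (hd.clm_apply (hasFDerivAt_const w t)).congr_fderiv (by ext z; simp)
    have h4 : HasFDerivAt (fun x => pd f x v) _ t :=
      ((h3 v).sub ((h3 (Complex.I • v)).const_smul Complex.I)).const_smul (1 / 2 : ℂ)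
    rw [h4.fderiv]
    rfl
  have hs : ∀ u v, fderiv ℝ (fderiv ℝ f) t u v = fderiv ℝ (fderiv ℝ f) t v u := fun u v =>
    (hf.isSymmSndFDerivAt two_le_smooth) u v
  rw [pd, pd, h2, h2, h2, h2, hs ξ ζ, hs ξ (Complex.I • ζ), hs (Complex.I • ξ) ζ,
    hs (Complex.I • ξ) (Complex.I • ζ)]
  module

/-- The curvature of the Chern connection is `∂̄(h⁻¹ ∂h)`. -/
lemma IsGramAt.curvature_eq (H : IsGramAt h t) (ξ ζ : Fin n → ℂ) :
    curvature (chernConnection h) t ξ ζ = curvMatrix h t ξ ζ := by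
  have hA := H.contDiffAt_chernConnection
  have hAd := (hA.differentiableAt (by simp)).hasFDerivAt
  have h1 : ∀ u v, fderiv ℝ (chernConnection h) t u v = fderiv ℝ (fun x => connMatrix h x v) t u := by
    intro u v
    have : HasFDerivAt (fun x => connMatrix h x v) _ t := hAd.clm_apply (hasFDerivAt_const v t)
    rw [this.fderiv]; simp
  have hcd : ∀ v, DifferentiableAt ℝ (fun x => connMatrix h x v) t := fun v =>
    (hA.clm_apply contDiffAt_const).differentiableAt (by simp)
  have h2 : curvMatrix h t ξ ζ = pdbar (fun x => connMatrix h x ζ) t ξ -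
      pdbar (fun x => connMatrix h x ξ) t ζ := by
    rw [← of_delbar_eq_pdbar (hcd ζ), ← of_delbar_eq_pdbar (hcd ξ)]
    rfl
  have h3 : ∀ u v, pd (fun x => connMatrix h x v) t u =
      - ((h t)⁻¹ * pd h t u * (h t)⁻¹) * pd h t v + (h t)⁻¹ * pd (fun x => pd h x v) t u := by
    intro u v
    have e : (fun x => connMatrix h x v) =ᶠ[𝓝 t] fun x => (h x)⁻¹ * pd h x v := by
      filter_upwards [H.eventually_connMatrix_eq] with x hx using hx v
    have e2 : pd (fun x => connMatrix h x v) t u = pd (fun x => (h x)⁻¹ * pd h x v) t u := by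
      rw [pd, pd, e.fderiv_eq]
    rw [e2, pd_mul ((contDiffAt_matrix_inv H.contDiffAt H.isUnit).differentiableAt (by simp))
      ((contDiffAt_pd H.contDiffAt v).differentiableAt (by simp)), H.pd_inv]
  rw [curvature_apply, h1, h1, ← pd_add_pdbar, ← pd_add_pdbar, h2, h3, h3,
    pd_pd_symm H.contDiffAt ξ ζ, chernConnection_apply, chernConnection_apply, H.connMatrix_eq,
    H.connMatrix_eq]
  noncomm_ring

/-! ### Change of frames and of coordinates -/

lemma smooth_of_holomorphic {E F : Type*} [NormedAddCommGroup E] [NormedSpace ℂ E]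
    [NormedAddCommGroup F] [NormedSpace ℂ F] {f : E → F} {t : E} (hf : ContDiffAt ℂ ω f t) :
    ContDiffAt ℝ ∞ f t := (hf.restrict_scalars ℝ).of_le le_top

lemma eventually_differentiableAt_complex {E F : Type*} [NormedAddCommGroup E] [NormedSpace ℂ E]
    [NormedAddCommGroup F] [NormedSpace ℂ F] {f : E → F} {t : E} (hf : ContDiffAt ℂ ω f t) :
    ∀ᶠ x in 𝓝 t, DifferentiableAt ℂ f x := by
  filter_upwards [hf.eventually (by simp)] with x hx
  exact hx.differentiableAt (by simp)

lemma fderiv_I_smul {E F : Type*} [NormedAddCommGroup E] [NormedSpace ℂ E]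
    [NormedAddCommGroup F] [NormedSpace ℂ F] {f : E → F} {t : E} (hf : DifferentiableAt ℂ f t)
    (ξ : E) : fderiv ℝ f t (Complex.I • ξ) = Complex.I • fderiv ℝ f t ξ := by
  rw [hf.fderiv_restrictScalars ℝ]
  simp

lemma pd_conjTranspose {g : (Fin n → ℂ) → Matrix (Fin r) (Fin r) ℂ}
    (hg : ∀ i j, DifferentiableAt ℂ (fun x => g x i j) t) (ξ : Fin n → ℂ) :
    pd (fun x => (g x)ᴴ) t ξ = 0 := by
  have h1 : ∀ i j, DifferentiableAt ℝ (fun x => star (g x j i)) t := fun i j =>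
    ((hg j i).restrictScalars ℝ).star
  have h2 : DifferentiableAt ℝ (fun x => (g x)ᴴ) t := by
    have : (fun x => (g x)ᴴ) = fun x => ∑ i, ∑ j, Matrix.single i j (star (g x j i)) := by
      funext x; exact Matrix.matrix_eq_sum_single (g x)ᴴ
    rw [this]
    refine DifferentiableAt.fun_sum fun i _ => DifferentiableAt.fun_sum fun j _ => ?_
    let e : ℂ →ₗ[ℝ] Matrix (Fin r) (Fin r) ℂ :=
      { toFun := fun c => Matrix.single i j c, map_add' := fun a b => Matrix.single_add i j a b,
        map_smul' := fun a b => (Matrix.smul_single a i j b).symm }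
    exact (LinearMap.toContinuousLinearMap e).differentiableAt.comp t (h1 i j)
  rw [← of_del_eq_pd h2]
  ext i j
  have h3 : ∀ ζ, fderiv ℝ (fun x => star (g x j i)) t ζ = star (fderiv ℝ (fun x => g x j i) t ζ) := by
    intro ζ
    rw [((hg j i).restrictScalars ℝ).hasFDerivAt.star.fderiv]
    simp
  simp only [Matrix.of_apply, Matrix.conjTranspose_apply, Matrix.zero_apply, del, h3,
    fderiv_I_smul (hg j i)]
  simp only [smul_eq_mul, star_mul', Complex.star_def, Complex.conj_I]
  ring_nf
  simp

lemma pd_comp {F : Type*} [NormedAddCommGroup F] [NormedSpace ℝ F] [NormedSpace ℂ F]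
    {f : (Fin n → ℂ) → F} {ψ : (Fin m → ℂ) → Fin n → ℂ} {t : Fin m → ℂ}
    (hf : DifferentiableAt ℝ f (ψ t)) (hψ : DifferentiableAt ℂ ψ t) (ξ : Fin m → ℂ) :
    pd (fun x => f (ψ x)) t ξ = pd f (ψ t) (fderiv ℝ ψ t ξ) := by
  have : HasFDerivAt (fun x => f (ψ x)) _ t :=
    hf.hasFDerivAt.comp t (hψ.restrictScalars ℝ).hasFDerivAt
  rw [pd, pd, this.fderiv, ← fderiv_I_smul hψ]
  rfl

/-- Under a holomorphic change of coordinates and of frame, Chern connections change by a gauge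
transformation. -/
lemma isGaugeTransform_chernConnection {ψ : (Fin m → ℂ) → Fin n → ℂ} {t : Fin m → ℂ}
    {g h' : (Fin m → ℂ) → Matrix (Fin r) (Fin r) ℂ} (H : IsGramAt h (ψ t))
    (hψ : ContDiffAt ℂ ω ψ t) (hg : ∀ i j, ContDiffAt ℂ ω (fun x => g x i j) t)
    (hgu : IsUnit (g t)) (hh' : ∀ᶠ x in 𝓝 t, h' x = (g x)ᴴ * h (ψ x) * g x) :
    IsGaugeTransform (chernConnection h) (chernConnection h') ψ g (fun x => (g x)⁻¹) t := by
  have hgR : ContDiffAt ℝ ∞ g t := contDiffAt_matrix.2 fun i j => smooth_of_holomorphic (hg i j)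
  have hψR := smooth_of_holomorphic hψ
  have hu := eventually_isUnit_matrix hgR.continuousAt hgu
  have hgd : ∀ᶠ x in 𝓝 t, ∀ i j, DifferentiableAt ℂ (fun x => g x i j) x := by
    simp only [Filter.eventually_all]
    exact fun i j => eventually_differentiableAt_complex (hg i j)
  refine ⟨H.contDiffAt_chernConnection, hψR, hgR, contDiffAt_matrix_inv hgR hgu, ?_, ?_, ?_⟩
  · filter_upwards [hu] with x hx using Matrix.mul_nonsing_inv _ (isUnit_det hx)
  · filter_upwards [hu] with x hx using Matrix.nonsing_inv_mul _ (isUnit_det hx)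
  have hψt : Filter.Tendsto ψ (𝓝 t) (𝓝 (ψ t)) := hψR.continuousAt
  filter_upwards [hu, hgd, eventually_differentiableAt hgR, eventually_differentiableAt_complex hψ,
    hψt.eventually H.eventually_connMatrix_eq, hψt.eventually H.eventually_isUnit,
    hψt.eventually (eventually_differentiableAt H.contDiffAt), hh'.eventually_nhds] with
    x hux hgx hgx' hψx hcx hhux hhx hh'x
  intro ξ
  have e1 : DifferentiableAt ℝ (fun x => (g x)ᴴ) x := by
    have : ∀ i j, DifferentiableAt ℝ (fun x => star (g x j i)) x := fun i j =>
      ((hgx j i).restrictScalars ℝ).star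
    have e : (fun x => (g x)ᴴ) = fun x => ∑ i, ∑ j, Matrix.single i j (star (g x j i)) := by
      funext x; exact Matrix.matrix_eq_sum_single (g x)ᴴ
    rw [e]
    refine DifferentiableAt.fun_sum fun i _ => DifferentiableAt.fun_sum fun j _ => ?_
    let e : ℂ →ₗ[ℝ] Matrix (Fin r) (Fin r) ℂ :=
      { toFun := fun c => Matrix.single i j c, map_add' := fun a b => Matrix.single_add i j a b,
        map_smul' := fun a b => (Matrix.smul_single a i j b).symm }
    exact (LinearMap.toContinuousLinearMap e).differentiableAt.comp x (this i j)
  have e2 : DifferentiableAt ℝ (fun x => h (ψ x)) x :=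
    hhx.comp x (hψx.restrictScalars ℝ)
  have e3 : DifferentiableAt ℝ h' x := (((e1.mul e2).mul hgx').congr_of_eventuallyEq hh'x)
  have e4 : pd h' x ξ = (g x)ᴴ * pd h (ψ x) (fderiv ℝ ψ x ξ) * g x +
      (g x)ᴴ * h (ψ x) * fderiv ℝ g x ξ := by
    have e5 : pd h' x ξ = pd (fun x => (g x)ᴴ * h (ψ x) * g x) x ξ := by
      rw [pd, pd, Filter.EventuallyEq.fderiv_eq hh'x]
    have e6 : pd g x ξ = fderiv ℝ g x ξ := by
      rw [← of_del_eq_pd hgx']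
      ext i j
      rw [Matrix.of_apply, del, fderiv_I_smul (hgx i j), fderiv_matrix_apply hgx', smul_eq_mul,
        ← mul_assoc, Complex.I_mul_I]
      ring
    have e12 : DifferentiableAt ℝ (fun x => (g x)ᴴ * h (ψ x)) x := e1.mul e2
    rw [e5, pd_mul e12 hgx', pd_mul e1 e2, pd_conjTranspose hgx, pd_comp hhx hψx, e6]
    simp
  rw [chernConnection_apply, connMatrix, of_del_eq_pd e3, e4, hh'x.self_of_nhds,
    chernConnection_apply, hcx, Matrix.mul_inv_rev, Matrix.mul_inv_rev]
  have i1 := Matrix.nonsing_inv_mul _ (isUnit_det hhux)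
  have i2 : ((g x)ᴴ)⁻¹ * (g x)ᴴ = 1 := Matrix.nonsing_inv_mul _ (by
    rw [Matrix.det_conjTranspose]; exact (isUnit_det hux).star)
  have r1 : ∀ y, (h (ψ x))⁻¹ * (h (ψ x) * y) = y := fun y => by rw [← mul_assoc, i1, one_mul]
  have r2 : ∀ y, ((g x)ᴴ)⁻¹ * ((g x)ᴴ * y) = y := fun y => by rw [← mul_assoc, i2, one_mul]
  simp only [mul_add, mul_assoc, r1, r2]

/-! ### Chern–Weil forms of Gram matrices -/

/-- The polarization as a continuous multilinear map. -/
def polarizationCMM (Φ : MvPolynomial (Fin r × Fin r) ℂ) (k : ℕ) :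
    ContinuousMultilinearMap ℝ (fun _ : Fin k => Matrix (Fin r) (Fin r) ℂ) ℂ :=
  (exists_polarizationCMM Φ k).choose

lemma polarizationCMM_apply (Φ : MvPolynomial (Fin r × Fin r) ℂ) (k : ℕ)
    (A : Fin k → Matrix (Fin r) (Fin r) ℂ) : polarizationCMM Φ k A = polarization Φ k A :=
  (exists_polarizationCMM Φ k).choose_spec A

lemma isConjInvariant_polarizationCMM {Φ : MvPolynomial (Fin r × Fin r) ℂ}
    (hΦ : IsInvariantPolynomial Φ) (k : ℕ) : IsConjInvariant (polarizationCMM Φ k) := by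
  intro g h hgh _ X
  rw [polarizationCMM_apply, polarizationCMM_apply, polarization_conj hΦ k g h hgh]

/-- The Chern–Weil form of degree `2k` of a Gram matrix. -/
def gramForm (Φ : MvPolynomial (Fin r × Fin r) ℂ) (k : ℕ)
    (h : (Fin n → ℂ) → Matrix (Fin r) (Fin r) ℂ) (t : Fin n → ℂ) :
    (Fin n → ℂ) [⋀^Fin (2 * k)]→L[ℝ] ℂ :=
  cwForm (polarizationCMM Φ k) (curvature (chernConnection h) t)

/-- The transgression form of degree `2k + 1` of a pair of Gram matrices. -/
def gramTransgression (Φ : MvPolynomial (Fin r × Fin r) ℂ) (k : ℕ)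
    (h₀ h₁ : (Fin n → ℂ) → Matrix (Fin r) (Fin r) ℂ) (t : Fin n → ℂ) :
    (Fin n → ℂ) [⋀^Fin (2 * k + 1)]→L[ℝ] ℂ :=
  transgression (polarizationCMM Φ (k + 1)) (chernConnection h₀) (chernConnection h₁) t

lemma polyOfTwoForms_eq_gramForm (Φ : MvPolynomial (Fin r × Fin r) ℂ) (k : ℕ) (H : IsGramAt h t)
    (v : Fin (2 * k) → Fin n → ℂ) :
    polyOfTwoForms Φ k (curvMatrix h t) v = gramForm Φ k h t v := by
  rw [gramForm, cwForm_apply, polyOfTwoForms]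
  simp only [polarizationCMM_apply, H.curvature_eq]

lemma gramForm_zero_eq (Φ : MvPolynomial (Fin r × Fin r) ℂ)
    (h₁ h₂ : (Fin n → ℂ) → Matrix (Fin r) (Fin r) ℂ) (t : Fin n → ℂ) :
    gramForm Φ 0 h₁ t = gramForm Φ 0 h₂ t := by
  refine ContinuousAlternatingMap.ext fun v => ?_
  rw [gramForm, gramForm, cwForm_apply, cwForm_apply]
  congr 2
  funext σ
  congr 2
  funext i
  exact i.elim0

lemma contDiffAt_gramForm (Φ : MvPolynomial (Fin r × Fin r) ℂ) (k : ℕ) (H : IsGramAt h t) :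
    ContDiffAt ℝ ∞ (gramForm Φ k h) t :=
  contDiffAt_cwForm _ (contDiffAt_curvature H.contDiffAt_chernConnection)

lemma extDeriv_gramForm {Φ : MvPolynomial (Fin r × Fin r) ℂ} (hΦ : IsInvariantPolynomial Φ) (k : ℕ)
    (H : IsGramAt h t) : extDeriv (gramForm Φ k h) t = 0 := by
  have : CompleteSpace (Matrix (Fin r) (Fin r) ℂ) := FiniteDimensional.complete ℝ _
  exact extDeriv_cwForm_curvature (isConjInvariant_polarizationCMM hΦ k)
    H.contDiffAt_chernConnection

lemma contDiffOn_gramTransgression (Φ : MvPolynomial (Fin r × Fin r) ℂ) (k : ℕ)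
    {h₀ h₁ : (Fin n → ℂ) → Matrix (Fin r) (Fin r) ℂ} {U : Set (Fin n → ℂ)} (hU : IsOpen U)
    (H₀ : ∀ t ∈ U, IsGramAt h₀ t) (H₁ : ∀ t ∈ U, IsGramAt h₁ t) :
    ContDiffOn ℝ ∞ (gramTransgression Φ k h₀ h₁) U :=
  contDiffOn_transgression hU (fun t ht => (H₀ t ht).contDiffAt_chernConnection)
    fun t ht => (H₁ t ht).contDiffAt_chernConnection

lemma extDeriv_gramTransgression {Φ : MvPolynomial (Fin r × Fin r) ℂ} (hΦ : IsInvariantPolynomial Φ)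
    (k : ℕ) {h₀ h₁ : (Fin n → ℂ) → Matrix (Fin r) (Fin r) ℂ} {U : Set (Fin n → ℂ)} (hU : IsOpen U)
    (H₀ : ∀ t ∈ U, IsGramAt h₀ t) (H₁ : ∀ t ∈ U, IsGramAt h₁ t) {t : Fin n → ℂ} (ht : t ∈ U) :
    extDeriv (gramTransgression Φ k h₀ h₁) t =
      gramForm Φ (k + 1) h₁ t - gramForm Φ (k + 1) h₀ t := by
  have : CompleteSpace (Matrix (Fin r) (Fin r) ℂ) := FiniteDimensional.complete ℝ _
  exact extDeriv_transgression (isConjInvariant_polarizationCMM hΦ (k + 1)) hU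
    (fun t ht => (H₀ t ht).contDiffAt_chernConnection)
    (fun t ht => (H₁ t ht).contDiffAt_chernConnection) ht

section Naturality

variable {ψ : (Fin m → ℂ) → Fin n → ℂ} {t : Fin m → ℂ}
  {g h' h₀' h₁' : (Fin m → ℂ) → Matrix (Fin r) (Fin r) ℂ}
  {h₀ h₁ : (Fin n → ℂ) → Matrix (Fin r) (Fin r) ℂ}
  {Φ : MvPolynomial (Fin r × Fin r) ℂ}

lemma gramForm_eq (hΦ : IsInvariantPolynomial Φ) (k : ℕ) (H : IsGramAt h (ψ t))
    (hψ : ContDiffAt ℂ ω ψ t) (hg : ∀ i j, ContDiffAt ℂ ω (fun x => g x i j) t)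
    (hgu : IsUnit (g t)) (hh' : ∀ᶠ x in 𝓝 t, h' x = (g x)ᴴ * h (ψ x) * g x) :
    gramForm Φ k h' t = (gramForm Φ k h (ψ t)).compContinuousLinearMap (fderiv ℝ ψ t) :=
  (isGaugeTransform_chernConnection H hψ hg hgu hh').cwForm_eq (isConjInvariant_polarizationCMM hΦ k)

lemma gramTransgression_eq (hΦ : IsInvariantPolynomial Φ) (k : ℕ) (H₀ : IsGramAt h₀ (ψ t))
    (H₁ : IsGramAt h₁ (ψ t))
    (hψ : ContDiffAt ℂ ω ψ t) (hg : ∀ i j, ContDiffAt ℂ ω (fun x => g x i j) t)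
    (hgu : IsUnit (g t)) (hh₀' : ∀ᶠ x in 𝓝 t, h₀' x = (g x)ᴴ * h₀ (ψ x) * g x)
    (hh₁' : ∀ᶠ x in 𝓝 t, h₁' x = (g x)ᴴ * h₁ (ψ x) * g x) :
    gramTransgression Φ k h₀' h₁' t =
      (gramTransgression Φ k h₀ h₁ (ψ t)).compContinuousLinearMap (fderiv ℝ ψ t) :=
  transgression_eq (isConjInvariant_polarizationCMM hΦ (k + 1))
    (isGaugeTransform_chernConnection H₀ hψ hg hgu hh₀')
    (isGaugeTransform_chernConnection H₁ hψ hg hgu hh₁')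

end Naturality

end Chern

/-! ## Wedge products in top degree -/

section Wedge

/-- The antisymmetrization of a function of `m` vectors. -/
def altSum {m : ℕ} {V : Type*} (F : (Fin m → V) → ℂ) (v : Fin m → V) : ℂ :=
  ∑ σ : Equiv.Perm (Fin m), ((Equiv.Perm.sign σ : ℤ) : ℂ) * F (v ∘ σ)

lemma altSum_comp_perm {m : ℕ} {V : Type*} (F : (Fin m → V) → ℂ) (p : Equiv.Perm (Fin m))
    (v : Fin m → V) :
    altSum (fun u => F (u ∘ p)) v = ((Equiv.Perm.sign p : ℤ) : ℂ) * altSum F v := by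
  unfold altSum
  rw [Finset.mul_sum]
  refine Eq.trans ?_ (Equiv.sum_comp (Equiv.mulRight p) fun σ =>
    ((Equiv.Perm.sign p : ℤ) : ℂ) * (((Equiv.Perm.sign σ : ℤ) : ℂ) * F (v ∘ σ)))
  refine Finset.sum_congr rfl fun σ _ => ?_
  have h1 : ((Equiv.Perm.sign p : ℤ) : ℂ) * ((Equiv.Perm.sign p : ℤ) : ℂ) = 1 := by
    rw [← Int.cast_mul, ← Units.val_mul, Int.units_mul_self]; simp
  simp only [Equiv.coe_mulRight, Equiv.Perm.sign_mul, Units.val_mul, Int.cast_mul]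
  calc _ = ((Equiv.Perm.sign σ : ℤ) : ℂ) * F ((v ∘ σ) ∘ p) := rfl
    _ = ((Equiv.Perm.sign p : ℤ) : ℂ) * ((Equiv.Perm.sign p : ℤ) : ℂ) *
        (((Equiv.Perm.sign σ : ℤ) : ℂ) * F ((v ∘ σ) ∘ p)) := by rw [h1, one_mul]
    _ = _ := by
      rw [show (v ∘ σ) ∘ p = v ∘ (σ * p : Equiv.Perm (Fin m)) from rfl]; ring

lemma altSum_cast {m m' : ℕ} {V : Type*} (h : m = m') (F : (Fin m → V) → ℂ) (v : Fin m' → V) :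
    altSum F (v ∘ Fin.cast h) = altSum (fun u => F (u ∘ Fin.cast h)) v := by
  subst h; rfl

lemma altSum_sum {m : ℕ} {V ι : Type*} (s : Finset ι) (F : ι → (Fin m → V) → ℂ) (v : Fin m → V) :
    altSum (fun u => ∑ i ∈ s, F i u) v = ∑ i ∈ s, altSum (F i) v := by
  unfold altSum
  simp only [Finset.mul_sum]
  exact Finset.sum_comm

lemma altSum_mul {m : ℕ} {V : Type*} (c : ℂ) (F : (Fin m → V) → ℂ) (v : Fin m → V) :
    altSum (fun u => c * F u) v = c * altSum F v := by
  unfold altSum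
  rw [Finset.mul_sum]
  exact Finset.sum_congr rfl fun σ _ => by ring

/-- The permutation of the first block that moves the entry `j` to the front. -/
def frontPerm {a : ℕ} (b : ℕ) (j : Fin (a + 1)) : Equiv.Perm (Fin (a + 1 + b)) :=
  finSumFinEquiv.permCongr (Equiv.sumCongr j.cycleRange.symm (Equiv.refl (Fin b)))

lemma frontPerm_castAdd {a b : ℕ} (j i : Fin (a + 1)) :
    frontPerm b j (Fin.castAdd b i) = Fin.castAdd b (j.cycleRange.symm i) := by
  simp [frontPerm, Equiv.permCongr_apply]

lemma frontPerm_natAdd {a b : ℕ} (j : Fin (a + 1)) (i : Fin b) :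
    frontPerm b j (Fin.natAdd (a + 1) i) = Fin.natAdd (a + 1) i := by
  simp [frontPerm, Equiv.permCongr_apply]

lemma sign_frontPerm {a b : ℕ} (j : Fin (a + 1)) :
    Equiv.Perm.sign (frontPerm b j) = (-1) ^ (j : ℕ) := by
  rw [frontPerm, Equiv.Perm.sign_permCongr, Equiv.Perm.sign_sumCongr, Equiv.Perm.sign_symm,
    Fin.sign_cycleRange]
  simp

/-- The permutation of the second block that moves the entry `j` to the front. -/
def backPerm (a : ℕ) {b : ℕ} (j : Fin (b + 1)) : Equiv.Perm (Fin (a + (b + 1))) :=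
  finSumFinEquiv.permCongr (Equiv.sumCongr (Equiv.refl (Fin a)) j.cycleRange.symm)

lemma backPerm_castAdd {a b : ℕ} (j : Fin (b + 1)) (i : Fin a) :
    backPerm a j (Fin.castAdd (b + 1) i) = Fin.castAdd (b + 1) i := by
  simp [backPerm, Equiv.permCongr_apply]

lemma backPerm_natAdd {a b : ℕ} (j : Fin (b + 1)) (i : Fin (b + 1)) :
    backPerm a j (Fin.natAdd a i) = Fin.natAdd a (j.cycleRange.symm i) := by
  simp [backPerm, Equiv.permCongr_apply]

lemma sign_backPerm {a b : ℕ} (j : Fin (b + 1)) :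
    Equiv.Perm.sign (backPerm a j) = (-1) ^ (j : ℕ) := by
  rw [backPerm, Equiv.Perm.sign_permCongr, Equiv.Perm.sign_sumCongr, Equiv.Perm.sign_symm,
    Fin.sign_cycleRange]
  simp

lemma altSum_front {a b : ℕ} {V : Type*} (K : V → (Fin a → V) → (Fin b → V) → ℂ)
    (v : Fin (a + 1 + b) → V) :
    altSum (fun u => ∑ j : Fin (a + 1), (-1 : ℂ) ^ (j : ℕ) * K (u (Fin.castAdd b j))
        (fun i => u (Fin.castAdd b (j.succAbove i))) fun i => u (Fin.natAdd (a + 1) i)) v =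
      (a + 1) * altSum (fun u => K (u (Fin.castAdd b 0)) (fun i => u (Fin.castAdd b i.succ))
        fun i => u (Fin.natAdd (a + 1) i)) v := by
  rw [altSum_sum]
  have : ∀ j : Fin (a + 1), altSum (fun u => (-1 : ℂ) ^ (j : ℕ) * K (u (Fin.castAdd b j))
        (fun i => u (Fin.castAdd b (j.succAbove i))) fun i => u (Fin.natAdd (a + 1) i)) v =
      altSum (fun u => K (u (Fin.castAdd b 0)) (fun i => u (Fin.castAdd b i.succ))
        fun i => u (Fin.natAdd (a + 1) i)) v := by
    intro j
    have h := altSum_comp_perm (fun u => K (u (Fin.castAdd b 0))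
      (fun i => u (Fin.castAdd b i.succ)) fun i => u (Fin.natAdd (a + 1) i)) (frontPerm b j) v
    simp only [Function.comp_apply, frontPerm_castAdd, frontPerm_natAdd, Fin.cycleRange_symm_zero,
      Fin.cycleRange_symm_succ, sign_frontPerm] at h
    rw [altSum_mul, h, ← mul_assoc]
    have : ((-1 : ℂ) ^ (j : ℕ) * ((((-1 : ℤˣ) ^ (j : ℕ) : ℤˣ) : ℤ) : ℂ)) = 1 := by
      push_cast; rw [← mul_pow]; simp
    rw [this, one_mul]
  simp [this]

lemma altSum_back {a b : ℕ} {V : Type*} (K : V → (Fin a → V) → (Fin b → V) → ℂ)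
    (v : Fin (a + (b + 1)) → V) :
    altSum (fun u => ∑ j : Fin (b + 1), (-1 : ℂ) ^ (j : ℕ) * K (u (Fin.natAdd a j))
        (fun i => u (Fin.castAdd (b + 1) i)) fun i => u (Fin.natAdd a (j.succAbove i))) v =
      (b + 1) * altSum (fun u => K (u (Fin.natAdd a 0)) (fun i => u (Fin.castAdd (b + 1) i))
        fun i => u (Fin.natAdd a i.succ)) v := by
  rw [altSum_sum]
  have : ∀ j : Fin (b + 1), altSum (fun u => (-1 : ℂ) ^ (j : ℕ) * K (u (Fin.natAdd a j))
        (fun i => u (Fin.castAdd (b + 1) i)) fun i => u (Fin.natAdd a (j.succAbove i))) v =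
      altSum (fun u => K (u (Fin.natAdd a 0)) (fun i => u (Fin.castAdd (b + 1) i))
        fun i => u (Fin.natAdd a i.succ)) v := by
    intro j
    have h := altSum_comp_perm (fun u => K (u (Fin.natAdd a 0))
      (fun i => u (Fin.castAdd (b + 1) i)) fun i => u (Fin.natAdd a i.succ)) (backPerm a j) v
    simp only [Function.comp_apply, backPerm_castAdd, backPerm_natAdd, Fin.cycleRange_symm_zero,
      Fin.cycleRange_symm_succ, sign_backPerm] at h
    rw [altSum_mul, h, ← mul_assoc]
    have : ((-1 : ℂ) ^ (j : ℕ) * ((((-1 : ℤˣ) ^ (j : ℕ) : ℤˣ) : ℤ) : ℂ)) = 1 := by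
      push_cast; rw [← mul_pow]; simp
    rw [this, one_mul]
  simp [this]

lemma altSum_front_eq_back {a b : ℕ} {V : Type*} (K : V → (Fin a → V) → (Fin b → V) → ℂ)
    (t : ℕ → V) :
    altSum (fun u => K (u (Fin.castAdd b 0)) (fun i => u (Fin.castAdd b i.succ))
        fun i => u (Fin.natAdd (a + 1) i)) (fun i : Fin (a + 1 + b) => t i) =
      (-1) ^ a * altSum (fun u => K (u (Fin.natAdd a 0)) (fun i => u (Fin.castAdd (b + 1) i))
        fun i => u (Fin.natAdd a i.succ)) (fun i : Fin (a + (b + 1)) => t i) := by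
  have h := altSum_comp_perm (fun u => K (u (Fin.castAdd b 0))
      (fun i => u (Fin.castAdd b i.succ)) fun i => u (Fin.natAdd (a + 1) i))
      (frontPerm b (Fin.last a)) (fun i : Fin (a + 1 + b) => t i)
  simp only [Function.comp_apply, frontPerm_castAdd, frontPerm_natAdd, Fin.cycleRange_symm_zero,
      Fin.cycleRange_symm_succ, sign_frontPerm, Fin.succAbove_last, Fin.val_last] at h
  have hab : a + 1 + b = a + (b + 1) := by omega
  have h2 := altSum_cast hab (fun u => K (u (Fin.castAdd b (Fin.last a)))
      (fun i => u (Fin.castAdd b i.castSucc)) fun i => u (Fin.natAdd (a + 1) i))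
      (fun i : Fin (a + (b + 1)) => t i)
  have h3 : (fun i : Fin (a + (b + 1)) => t i) ∘ Fin.cast hab = fun i : Fin (a + 1 + b) => t i := rfl
  rw [h3, h] at h2
  have h4 : (fun u : Fin (a + (b + 1)) → V => K (u (Fin.natAdd a 0))
      (fun i => u (Fin.castAdd (b + 1) i)) fun i => u (Fin.natAdd a i.succ)) =
      fun u => K ((u ∘ Fin.cast hab) (Fin.castAdd b (Fin.last a)))
      (fun i => (u ∘ Fin.cast hab) (Fin.castAdd b i.castSucc))
      fun i => (u ∘ Fin.cast hab) (Fin.natAdd (a + 1) i) := by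
    funext u
    have e1 : Fin.natAdd a (0 : Fin (b + 1)) = Fin.cast hab (Fin.castAdd b (Fin.last a)) := by
      ext; simp
    have e2 : ∀ i : Fin a, Fin.castAdd (b + 1) i = Fin.cast hab (Fin.castAdd b i.castSucc) := by
      intro i; ext; simp
    have e3 : ∀ i : Fin b, Fin.natAdd a i.succ = Fin.cast hab (Fin.natAdd (a + 1) i) := by
      intro i; ext; simp; omega
    simp only [e1, e2, e3, Function.comp_apply]
  rw [h4, ← h2, ← mul_assoc]
  have : ((-1 : ℂ) ^ a * ((((-1 : ℤˣ) ^ a : ℤˣ) : ℤ) : ℂ)) = 1 := by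
    push_cast; rw [← mul_pow]; simp
  rw [this, one_mul]

variable {n a b : ℕ}

lemma wedgeEval_eq (f : (Fin n → ℂ) [⋀^Fin a]→L[ℝ] ℂ) (g : (Fin n → ℂ) [⋀^Fin b]→L[ℝ] ℂ)
    (t : ℕ → Fin n → ℂ) :
    wedgeEval f g t = (1 / ((a.factorial : ℂ) * (b.factorial : ℂ))) *
      altSum (fun u => (f fun i => u (Fin.castAdd b i)) * g fun i => u (Fin.natAdd a i))
        (fun i : Fin (a + b) => t i) := by
  unfold wedgeEval altSum
  simp only [mul_assoc, Function.comp_apply]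

lemma extDeriv_eq_sum {V : Type*} [NormedAddCommGroup V] [NormedSpace ℝ V]
    {f : V → V [⋀^Fin a]→L[ℝ] ℂ} {x : V} (v : Fin (a + 1) → V) :
    extDeriv f x v = ∑ j : Fin (a + 1), (-1 : ℂ) ^ (j : ℕ) *
      fderiv ℝ f x (v j) fun i => v (j.succAbove i) := by
  rw [extDeriv, ContinuousAlternatingMap.alternatizeUncurryFin_apply]
  refine Finset.sum_congr rfl fun j _ => ?_
  rw [show ((-1 : ℤ) ^ (j : ℕ) • (fderiv ℝ f x (v j)) (j.removeNth v) : ℂ) =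
    (((-1 : ℤ) ^ (j : ℕ) : ℤ) : ℂ) * (fderiv ℝ f x (v j)) (j.removeNth v) from zsmul_eq_mul _ _]
  push_cast
  rfl

lemma wedgeEval_extDeriv_left (f : (Fin n → ℂ) → (Fin n → ℂ) [⋀^Fin a]→L[ℝ] ℂ)
    (g : (Fin n → ℂ) [⋀^Fin b]→L[ℝ] ℂ) (x : Fin n → ℂ) (t : ℕ → Fin n → ℂ) :
    wedgeEval (extDeriv f x) g t = (1 / ((a.factorial : ℂ) * (b.factorial : ℂ))) *
      altSum (fun u => (fderiv ℝ f x (u (Fin.castAdd b 0)) fun i => u (Fin.castAdd b i.succ)) *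
        g fun i => u (Fin.natAdd (a + 1) i)) (fun i : Fin (a + 1 + b) => t i) := by
  rw [wedgeEval_eq]
  simp only [extDeriv_eq_sum, Finset.sum_mul, mul_assoc]
  rw [altSum_front (fun ξ v w => fderiv ℝ f x ξ v * g w), ← mul_assoc]
  congr 1
  rw [Nat.factorial_succ]
  have := Nat.cast_ne_zero (R := ℂ).2 a.factorial_ne_zero
  have := Nat.cast_ne_zero (R := ℂ).2 b.factorial_ne_zero
  have := Nat.cast_ne_zero (R := ℂ).2 a.succ_ne_zero
  push_cast at *
  field_simp

lemma wedgeEval_extDeriv_right (f : (Fin n → ℂ) [⋀^Fin a]→L[ℝ] ℂ)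
    (g : (Fin n → ℂ) → (Fin n → ℂ) [⋀^Fin b]→L[ℝ] ℂ) (x : Fin n → ℂ) (t : ℕ → Fin n → ℂ) :
    wedgeEval f (extDeriv g x) t = (1 / ((a.factorial : ℂ) * (b.factorial : ℂ))) * ((-1) ^ a *
      altSum (fun u => (f fun i => u (Fin.castAdd b i.succ)) *
        fderiv ℝ g x (u (Fin.castAdd b 0)) fun i => u (Fin.natAdd (a + 1) i))
        (fun i : Fin (a + 1 + b) => t i)) := by
  rw [wedgeEval_eq, altSum_front_eq_back (fun ξ v w => f v * fderiv ℝ g x ξ w), ← mul_assoc ((-1) ^ a),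
    ← mul_pow]
  simp only [extDeriv_eq_sum, Finset.mul_sum]
  have h := altSum_back (fun ξ v w => f v * fderiv ℝ g x ξ w) (fun i : Fin (a + (b + 1)) => t i)
  simp only [mul_left_comm _ (f _) _] at h ⊢
  rw [h, ← mul_assoc]
  simp only [mul_neg, mul_one, neg_neg, one_pow, one_mul]
  congr 1
  rw [Nat.factorial_succ]
  have := Nat.cast_ne_zero (R := ℂ).2 a.factorial_ne_zero
  have := Nat.cast_ne_zero (R := ℂ).2 b.factorial_ne_zero
  have := Nat.cast_ne_zero (R := ℂ).2 b.succ_ne_zero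
  push_cast at *
  field_simp

lemma wedgeEval_add_left (f f' : (Fin n → ℂ) [⋀^Fin a]→L[ℝ] ℂ) (g : (Fin n → ℂ) [⋀^Fin b]→L[ℝ] ℂ)
    (t : ℕ → Fin n → ℂ) : wedgeEval (f + f') g t = wedgeEval f g t + wedgeEval f' g t := by
  unfold wedgeEval
  rw [← mul_add, ← Finset.sum_add_distrib]
  congr 1
  refine Finset.sum_congr rfl fun σ _ => ?_
  rw [ContinuousAlternatingMap.add_apply]; ring

lemma wedgeEval_smul_left (c : ℂ) (f : (Fin n → ℂ) [⋀^Fin a]→L[ℝ] ℂ)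
    (g : (Fin n → ℂ) [⋀^Fin b]→L[ℝ] ℂ) (t : ℕ → Fin n → ℂ) :
    wedgeEval (c • f) g t = c * wedgeEval f g t := by
  unfold wedgeEval
  rw [mul_left_comm]
  congr 1
  rw [Finset.mul_sum]
  refine Finset.sum_congr rfl fun σ _ => ?_
  have : (c • f) (fun i => t (σ (Fin.castAdd b i))) = c * f fun i => t (σ (Fin.castAdd b i)) := rfl
  rw [this]; ring

lemma wedgeEval_zero_left (g : (Fin n → ℂ) [⋀^Fin b]→L[ℝ] ℂ) (t : ℕ → Fin n → ℂ) :
    wedgeEval (0 : (Fin n → ℂ) [⋀^Fin a]→L[ℝ] ℂ) g t = 0 := by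
  rw [← zero_smul ℂ (0 : (Fin n → ℂ) [⋀^Fin a]→L[ℝ] ℂ), wedgeEval_smul_left, zero_mul]

lemma wedgeEval_sub_right (f : (Fin n → ℂ) [⋀^Fin a]→L[ℝ] ℂ) (g g' : (Fin n → ℂ) [⋀^Fin b]→L[ℝ] ℂ)
    (t : ℕ → Fin n → ℂ) : wedgeEval f (g - g') t = wedgeEval f g t - wedgeEval f g' t := by
  unfold wedgeEval
  rw [← mul_sub, ← Finset.sum_sub_distrib]
  congr 1
  refine Finset.sum_congr rfl fun σ _ => ?_
  rw [ContinuousAlternatingMap.sub_apply]; ring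

lemma wedgeEval_zero_right (f : (Fin n → ℂ) [⋀^Fin a]→L[ℝ] ℂ) (t : ℕ → Fin n → ℂ) :
    wedgeEval f (0 : (Fin n → ℂ) [⋀^Fin b]→L[ℝ] ℂ) t = 0 := by
  simpa using wedgeEval_sub_right f (0 : (Fin n → ℂ) [⋀^Fin b]→L[ℝ] ℂ) 0 t

lemma norm_wedgeEval_le (n a b : ℕ) (t : ℕ → Fin n → ℂ) : ∃ C : ℝ, 0 ≤ C ∧
    ∀ (f : (Fin n → ℂ) [⋀^Fin a]→L[ℝ] ℂ) (g : (Fin n → ℂ) [⋀^Fin b]→L[ℝ] ℂ),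
      ‖wedgeEval f g t‖ ≤ C * (‖f‖ * ‖g‖) := by
  refine ⟨‖(1 / ((a.factorial : ℂ) * (b.factorial : ℂ)))‖ * ∑ σ : Equiv.Perm (Fin (a + b)),
    ‖((Equiv.Perm.sign σ : ℤ) : ℂ)‖ * ((∏ i, ‖t (σ (Fin.castAdd b i))‖) *
      ∏ j, ‖t (σ (Fin.natAdd a j))‖), by positivity, fun f g => ?_⟩
  unfold wedgeEval
  rw [norm_mul, mul_assoc]
  refine mul_le_mul_of_nonneg_left ?_ (norm_nonneg _)
  refine (norm_sum_le _ _).trans ?_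
  rw [Finset.sum_mul]
  refine Finset.sum_le_sum fun σ _ => ?_
  rw [norm_mul, norm_mul, mul_assoc, mul_assoc]
  refine mul_le_mul_of_nonneg_left ?_ (norm_nonneg _)
  calc _ ≤ (‖f‖ * ∏ i, ‖t (σ (Fin.castAdd b i))‖) * (‖g‖ * ∏ j, ‖t (σ (Fin.natAdd a j))‖) :=
        mul_le_mul (f.le_opNorm _) (g.le_opNorm _) (norm_nonneg _) (by positivity)
    _ = _ := by ring

lemma continuousOn_wedgeEval {W : Type*} [TopologicalSpace W]
    {f : W → (Fin n → ℂ) [⋀^Fin a]→L[ℝ] ℂ} {g : W → (Fin n → ℂ) [⋀^Fin b]→L[ℝ] ℂ} {s : Set W}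
    (hf : ContinuousOn f s) (hg : ContinuousOn g s) (t : ℕ → Fin n → ℂ) :
    ContinuousOn (fun x => wedgeEval (f x) (g x) t) s := by
  have ev : ∀ {m : ℕ} (v : Fin m → Fin n → ℂ),
      Continuous fun F : (Fin n → ℂ) [⋀^Fin m]→L[ℝ] ℂ => F v := fun v =>
    (ContinuousAlternatingMap.apply ℝ (Fin n → ℂ) ℂ v).continuous
  unfold wedgeEval
  refine continuousOn_const.mul (continuousOn_finsetSum _ fun σ _ => ?_)
  exact (continuousOn_const.mul ((ev _).comp_continuousOn hf)).mul ((ev _).comp_continuousOn hg)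

lemma wedgeEval_compContinuousLinearMap (hab : a + b = 2 * n)
    (f : (Fin n → ℂ) [⋀^Fin a]→L[ℝ] ℂ) (g : (Fin n → ℂ) [⋀^Fin b]→L[ℝ] ℂ)
    (A : (Fin n → ℂ) →L[ℝ] Fin n → ℂ) (t : ℕ → Fin n → ℂ) :
    wedgeEval (f.compContinuousLinearMap A) (g.compContinuousLinearMap A) t =
      ((LinearMap.det (A : (Fin n → ℂ) →ₗ[ℝ] Fin n → ℂ) : ℝ) : ℂ) * wedgeEval f g t := by
  have hfin : Module.finrank ℝ (Fin n → ℂ) = a + b := by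
    rw [finrank_real_of_complex, Module.finrank_fin_fun, hab]
  let e := Module.finBasisOfFinrankEq ℝ (Fin n → ℂ) hfin
  have key : ∀ L : ℂ →ₗ[ℝ] ℝ, ∀ v : Fin (a + b) → Fin n → ℂ,
      L (altSum (fun u => (f fun i => A (u (Fin.castAdd b i))) * g fun i => A (u (Fin.natAdd a i))) v) =
      LinearMap.det (A : (Fin n → ℂ) →ₗ[ℝ] Fin n → ℂ) *
      L (altSum (fun u => (f fun i => u (Fin.castAdd b i)) * g fun i => u (Fin.natAdd a i)) v) := by
    intro L v
    let M : MultilinearMap ℝ (fun _ : Fin (a + b) => Fin n → ℂ) ℝ :=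
      (L ∘ₗ LinearMap.mul' ℝ ℂ).compMultilinearMap
        ((f.toMultilinearMap.domCoprod g.toMultilinearMap).domDomCongr finSumFinEquiv)
    have hM : ∀ u, M u = L ((f fun i => u (Fin.castAdd b i)) * g fun i => u (Fin.natAdd a i)) := by
      intro u; rfl
    let N := MultilinearMap.alternatization M
    have hN : ∀ u, N u =
        L (altSum (fun u => (f fun i => u (Fin.castAdd b i)) * g fun i => u (Fin.natAdd a i)) u) := by
      intro u
      simp only [N, MultilinearMap.alternatization_apply, altSum, map_sum]
      refine Finset.sum_congr rfl fun σ _ => ?_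
      rw [MultilinearMap.domDomCongr_apply, hM]
      rcases Int.units_eq_one_or (Equiv.Perm.sign σ) with h | h <;> simp [h]
    rw [← hN, show L (altSum (fun u => (f fun i => A (u (Fin.castAdd b i))) *
      g fun i => A (u (Fin.natAdd a i))) v) = N (A ∘ v) from ?_]
    · rw [N.eq_smul_basis_det e]
      simp only [AlternatingMap.smul_apply, smul_eq_mul]
      rw [show (A ∘ v) = ((A : (Fin n → ℂ) →ₗ[ℝ] Fin n → ℂ) ∘ v) from rfl, Module.Basis.det_comp]
      ring
    · rw [hN]; rfl
  have h1 := key Complex.reLm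
  have h2 := key Complex.imLm
  rw [wedgeEval_eq, wedgeEval_eq, mul_left_comm]
  congr 1
  apply Complex.ext
  · rw [Complex.re_ofReal_mul]; exact h1 _
  · rw [Complex.im_ofReal_mul]; exact h2 _

/-- The real determinant of a complex linear map is the square of the modulus of the complex one. -/
lemma det_restrictScalars_complex (A : (Fin n → ℂ) →ₗ[ℂ] Fin n → ℂ) :
    LinearMap.det (A.restrictScalars ℝ) = Complex.normSq (LinearMap.det A) := by
  rw [LinearMap.det_restrictScalars, Algebra.norm_complex_apply]

open MeasureTheory in
/-- Integration by parts for the wedge product on an open set of `ℂⁿ`. -/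
lemma integral_wedgeEval_extDeriv {f : (Fin n → ℂ) → (Fin n → ℂ) [⋀^Fin a]→L[ℝ] ℂ}
    {g : (Fin n → ℂ) → (Fin n → ℂ) [⋀^Fin b]→L[ℝ] ℂ} {U : Set (Fin n → ℂ)} (hU : IsOpen U)
    (hf : ContDiff ℝ ∞ f) (hc : HasCompactSupport f) (hfU : tsupport f ⊆ U)
    (hg : ContDiffOn ℝ ∞ g U) (t : ℕ → Fin n → ℂ) :
    ∫ x, wedgeEval (extDeriv f x) (g x) t = (-1) ^ (a + 1) * ∫ x, wedgeEval (f x) (extDeriv g x) t := by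
  have evc : ∀ {m : ℕ} (v : Fin m → Fin n → ℂ),
      Continuous fun F : (Fin n → ℂ) [⋀^Fin m]→L[ℝ] ℂ => F v := fun v =>
    (ContinuousAlternatingMap.apply ℝ (Fin n → ℂ) ℂ v).continuous
  have hfd : ∀ x, DifferentiableAt ℝ f x := fun x => (hf.differentiable (by simp)) x
  have hgd : ∀ x ∈ U, DifferentiableAt ℝ g x := fun x hx =>
    ((hg x hx).contDiffAt (hU.mem_nhds hx)).differentiableAt (by simp)
  have hf' : Continuous (fderiv ℝ f) := hf.continuous_fderiv (by simp)
  have hg' : ContinuousOn (fderiv ℝ g) U := hg.continuousOn_fderiv_of_isOpen hU (by simp)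
  -- integrability from support and continuity on `U`
  have hint : ∀ F : (Fin n → ℂ) → ℂ, ContinuousOn F U → (∀ x, x ∉ tsupport f → F x = 0) →
      Integrable F := by
    intro F hF h0
    have hs : tsupport F ⊆ tsupport f := by
      apply closure_minimal _ (isClosed_tsupport f)
      intro x hx
      by_contra h
      exact hx (h0 x h)
    have hcF : Continuous F := by
      rw [continuous_iff_continuousAt]
      intro x
      by_cases hx : x ∈ U
      · exact (hF x hx).continuousAt (hU.mem_nhds hx)
      · have : F =ᶠ[𝓝 x] fun _ => 0 := by
          have : (tsupport f)ᶜ ∈ 𝓝 x := (isClosed_tsupport f).isOpen_compl.mem_nhds fun h => hx (hfU h)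
          filter_upwards [this] with y hy using h0 y hy
        exact continuousAt_const.congr this.symm
    exact hcF.integrable_of_hasCompactSupport (hc.of_isClosed_subset (isClosed_tsupport F) hs)
  have hf0 : ∀ x, x ∉ tsupport f → f x = 0 := fun x hx => image_eq_zero_of_notMem_tsupport hx
  have hf'0 : ∀ x, x ∉ tsupport f → fderiv ℝ f x = 0 := fun x hx => by
    by_contra h
    exact hx (support_fderiv_subset ℝ h)
  -- the statement for each component
  have hcomp : ∀ (ξ : Fin n → ℂ) (v : Fin a → Fin n → ℂ) (w : Fin b → Fin n → ℂ),
      Integrable (fun x => fderiv ℝ f x ξ v * g x w) ∧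
      Integrable (fun x => f x v * fderiv ℝ g x ξ w) ∧
      ∫ x, fderiv ℝ f x ξ v * g x w = -∫ x, f x v * fderiv ℝ g x ξ w := by
    intro ξ v w
    let ev : ∀ {m : ℕ} (v : Fin m → Fin n → ℂ), ((Fin n → ℂ) [⋀^Fin m]→L[ℝ] ℂ) →L[ℝ] ℂ := fun v =>
      ContinuousAlternatingMap.apply ℝ (Fin n → ℂ) ℂ v
    have hev : ∀ {m : ℕ} (v : Fin m → Fin n → ℂ) (F : (Fin n → ℂ) [⋀^Fin m]→L[ℝ] ℂ), ev v F = F v :=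
      fun v F => rfl
    have d1 : ∀ x, HasFDerivAt (fun x => f x v) ((ev v).comp (fderiv ℝ f x)) x := fun x =>
      (ev v).hasFDerivAt.comp x (hfd x).hasFDerivAt
    have d2 : ∀ x ∈ U, HasFDerivAt (fun x => g x w) ((ev w).comp (fderiv ℝ g x)) x := fun x hx =>
      (ev w).hasFDerivAt.comp x (hgd x hx).hasFDerivAt
    have cg : ContinuousOn (fun x => g x w) U := (evc w).comp_continuousOn hg.continuousOn
    have cf : ContinuousOn (fun x => f x v) U := ((evc v).comp hf.continuous).continuousOn
    have cf' : ContinuousOn (fun x => fderiv ℝ f x ξ v) U :=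
      ((evc v).comp (hf'.clm_apply continuous_const)).continuousOn
    have cg' : ContinuousOn (fun x => fderiv ℝ g x ξ w) U :=
      (evc w).comp_continuousOn (hg'.clm_apply continuousOn_const)
    have i1 := hint (fun x => fderiv ℝ f x ξ v * g x w) (cf'.mul cg) fun x hx => by
      simp [hf'0 x hx]
    have i2 := hint (fun x => f x v * fderiv ℝ g x ξ w) (cf.mul cg') fun x hx => by
      simp [hf0 x hx]
    have i3 := hint (fun x => f x v * g x w) (cf.mul cg) fun x hx => by
      simp [hf0 x hx]
    refine ⟨i1, i2, ?_⟩
    have := integral_bilinear_hasFDerivAt_right_eq_neg_left_of_integrable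
      (μ := (volume : Measure (Fin n → ℂ))) (v := ξ) (f := fun x => f x v) (g := fun x => g x w)
      (f' := fun x => (ev v).comp (fderiv ℝ f x)) (g' := fun x => (ev w).comp (fderiv ℝ g x))
      (B := ContinuousLinearMap.mul ℝ ℂ) (by simpa [hev] using i1) (by simpa [hev] using i2)
      (by simpa using i3) (fun x _ => d1 x) (fun x hx => d2 x (hfU (by
        refine closure_mono ?_ hx
        intro y hy hy'
        exact hy (by simp [hy']))))
    simp only [ContinuousLinearMap.mul_apply', ContinuousLinearMap.comp_apply, hev] at this
    rw [this, neg_neg]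
  simp only [wedgeEval_extDeriv_left, wedgeEval_extDeriv_right]
  rw [integral_const_mul, integral_const_mul, integral_const_mul]
  unfold altSum
  rw [integral_finsetSum _ fun σ _ => (hcomp _ _ _).1.const_mul _,
    integral_finsetSum _ fun σ _ => (hcomp _ _ _).2.1.const_mul _]
  simp only [integral_const_mul, Function.comp_apply, (hcomp _ _ _).2.2]
  rw [mul_left_comm, pow_succ]
  congr 1
  rw [← mul_assoc, mul_neg_one, neg_mul, ← mul_pow]
  simp

end Wedge

/-! ## Forms on complex manifolds -/

section ManifoldForms

lemma contMDiffAt_real {E F M N : Type*} [NormedAddCommGroup E] [NormedSpace ℂ E]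
    [NormedAddCommGroup F] [NormedSpace ℂ F] [TopologicalSpace M] [ChartedSpace E M]
    [TopologicalSpace N] [ChartedSpace F N] {f : M → N} {x : M}
    (h : ContMDiffAt 𝓘(ℂ, E) 𝓘(ℂ, F) ω f x) : ContMDiffAt 𝓘(ℝ, E) 𝓘(ℝ, F) ∞ f x := by
  rw [contMDiffAt_iff] at h ⊢
  refine ⟨h.1, ?_⟩
  have := (h.2.restrict_scalars ℝ).of_le (m := ∞) le_top
  simpa using this

variable {n m a b : ℕ} {X : Type u} [TopologicalSpace X] [ChartedSpace (Fin n → ℂ) X]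

/-- The smooth real manifold underlying a complex manifold. -/
lemma isManifold_real [IsManifold 𝓘(ℂ, Fin n → ℂ) ω X] : IsManifold 𝓘(ℝ, Fin n → ℂ) ∞ X := by
  apply isManifold_of_contDiffOn
  intro e e' he he'
  have h := HasGroupoid.compatible (G := contDiffGroupoid ω 𝓘(ℂ, Fin n → ℂ)) he he'
  rw [contDiffGroupoid, mem_groupoid_of_pregroupoid] at h
  have h' : ContDiffOn ℂ ω _ _ := h.1
  have := (h'.restrict_scalars ℝ).of_le (m := ∞) le_top
  simpa using this

/-- A chart of the maximal holomorphic atlas. -/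
abbrev IsHolChart (z : OpenPartialHomeomorph X (Fin n → ℂ)) : Prop :=
  z ∈ IsManifold.maximalAtlas 𝓘(ℂ, Fin n → ℂ) ω X

lemma isHolChart_of_mem_atlas [IsManifold 𝓘(ℂ, Fin n → ℂ) ω X] {φ : OpenPartialHomeomorph X (Fin n → ℂ)}
    (h : φ ∈ atlas (Fin n → ℂ) X) : IsHolChart φ := IsManifold.subset_maximalAtlas h

section Charts
variable {z φ : OpenPartialHomeomorph X (Fin n → ℂ)}

lemma IsHolChart.contMDiffAt (hz : IsHolChart z) {x : X} (hx : x ∈ z.source) :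
    ContMDiffAt 𝓘(ℂ, Fin n → ℂ) 𝓘(ℂ, Fin n → ℂ) ω z x :=
  contMDiffAt_of_mem_maximalAtlas hz hx

lemma IsHolChart.contMDiffAt_symm (hz : IsHolChart z) {t : Fin n → ℂ} (ht : t ∈ z.target) :
    ContMDiffAt 𝓘(ℂ, Fin n → ℂ) 𝓘(ℂ, Fin n → ℂ) ω z.symm t :=
  contMDiffAt_symm_of_mem_maximalAtlas hz ht

lemma IsHolChart.transition (hφ : IsHolChart φ) (hz : IsHolChart z) {t : Fin n → ℂ} (ht : t ∈ z.target)
    (ht' : z.symm t ∈ φ.source) : ContDiffAt ℂ ω (fun t => φ (z.symm t)) t := by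
  have := (hφ.contMDiffAt ht').comp t (hz.contMDiffAt_symm ht)
  exact contMDiffAt_iff_contDiffAt.1 this

lemma IsHolChart.mdifferentiableAt (hz : IsHolChart z) {x : X} (hx : x ∈ z.source) :
    MDifferentiableAt 𝓘(ℝ, Fin n → ℂ) 𝓘(ℝ, Fin n → ℂ) z x :=
  (contMDiffAt_real (hz.contMDiffAt hx)).mdifferentiableAt (by simp)

lemma IsHolChart.mdifferentiableAt_symm (hz : IsHolChart z) {t : Fin n → ℂ} (ht : t ∈ z.target) :
    MDifferentiableAt 𝓘(ℝ, Fin n → ℂ) 𝓘(ℝ, Fin n → ℂ) z.symm t :=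
  (contMDiffAt_real (hz.contMDiffAt_symm ht)).mdifferentiableAt (by simp)

end Charts

/-- The pullback of a form along a map defined on an open set of `ℂⁿ`. -/
def pb (ψ : (Fin n → ℂ) → X) (f : DForm n m X) (t : Fin n → ℂ) : (Fin n → ℂ) [⋀^Fin m]→L[ℝ] ℂ :=
  (f (ψ t)).compContinuousLinearMap (mfderiv 𝓘(ℝ, Fin n → ℂ) 𝓘(ℝ, Fin n → ℂ) ψ t)

lemma localRep_eq_pb (φ : OpenPartialHomeomorph X (Fin n → ℂ)) (f : DForm n m X) :
    localRep φ f = pb φ.symm f := rfl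

lemma mfderiv_eq_of_chart {φ : OpenPartialHomeomorph X (Fin n → ℂ)} (hφ : IsHolChart φ)
    {ψ : (Fin n → ℂ) → X} {t : Fin n → ℂ}
    (hψ : MDifferentiableAt 𝓘(ℝ, Fin n → ℂ) 𝓘(ℝ, Fin n → ℂ) ψ t) (ht : ψ t ∈ φ.source) :
    mfderiv 𝓘(ℝ, Fin n → ℂ) 𝓘(ℝ, Fin n → ℂ) ψ t =
      (mfderiv 𝓘(ℝ, Fin n → ℂ) 𝓘(ℝ, Fin n → ℂ) φ.symm (φ (ψ t))).comp
        (fderiv ℝ (fun x => φ (ψ x)) t) := by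
  have h1 : ψ =ᶠ[𝓝 t] φ.symm ∘ fun x => φ (ψ x) := by
    filter_upwards [hψ.continuousAt (φ.open_source.mem_nhds ht)] with x hx
    exact (φ.left_inv hx).symm
  have h2 : MDifferentiableAt 𝓘(ℝ, Fin n → ℂ) 𝓘(ℝ, Fin n → ℂ) (fun x => φ (ψ x)) t :=
    (hφ.mdifferentiableAt ht).comp t hψ
  rw [h1.mfderiv_eq, mfderiv_comp t (hφ.mdifferentiableAt_symm (φ.map_source ht)) h2,
    mfderiv_eq_fderiv]
  rfl

lemma pb_eq {φ : OpenPartialHomeomorph X (Fin n → ℂ)} (hφ : IsHolChart φ) {ψ : (Fin n → ℂ) → X}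
    {t : Fin n → ℂ} (hψ : MDifferentiableAt 𝓘(ℝ, Fin n → ℂ) 𝓘(ℝ, Fin n → ℂ) ψ t)
    (ht : ψ t ∈ φ.source) (f : DForm n m X) :
    pb ψ f t = (localRep φ f (φ (ψ t))).compContinuousLinearMap (fderiv ℝ (fun x => φ (ψ x)) t) := by
  unfold pb localRep
  rw [mfderiv_eq_of_chart hφ hψ ht, φ.left_inv ht]
  rfl

lemma contDiffAt_compContinuousLinearMap {W V V' : Type*} [NormedAddCommGroup W] [NormedSpace ℝ W]
    [NormedAddCommGroup V] [NormedSpace ℝ V] [FiniteDimensional ℝ V]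
    [NormedAddCommGroup V'] [NormedSpace ℝ V'] [FiniteDimensional ℝ V']
    {F : W → V [⋀^Fin m]→L[ℝ] ℂ} {A : W → V' →L[ℝ] V} {t : W} {N : WithTop ℕ∞}
    (hF : ContDiffAt ℝ N F t) (hA : ContDiffAt ℝ N A t) :
    ContDiffAt ℝ N (fun x => (F x).compContinuousLinearMap (A x)) t := by
  refine contDiffAt_cam fun v => ?_
  let e := Module.finBasis ℝ V
  have h : ∀ x, (F x).compContinuousLinearMap (A x) v =
      ∑ I : Fin m → Fin (Module.finrank ℝ V), (∏ i, e.repr (A x (v i)) (I i)) • F x fun i => e (I i) := by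
    intro x
    have : (fun i => A x (v i)) = fun i => ∑ j, e.repr (A x (v i)) j • e j := by
      funext i; exact (e.sum_repr _).symm
    calc (F x).compContinuousLinearMap (A x) v = (F x).toMultilinearMap fun i => A x (v i) := rfl
      _ = _ := by
        rw [this, MultilinearMap.map_sum]
        refine Finset.sum_congr rfl fun I _ => ?_
        rw [MultilinearMap.map_smul_univ]
        rfl
  simp only [h]
  refine ContDiffAt.sum fun I _ => ?_
  have h1 : ContDiffAt ℝ N (fun x => ∏ i, e.repr (A x (v i)) (I i)) t := by
    refine contDiffAt_prod fun i _ => ?_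
    have := (LinearMap.toContinuousLinearMap (e.coord (I i))).contDiff.contDiffAt.comp t
      (hA.clm_apply (contDiffAt_const (c := v i)))
    exact this
  have h2 : ContDiffAt ℝ N (fun x => F x fun i => e (I i)) t :=
    (ContinuousAlternatingMap.apply ℝ V ℂ fun i => e (I i)).contDiff.contDiffAt.comp t hF
  exact h1.smul h2

lemma contDiffAt_pb [IsManifold 𝓘(ℂ, Fin n → ℂ) ω X] {f : DForm n m X} {U : Set X} (hU : IsOpen U)
    (hf : IsSmoothFormOn f U) {ψ : (Fin n → ℂ) → X} {t : Fin n → ℂ}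
    (hψ : ContMDiffAt 𝓘(ℝ, Fin n → ℂ) 𝓘(ℝ, Fin n → ℂ) ∞ ψ t) (ht : ψ t ∈ U) :
    ContDiffAt ℝ ∞ (pb ψ f) t := by
  have : IsManifold 𝓘(ℝ, Fin n → ℂ) ∞ X := isManifold_real
  set φ := chartAt (Fin n → ℂ) (ψ t) with hφ
  have hφa : φ ∈ atlas (Fin n → ℂ) X := chart_mem_atlas _ _
  have hφc : IsHolChart φ := isHolChart_of_mem_atlas hφa
  have hts : ψ t ∈ φ.source := mem_chart_source _ _
  have hloc : ∀ᶠ x in 𝓝 t, MDifferentiableAt 𝓘(ℝ, Fin n → ℂ) 𝓘(ℝ, Fin n → ℂ) ψ x ∧ ψ x ∈ φ.source := by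
    have h1 := (contMDiffAt_iff_contMDiffAt_nhds (by simp)).1 (hψ.of_le (n := ∞) (m := 1) (by simp))
    have h2 := hψ.continuousAt (φ.open_source.mem_nhds hts)
    filter_upwards [h1, h2] with x hx hx2 using ⟨hx.mdifferentiableAt (by simp), hx2⟩
  have heq : pb ψ f =ᶠ[𝓝 t] fun x => (localRep φ f (φ (ψ x))).compContinuousLinearMap
      (fderiv ℝ (fun x => φ (ψ x)) x) := by
    filter_upwards [hloc] with x hx using pb_eq hφc hx.1 hx.2 f
  have hcomp : ContDiffAt ℝ ∞ (fun x => φ (ψ x)) t :=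
    contMDiffAt_iff_contDiffAt.1 ((contMDiffAt_real (hφc.contMDiffAt hts)).comp t hψ)
  refine ContDiffAt.congr_of_eventuallyEq ?_ heq
  refine contDiffAt_compContinuousLinearMap ?_ (hcomp.fderiv_right (m := ∞) (by simp))
  have h3 : ContDiffAt ℝ ∞ (localRep φ f) (φ (ψ t)) := by
    refine (hf φ hφa).contDiffAt ?_
    refine (φ.isOpen_inter_preimage_symm hU).mem_nhds ⟨φ.map_source hts, ?_⟩
    simpa [φ.left_inv hts] using ht
  exact h3.comp t hcomp

lemma extDeriv_pb [IsManifold 𝓘(ℂ, Fin n → ℂ) ω X] {f : DForm n m X} {U : Set X} (hU : IsOpen U)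
    (hf : IsSmoothFormOn f U) {ψ : (Fin n → ℂ) → X} {t : Fin n → ℂ}
    (hψ : ContMDiffAt 𝓘(ℝ, Fin n → ℂ) 𝓘(ℝ, Fin n → ℂ) ∞ ψ t) (ht : ψ t ∈ U) :
    pb ψ (extD f) t = extDeriv (pb ψ f) t := by
  have : IsManifold 𝓘(ℝ, Fin n → ℂ) ∞ X := isManifold_real
  set φ := chartAt (Fin n → ℂ) (ψ t) with hφ
  have hφa : φ ∈ atlas (Fin n → ℂ) X := chart_mem_atlas _ _
  have hφc : IsHolChart φ := isHolChart_of_mem_atlas hφa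
  have hts : ψ t ∈ φ.source := mem_chart_source _ _
  have hloc : ∀ᶠ x in 𝓝 t, MDifferentiableAt 𝓘(ℝ, Fin n → ℂ) 𝓘(ℝ, Fin n → ℂ) ψ x ∧ ψ x ∈ φ.source := by
    have h1 := (contMDiffAt_iff_contMDiffAt_nhds (by simp)).1 (hψ.of_le (n := ∞) (m := 1) (by simp))
    have h2 := hψ.continuousAt (φ.open_source.mem_nhds hts)
    filter_upwards [h1, h2] with x hx hx2 using ⟨hx.mdifferentiableAt (by simp), hx2⟩
  have heq : pb ψ f =ᶠ[𝓝 t] fun x => (localRep φ f (φ (ψ x))).compContinuousLinearMap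
      (fderiv ℝ (fun x => φ (ψ x)) x) := by
    filter_upwards [hloc] with x hx using pb_eq hφc hx.1 hx.2 f
  have hcomp : ContDiffAt ℝ ∞ (fun x => φ (ψ x)) t :=
    contMDiffAt_iff_contDiffAt.1 ((contMDiffAt_real (hφc.contMDiffAt hts)).comp t hψ)
  have h3 : ContDiffAt ℝ ∞ (localRep φ f) (φ (ψ t)) := by
    refine (hf φ hφa).contDiffAt ?_
    refine (φ.isOpen_inter_preimage_symm hU).mem_nhds ⟨φ.map_source hts, ?_⟩
    simpa [φ.left_inv hts] using ht
  rw [heq.extDeriv_eq, _root_.extDeriv_pullback (f := fun x => φ (ψ x)) (h3.differentiableAt (by simp)) hcomp two_le_smooth]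
  have h4 : fderiv ℝ (fun x => φ (ψ x)) t =
      (mfderiv 𝓘(ℝ, Fin n → ℂ) 𝓘(ℝ, Fin n → ℂ) φ (ψ t)).comp
        (mfderiv 𝓘(ℝ, Fin n → ℂ) 𝓘(ℝ, Fin n → ℂ) ψ t) := by
    rw [← mfderiv_eq_fderiv]
    exact mfderiv_comp t (hφc.mdifferentiableAt hts) (hψ.mdifferentiableAt (by simp))
  rw [h4]
  rfl

lemma isSmoothForm_iff {f : DForm n m X} :
    IsSmoothForm f ↔ ∀ φ ∈ atlas (Fin n → ℂ) X, ContDiffOn ℝ ∞ (localRep φ f) φ.target := by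
  simp [IsSmoothForm, IsSmoothFormOn]

variable [IsManifold 𝓘(ℂ, Fin n → ℂ) ω X]

lemma IsSmoothForm.contDiffOn_localRep {f : DForm n m X} (hf : IsSmoothForm f)
    {z : OpenPartialHomeomorph X (Fin n → ℂ)} (hz : IsHolChart z) :
    ContDiffOn ℝ ∞ (localRep z f) z.target := fun _ ht =>
  (contDiffAt_pb isOpen_univ hf (contMDiffAt_real (hz.contMDiffAt_symm ht)) trivial).contDiffWithinAt

lemma IsSmoothForm.localRep_extD {f : DForm n m X} (hf : IsSmoothForm f)
    {z : OpenPartialHomeomorph X (Fin n → ℂ)} (hz : IsHolChart z) {t : Fin n → ℂ} (ht : t ∈ z.target) :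
    localRep z (extD f) t = extDeriv (localRep z f) t :=
  extDeriv_pb isOpen_univ hf (contMDiffAt_real (hz.contMDiffAt_symm ht)) trivial

lemma contDiffAt_extDeriv {V : Type*} [NormedAddCommGroup V] [NormedSpace ℝ V]
    {f : V → V [⋀^Fin m]→L[ℝ] ℂ} {t : V} (hf : ContDiffAt ℝ ∞ f t) :
    ContDiffAt ℝ ∞ (extDeriv f) t := by
  let L : (V →L[ℝ] V [⋀^Fin m]→L[ℝ] ℂ) →L[ℝ] V [⋀^Fin (m + 1)]→L[ℝ] ℂ :=
    ContinuousAlternatingMap.alternatizeUncurryFinCLM ℝ V ℂ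
  have hL : extDeriv f = L ∘ fderiv ℝ f := rfl
  rw [hL]
  exact L.contDiff.contDiffAt.comp t (hf.fderiv_right (m := ∞) (by simp))

lemma IsSmoothForm.extD {f : DForm n m X} (hf : IsSmoothForm f) : IsSmoothForm (extD f) := by
  rw [isSmoothForm_iff]
  intro φ hφ
  have hφ' := isHolChart_of_mem_atlas hφ
  refine ContDiffOn.congr (f := extDeriv (localRep φ f)) ?_ fun t ht => hf.localRep_extD hφ' ht
  intro t ht
  exact (contDiffAt_extDeriv ((hf.contDiffOn_localRep hφ').contDiffAt
    (φ.open_target.mem_nhds ht))).contDiffWithinAt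

omit [IsManifold 𝓘(ℂ, Fin n → ℂ) ω X] in
lemma localRep_add (φ : OpenPartialHomeomorph X (Fin n → ℂ)) (f g : DForm n m X) :
    localRep φ (f + g) = localRep φ f + localRep φ g := rfl

omit [IsManifold 𝓘(ℂ, Fin n → ℂ) ω X] in
lemma pb_smul (ψ : (Fin n → ℂ) → X) (ρ : X → ℂ) (f : DForm n m X) (t : Fin n → ℂ) :
    pb ψ (fun x => ρ x • f x) t = ρ (ψ t) • pb ψ f t := rfl

omit [IsManifold 𝓘(ℂ, Fin n → ℂ) ω X] in
lemma IsSmoothForm.add {f g : DForm n m X} (hf : IsSmoothForm f) (hg : IsSmoothForm g) :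
    IsSmoothForm (f + g) := fun φ hφ => (hf φ hφ).add (hg φ hφ)

omit [IsManifold 𝓘(ℂ, Fin n → ℂ) ω X] in
lemma IsSmoothForm.zero : IsSmoothForm (0 : DForm n m X) := fun _ _ => contDiffOn_const (c := 0)

omit [IsManifold 𝓘(ℂ, Fin n → ℂ) ω X] in
lemma IsSmoothForm.sum {ι : Type*} (s : Finset ι) {f : ι → DForm n m X}
    (hf : ∀ i ∈ s, IsSmoothForm (f i)) : IsSmoothForm (∑ i ∈ s, f i) :=
  Finset.sum_induction f IsSmoothForm (fun _ _ => IsSmoothForm.add) IsSmoothForm.zero hf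

lemma IsSmoothForm.smul {f : DForm n m X} (hf : IsSmoothForm f) {ρ : X → ℂ}
    (hρ : ContMDiff 𝓘(ℝ, Fin n → ℂ) 𝓘(ℝ, ℂ) ∞ ρ) : IsSmoothForm (fun x => ρ x • f x) := by
  rw [isSmoothForm_iff] at hf ⊢
  intro φ hφ t ht
  have h1 : ContDiffAt ℝ ∞ (fun t => ρ (φ.symm t)) t := contMDiffAt_iff_contDiffAt.1
    ((hρ _).comp t (contMDiffAt_real ((isHolChart_of_mem_atlas hφ).contMDiffAt_symm ht)))
  exact h1.contDiffWithinAt.smul (hf φ hφ t ht)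

lemma extD_add {f g : DForm n m X} (hf : IsSmoothForm f) (hg : IsSmoothForm g) :
    extD (f + g) = extD f + extD g := by
  funext x
  have hd : ∀ {f : DForm n m X}, IsSmoothForm f →
      DifferentiableAt ℝ (localRep (chartAt (Fin n → ℂ) x) f) (chartAt (Fin n → ℂ) x x) := fun hf =>
    ((hf.contDiffOn_localRep (isHolChart_of_mem_atlas (chart_mem_atlas _ x))).contDiffAt
      ((chartAt _ x).open_target.mem_nhds (mem_chart_target _ x))).differentiableAt (by simp)
  unfold ParChernWeil.extD
  rw [localRep_add, extDeriv_add (hd hf) (hd hg)]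
  rfl

omit [IsManifold 𝓘(ℂ, Fin n → ℂ) ω X] in
lemma extD_zero : extD (0 : DForm n m X) = 0 := by
  funext x
  unfold ParChernWeil.extD
  rw [show localRep (chartAt (Fin n → ℂ) x) (0 : DForm n m X) = 0 from rfl]
  have : extDeriv (0 : (Fin n → ℂ) → (Fin n → ℂ) [⋀^Fin m]→L[ℝ] ℂ) (chartAt (Fin n → ℂ) x x) = 0 := by
    ext v
    rw [extDeriv_eq_sum]
    simp
  rw [this]
  rfl

lemma extD_sum {ι : Type*} (s : Finset ι) {f : ι → DForm n m X} (hf : ∀ i ∈ s, IsSmoothForm (f i)) :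
    extD (∑ i ∈ s, f i) = ∑ i ∈ s, extD (f i) := by
  classical
  induction s using Finset.induction_on with
  | empty => simpa using extD_zero
  | insert i s hi ih =>
    rw [Finset.sum_insert hi, Finset.sum_insert hi, extD_add (hf i (by simp))
      (IsSmoothForm.sum s fun j hj => hf j (by simp [hj])), ih fun j hj => hf j (by simp [hj])]

omit [IsManifold 𝓘(ℂ, Fin n → ℂ) ω X] in
/-- The exterior derivative of a form is supported in the support of the form. -/
lemma support_extD [IsManifold 𝓘(ℂ, Fin n → ℂ) ω X] (f : DForm n m X) : {x | extD f x ≠ 0} ⊆ closure {x | f x ≠ 0} := by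
  intro x hx
  by_contra h
  apply hx
  have h1 : ∀ᶠ t in 𝓝 (chartAt (Fin n → ℂ) x x), localRep (chartAt (Fin n → ℂ) x) f t = 0 := by
    have hc := (chartAt (Fin n → ℂ) x).continuousAt_symm (mem_chart_target _ x)
    have : (closure {x | f x ≠ 0})ᶜ ∈ 𝓝 ((chartAt (Fin n → ℂ) x).symm (chartAt (Fin n → ℂ) x x)) := by
      rw [(chartAt (Fin n → ℂ) x).left_inv (mem_chart_source _ x)]
      exact isClosed_closure.isOpen_compl.mem_nhds h
    filter_upwards [hc this] with t ht
    have : f ((chartAt (Fin n → ℂ) x).symm t) = 0 := by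
      by_contra h'
      exact ht (subset_closure h')
    unfold localRep
    rw [this]
    rfl
  unfold ParChernWeil.extD
  have h2 : extDeriv (localRep (chartAt (Fin n → ℂ) x) f) (chartAt (Fin n → ℂ) x x) = 0 := by
    have : localRep (chartAt (Fin n → ℂ) x) f =ᶠ[𝓝 (chartAt (Fin n → ℂ) x x)] 0 := h1
    rw [this.extDeriv_eq]
    ext v
    rw [extDeriv_eq_sum]
    simp
  rw [h2]
  rfl

end ManifoldForms

/-! ## Integration over branched charts -/

section Branched

open MeasureTheory

variable {n m a b : ℕ}

/-- `P` is a proper holomorphic self-map of `ℂⁿ` that is generically `N` to one, with the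
corresponding change of variables. -/
structure IsBranchedCover (P : (Fin n → ℂ) → Fin n → ℂ) (N : ℕ) : Prop where
  pos : 0 < N
  hol : ContDiff ℂ ω P
  proper : ∀ K, IsCompact K → IsCompact (P ⁻¹' K)
  integral : ∀ (V : Set (Fin n → ℂ)) (F : (Fin n → ℂ) → ℂ), MeasurableSet V →
    IntegrableOn (fun t => |(fderiv ℝ P t).det| • F (P t)) (P ⁻¹' V) →
      IntegrableOn F V ∧ N * ∫ t in V, F t = ∫ t in P ⁻¹' V, |(fderiv ℝ P t).det| • F (P t)

lemma isBranchedCover_id : IsBranchedCover (id : (Fin n → ℂ) → Fin n → ℂ) 1 where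
  pos := one_pos
  hol := contDiff_id
  proper := fun K hK => hK
  integral := fun V F _ h => by
    simp only [fderiv_id, ContinuousLinearMap.det] at h ⊢
    simpa using h

lemma contDiff_powerMap (i : Fin n) (N : ℕ) : ContDiff ℂ ω (powerMap i N) := by
  rw [contDiff_pi]
  intro j
  by_cases h : j = i
  · subst h
    simp only [powerMap, Function.update_self]
    exact (contDiff_apply ℂ ℂ j).pow N
  · simp only [powerMap, Function.update_of_ne h]
    exact contDiff_apply ℂ ℂ j

lemma powerMap_self (i : Fin n) (N : ℕ) (t : Fin n → ℂ) : powerMap i N t i = t i ^ N := by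
  simp [powerMap]

lemma powerMap_of_ne {i j : Fin n} (h : j ≠ i) (N : ℕ) (t : Fin n → ℂ) : powerMap i N t j = t j := by
  simp [powerMap, h]

lemma volume_coordinate_hyperplane (i : Fin n) : volume {t : Fin n → ℂ | t i = 0} = 0 := by
  have := Measure.addHaar_submodule (volume : Measure (Fin n → ℂ))
    (LinearMap.ker (LinearMap.proj (R := ℝ) (φ := fun _ : Fin n => ℂ) i)) (by
      rw [Ne, LinearMap.ker_eq_top]
      intro h
      have := LinearMap.congr_fun h (fun _ => 1)
      simp at this)
  exact this

lemma isBranchedCover_powerMap (i : Fin n) {N : ℕ} (hN : 0 < N) :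
    IsBranchedCover (powerMap i N) N where
  pos := hN
  hol := contDiff_powerMap i N
  proper := fun K hK => by
    refine Metric.isCompact_of_isClosed_isBounded
      (hK.isClosed.preimage (contDiff_powerMap i N).continuous) ?_
    obtain ⟨R, hR⟩ := hK.isBounded.exists_norm_le
    refine (Metric.isBounded_closedBall (x := (0 : Fin n → ℂ)) (r := max 1 R)).subset fun t ht => ?_
    rw [mem_closedBall_zero_iff, pi_norm_le_iff_of_nonneg (by positivity)]
    intro j
    have h1 := (norm_le_pi_norm (powerMap i N t) j).trans (hR _ ht)
    by_cases h : j = i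
    · subst h
      rw [powerMap_self, norm_pow] at h1
      by_contra hlt
      push Not at hlt
      have h2 : 1 < ‖t j‖ := (le_max_left _ _).trans_lt hlt
      have h3 : ‖t j‖ ≤ ‖t j‖ ^ N := le_self_pow₀ h2.le hN.ne'
      exact absurd (h3.trans h1) (not_le.2 ((le_max_right _ _).trans_lt hlt))
    · rw [powerMap_of_ne h] at h1
      exact h1.trans (le_max_right _ _)
  integral := fun V F hV h => by
    set P := powerMap i N with hP
    have hPc : Continuous P := (contDiff_powerMap i N).continuous
    have hder : ∀ x, HasFDerivAt P (fderiv ℝ P x) x := fun x =>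
      (((contDiff_powerMap i N).restrict_scalars ℝ).differentiable (by simp) x).hasFDerivAt
    set G := fun t => |(fderiv ℝ P t).det| • F (P t) with hG
    set rt : (Fin n → ℂ) → ℂ := fun t => (t i ^ N) ^ ((N : ℂ)⁻¹) with hrt
    have hrt_pow : ∀ t, rt t ^ N = t i ^ N := fun t => Complex.cpow_nat_inv_pow _ hN.ne'
    have hrtm : Measurable rt := ((measurable_pi_apply i).pow_const N).pow_const _
    set S : ℂ → Set (Fin n → ℂ) := fun ζ => {t | t ∈ P ⁻¹' V ∧ t i ≠ 0 ∧ t i = ζ * rt t} with hS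
    have hSm : ∀ ζ, MeasurableSet (S ζ) := fun ζ =>
      (hPc.measurable hV).inter (((measurableSet_singleton (0 : ℂ)).compl.preimage
        (measurable_pi_apply i)).inter
        (measurableSet_eq_fun (measurable_pi_apply i) (measurable_const.mul hrtm)))
    set V' := V \ {t | t i = 0} with hV'
    have himg : ∀ ζ, ζ ^ N = 1 → P '' S ζ = V' := by
      intro ζ hζ
      ext s
      constructor
      · rintro ⟨t, ⟨h1, h2, h3⟩, rfl⟩
        refine ⟨h1, ?_⟩
        simpa [hP, powerMap_self] using fun h => absurd h h2
      · rintro ⟨h1, h2⟩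
        have hs : (ζ * (s i) ^ ((N : ℂ)⁻¹)) ^ N = s i := by
          rw [mul_pow, hζ, one_mul, Complex.cpow_nat_inv_pow _ hN.ne']
        have hPs : P (Function.update s i (ζ * (s i) ^ ((N : ℂ)⁻¹))) = s := by
          funext j
          by_cases h : j = i
          · subst h; rw [hP, powerMap_self, Function.update_self, hs]
          · rw [hP, powerMap_of_ne h, Function.update_of_ne h]
        refine ⟨_, ⟨?_, ?_, ?_⟩, hPs⟩
        · rw [Set.mem_preimage, hPs]; exact h1
        · intro h0
          rw [Function.update_self] at h0
          rw [h0, zero_pow hN.ne'] at hs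
          exact h2 hs.symm
        · simp only [hrt, Function.update_self, hs]
    have hinj : ∀ ζ, Set.InjOn P (S ζ) := by
      rintro ζ t ⟨-, -, h3⟩ t' ⟨-, -, h3'⟩ h
      have hi : t i ^ N = t' i ^ N := by
        have := congrFun h i
        rwa [hP, powerMap_self, powerMap_self] at this
      funext j
      by_cases hj : j = i
      · subst hj
        rw [h3, h3']
        simp only [hrt, hi]
      · have := congrFun h j
        rwa [hP, powerMap_of_ne hj, powerMap_of_ne hj] at this
    have hVae : V' =ᵐ[volume] V := by
      rw [hV']
      exact sdiff_null_ae_eq_self (volume_coordinate_hyperplane i)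
    have hsec : ∀ ζ, ζ ^ N = 1 → ∫ t in S ζ, G t = ∫ t in V, F t := by
      intro ζ hζ
      rw [← setIntegral_congr_set hVae, ← himg ζ hζ]
      exact (integral_image_eq_integral_abs_det_fderiv_smul volume (hSm ζ)
        (fun x _ => (hder x).hasFDerivWithinAt) (hinj ζ) F).symm
    have hSsub : ∀ ζ, S ζ ⊆ P ⁻¹' V := fun ζ t ht => ht.1
    constructor
    · have h1 : IntegrableOn G (S 1) := h.mono_set (hSsub 1)
      have h2 := (integrableOn_image_iff_integrableOn_abs_det_fderiv_smul volume (hSm 1)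
        (fun x _ => (hder x).hasFDerivWithinAt) (hinj 1) F).2 h1
      rw [himg 1 (one_pow N)] at h2
      exact h2.congr_set_ae hVae.symm
    · have hU : (P ⁻¹' V : Set (Fin n → ℂ)) =ᵐ[volume]
          ⋃ ζ ∈ Polynomial.nthRootsFinset N (1 : ℂ), S ζ := by
        have : (⋃ ζ ∈ Polynomial.nthRootsFinset N (1 : ℂ), S ζ) = P ⁻¹' V \ {t | t i = 0} := by
          ext t
          simp only [Set.mem_iUnion, Polynomial.mem_nthRootsFinset hN, exists_prop]
          constructor
          · rintro ⟨ζ, -, h1, h2, -⟩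
            exact ⟨h1, h2⟩
          · rintro ⟨h1, h2⟩
            have h2' : t i ≠ 0 := h2
            have h3 : rt t ≠ 0 := fun h0 => h2' (by
              have := hrt_pow t
              rw [h0, zero_pow hN.ne'] at this
              exact pow_eq_zero_iff hN.ne' |>.1 this.symm)
            refine ⟨t i / rt t, ?_, h1, h2', ?_⟩
            · rw [div_pow, hrt_pow, div_self (pow_ne_zero _ h2')]
            · field_simp
        rw [this]
        exact (sdiff_null_ae_eq_self (volume_coordinate_hyperplane i)).symm
      rw [setIntegral_congr_set hU, integral_biUnion_finset _ (fun ζ _ => hSm ζ) ?_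
        fun ζ _ => h.mono_set (hSsub ζ)]
      · rw [Finset.sum_congr rfl fun ζ hζ => hsec ζ ((Polynomial.mem_nthRootsFinset hN _).1 hζ),
          Finset.sum_const, (Complex.isPrimitiveRoot_exp N hN.ne').card_nthRootsFinset, nsmul_eq_mul]
      · intro ζ _ ζ' _ hne
        rw [Function.onFun, Set.disjoint_left]
        rintro t ⟨-, h2, h3⟩ ⟨-, -, h3'⟩
        rw [h3] at h2
        exact hne (mul_right_cancel₀ (right_ne_zero_of_mul h2) (h3.symm.trans h3'))

lemma abs_det_fderiv {τ : (Fin n → ℂ) → Fin n → ℂ} {t : Fin n → ℂ} (h : DifferentiableAt ℂ τ t) :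
    |(fderiv ℝ τ t).det| = (fderiv ℝ τ t).det := by
  rw [h.fderiv_restrictScalars ℝ]
  apply abs_of_nonneg
  have : ((fderiv ℂ τ t).restrictScalars ℝ).det =
      LinearMap.det ((fderiv ℂ τ t : (Fin n → ℂ) →ₗ[ℂ] Fin n → ℂ).restrictScalars ℝ) := rfl
  rw [this, det_restrictScalars_complex]
  exact Complex.normSq_nonneg _

lemma wedgeEval_comp_hol (hab : a + b = 2 * n) (f : (Fin n → ℂ) [⋀^Fin a]→L[ℝ] ℂ)
    (g : (Fin n → ℂ) [⋀^Fin b]→L[ℝ] ℂ) {τ : (Fin n → ℂ) → Fin n → ℂ} {t : Fin n → ℂ}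
    (h : DifferentiableAt ℂ τ t) (e : ℕ → Fin n → ℂ) :
    wedgeEval (f.compContinuousLinearMap (fderiv ℝ τ t)) (g.compContinuousLinearMap (fderiv ℝ τ t)) e =
      |(fderiv ℝ τ t).det| • wedgeEval f g e := by
  rw [wedgeEval_compContinuousLinearMap hab, abs_det_fderiv h, Complex.real_smul]

variable {X : Type u} [TopologicalSpace X] [ChartedSpace (Fin n → ℂ) X]

lemma localRep_eq_zero {z : OpenPartialHomeomorph X (Fin n → ℂ)} {f : DForm n m X} {t : Fin n → ℂ}
    (h : f (z.symm t) = 0) : localRep z f t = 0 := by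
  unfold localRep; rw [h]; rfl

variable [IsManifold 𝓘(ℂ, Fin n → ℂ) ω X]

/-- Change of charts for the integral of a wedge product supported in the intersection. -/
lemma wedgeDensity_change {φ z : OpenPartialHomeomorph X (Fin n → ℂ)} (hφ : IsHolChart φ)
    (hz : IsHolChart z) (hab : a + b = 2 * n) {f : DForm n a X} (η : DForm n b X)
    (hf : {x | f x ≠ 0} ⊆ φ.source ∩ z.source) :
    (IntegrableOn (wedgeDensity z f η) z.target → IntegrableOn (wedgeDensity φ f η) φ.target) ∧
    ∫ t in φ.target, wedgeDensity φ f η t = ∫ t in z.target, wedgeDensity z f η t := by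
  set S := z.target ∩ z.symm ⁻¹' φ.source with hS
  set S' := φ.target ∩ φ.symm ⁻¹' z.source with hS'
  set τ := fun t => φ (z.symm t) with hτ
  have hSo : IsOpen S := z.isOpen_inter_preimage_symm φ.open_source
  have hSo' : IsOpen S' := φ.isOpen_inter_preimage_symm z.open_source
  have h0 : ∀ t ∈ z.target \ S, wedgeDensity z f η t = 0 := by
    rintro t ⟨h1, h2⟩
    have : f (z.symm t) = 0 := by
      by_contra h
      exact h2 ⟨h1, (hf h).1⟩
    rw [wedgeDensity, localRep_eq_zero this, wedgeEval_zero_left]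
  have h0' : ∀ t ∈ φ.target \ S', wedgeDensity φ f η t = 0 := by
    rintro t ⟨h1, h2⟩
    have : f (φ.symm t) = 0 := by
      by_contra h
      exact h2 ⟨h1, (hf h).2⟩
    rw [wedgeDensity, localRep_eq_zero this, wedgeEval_zero_left]
  have hdiff : ∀ t ∈ S, DifferentiableAt ℂ τ t := fun t ht =>
    (hφ.transition hz ht.1 ht.2).differentiableAt (by simp)
  have hder : ∀ t ∈ S, HasFDerivWithinAt τ (fderiv ℝ τ t) S t := fun t ht =>
    ((hdiff t ht).restrictScalars ℝ).hasFDerivAt.hasFDerivWithinAt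
  have hinj : Set.InjOn τ S := by
    intro t ht t' ht' h
    have := φ.injOn ht.2 ht'.2 h
    exact z.symm.injOn ht.1 ht'.1 this
  have himg : τ '' S = S' := by
    ext s
    constructor
    · rintro ⟨t, ht, rfl⟩
      refine ⟨φ.map_source ht.2, ?_⟩
      simp only [hτ, Set.mem_preimage, φ.left_inv ht.2]
      exact z.map_target ht.1
    · rintro ⟨h1, h2⟩
      refine ⟨z (φ.symm s), ⟨z.map_source h2, ?_⟩, ?_⟩
      · simp only [Set.mem_preimage, z.left_inv h2]
        exact φ.map_target h1
      · simp only [hτ, z.left_inv h2, φ.right_inv h1]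
  have hval : ∀ t ∈ S, wedgeDensity z f η t =
      |(fderiv ℝ τ t).det| • wedgeDensity φ f η (τ t) := by
    intro t ht
    rw [wedgeDensity, localRep_eq_pb, localRep_eq_pb, pb_eq hφ (hz.mdifferentiableAt_symm ht.1) ht.2,
      pb_eq hφ (hz.mdifferentiableAt_symm ht.1) ht.2]
    exact wedgeEval_comp_hol hab _ _ (hdiff t ht) _
  constructor
  · intro hi
    have h1 : IntegrableOn (wedgeDensity z f η) S := hi.mono_set Set.inter_subset_left
    have h2 := (integrableOn_image_iff_integrableOn_abs_det_fderiv_smul volume hSo.measurableSet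
      hder hinj (wedgeDensity φ f η)).2 (h1.congr_fun hval hSo.measurableSet)
    rw [himg] at h2
    exact h2.of_forall_sdiff_eq_zero φ.open_target.measurableSet h0'
  · rw [setIntegral_eq_of_subset_of_forall_sdiff_eq_zero φ.open_target.measurableSet
      Set.inter_subset_left h0', setIntegral_eq_of_subset_of_forall_sdiff_eq_zero
      z.open_target.measurableSet Set.inter_subset_left h0, ← hS', ← himg,
      integral_image_eq_integral_abs_det_fderiv_smul volume hSo.measurableSet hder hinj]
    exact (setIntegral_congr_fun hSo.measurableSet hval).symm

/-- A holomorphic chart `z` together with a branched cover of its image, branched only over a null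
set, in which `D` is negligible. -/
structure IsOrbChart (D : Set X) (z : OpenPartialHomeomorph X (Fin n → ℂ))
    (P : (Fin n → ℂ) → Fin n → ℂ) (N : ℕ) : Prop where
  chart : IsHolChart z
  cover : IsBranchedCover P N
  null : volume {t | P t ∈ z.target ∧ z.symm (P t) ∈ D} = 0

/-- The form `g` is a smooth extension of the pullback of `η` to the branched chart. -/
def IsOrbExt (D : Set X) (z : OpenPartialHomeomorph X (Fin n → ℂ)) (P : (Fin n → ℂ) → Fin n → ℂ)
    (η : DForm n b X) (g : (Fin n → ℂ) → (Fin n → ℂ) [⋀^Fin b]→L[ℝ] ℂ) : Prop :=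
  ContDiffOn ℝ ∞ g (P ⁻¹' z.target) ∧
    ∀ t, P t ∈ z.target → z.symm (P t) ∉ D → pb (fun t => z.symm (P t)) η t = g t

section Local

variable {D : Set X} {z : OpenPartialHomeomorph X (Fin n → ℂ)} {P : (Fin n → ℂ) → Fin n → ℂ} {N : ℕ}

lemma IsOrbChart.isOpen (hz : IsOrbChart D z P N) : IsOpen (P ⁻¹' z.target) :=
  z.open_target.preimage hz.cover.hol.continuous

lemma IsOrbChart.contMDiffAt (hz : IsOrbChart D z P N) {t : Fin n → ℂ} (ht : P t ∈ z.target) :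
    ContMDiffAt 𝓘(ℝ, Fin n → ℂ) 𝓘(ℝ, Fin n → ℂ) ∞ (fun t => z.symm (P t)) t :=
  (contMDiffAt_real (hz.chart.contMDiffAt_symm ht)).comp t
    (contMDiffAt_real (contMDiffAt_iff_contDiffAt.2 hz.cover.hol.contDiffAt))

lemma IsOrbChart.contDiffAt_pb (hz : IsOrbChart D z P N) {f : DForm n m X} (hf : IsSmoothForm f)
    {t : Fin n → ℂ} (ht : P t ∈ z.target) : ContDiffAt ℝ ∞ (pb (fun t => z.symm (P t)) f) t :=
  ParChernWeil.contDiffAt_pb isOpen_univ hf (hz.contMDiffAt ht) trivial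

lemma IsOrbChart.pb_eq (hz : IsOrbChart D z P N) (f : DForm n m X) {t : Fin n → ℂ}
    (ht : P t ∈ z.target) : pb (fun t => z.symm (P t)) f t =
      (localRep z f (P t)).compContinuousLinearMap (fderiv ℝ P t) := by
  rw [ParChernWeil.pb_eq hz.chart ((hz.contMDiffAt ht).mdifferentiableAt (by simp)) (z.map_target ht),
    z.right_inv ht]
  congr 1
  apply Filter.EventuallyEq.fderiv_eq
  filter_upwards [hz.isOpen.mem_nhds ht] with x hx using z.right_inv hx

/-- The compact set upstairs over a compact set in the chart. -/
lemma IsOrbChart.isCompact_preimage (hz : IsOrbChart D z P N) {K : Set X} (hK : IsCompact K)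
    (hKz : K ⊆ z.source) : IsCompact (P ⁻¹' (z '' K)) ∧ P ⁻¹' (z '' K) ⊆ P ⁻¹' z.target := by
  refine ⟨hz.cover.proper _ (hK.image_of_continuousOn (z.continuousOn.mono hKz)),
    Set.preimage_mono ?_⟩
  rintro _ ⟨x, hx, rfl⟩
  exact z.map_source (hKz hx)

variable [CompactSpace X]

lemma pb_eq_zero_of_notMem {f : DForm n m X} {K : Set X} (hf : {x | f x ≠ 0} ⊆ K) {t : Fin n → ℂ}
    (ht : P t ∈ z.target) (h : t ∉ P ⁻¹' (z '' K)) : pb (fun t => z.symm (P t)) f t = 0 := by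
  have : f (z.symm (P t)) = 0 := by
    by_contra h'
    exact h ⟨_, hf h', z.right_inv ht⟩
  unfold pb
  rw [this]
  rfl

lemma IsOrbChart.integral_eq (hz : IsOrbChart D z P N) (hab : a + b = 2 * n) {f : DForm n a X}
    (hf : IsSmoothForm f) (hs : closure {x | f x ≠ 0} ⊆ z.source) {η : DForm n b X}
    {g : (Fin n → ℂ) → (Fin n → ℂ) [⋀^Fin b]→L[ℝ] ℂ} (hg : IsOrbExt D z P η g) :
    IntegrableOn (wedgeDensity z f η) z.target ∧
      N * ∫ t in z.target, wedgeDensity z f η t =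
        ∫ t in P ⁻¹' z.target, wedgeEval (pb (fun t => z.symm (P t)) f t) (g t) (realBasis n) := by
  obtain ⟨hK, hKW⟩ := hz.isCompact_preimage isClosed_closure.isCompact hs
  have hval : ∀ᵐ t, t ∈ P ⁻¹' z.target → |(fderiv ℝ P t).det| • wedgeDensity z f η (P t) =
      wedgeEval (pb (fun t => z.symm (P t)) f t) (g t) (realBasis n) := by
    have := measure_eq_zero_iff_ae_notMem.1 hz.null
    filter_upwards [this] with t ht htW
    have hD : z.symm (P t) ∉ D := fun h => ht ⟨htW, h⟩
    rw [← hg.2 t htW hD, hz.pb_eq f htW, hz.pb_eq η htW, wedgeEval_comp_hol hab _ _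
      (hz.cover.hol.differentiable (by simp) t)]
    rfl
  have hcont : ContinuousOn (fun t => wedgeEval (pb (fun t => z.symm (P t)) f t) (g t) (realBasis n))
      (P ⁻¹' z.target) := continuousOn_wedgeEval
    (fun t ht => (hz.contDiffAt_pb hf ht).continuousAt.continuousWithinAt) hg.1.continuousOn _
  have hint : IntegrableOn (fun t => wedgeEval (pb (fun t => z.symm (P t)) f t) (g t) (realBasis n))
      (P ⁻¹' z.target) := by
    refine ((hcont.mono hKW).integrableOn_compact hK).of_forall_sdiff_eq_zero
      hz.isOpen.measurableSet fun t ht => ?_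
    rw [pb_eq_zero_of_notMem subset_closure ht.1 ht.2, wedgeEval_zero_left]
  have hint' : IntegrableOn (fun t => |(fderiv ℝ P t).det| • wedgeDensity z f η (P t))
      (P ⁻¹' z.target) :=
    hint.congr (by
      filter_upwards [(ae_restrict_iff' hz.isOpen.measurableSet).2 hval] with t ht using ht.symm)
  obtain ⟨h1, h2⟩ := hz.cover.integral z.target _ z.open_target.measurableSet hint'
  exact ⟨h1, h2.trans (setIntegral_congr_ae hz.isOpen.measurableSet hval)⟩

lemma IsOrbChart.integral_extD (hz : IsOrbChart D z P N) (hab : a + 1 + b = 2 * n) {f : DForm n a X}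
    (hf : IsSmoothForm f) (hs : closure {x | f x ≠ 0} ⊆ z.source) {η : DForm n b X}
    {g : (Fin n → ℂ) → (Fin n → ℂ) [⋀^Fin b]→L[ℝ] ℂ} (hg : IsOrbExt D z P η g) :
    N * ∫ t in z.target, wedgeDensity z (extD f) η t = (-1) ^ (a + 1) *
        ∫ t in P ⁻¹' z.target,
          wedgeEval (pb (fun t => z.symm (P t)) f t) (extDeriv g t) (realBasis n) := by
  obtain ⟨hK, hKW⟩ := hz.isCompact_preimage isClosed_closure.isCompact hs
  set K := P ⁻¹' (z '' closure {x | f x ≠ 0})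
  set W := P ⁻¹' z.target
  rw [(hz.integral_eq hab hf.extD ((closure_minimal (support_extD f) isClosed_closure).trans hs) hg).2]
  set F : (Fin n → ℂ) → (Fin n → ℂ) [⋀^Fin a]→L[ℝ] ℂ :=
    W.indicator (pb (fun t => z.symm (P t)) f) with hF
  have hFW : ∀ t ∈ W, F =ᶠ[𝓝 t] pb (fun t => z.symm (P t)) f := fun t ht => by
    filter_upwards [hz.isOpen.mem_nhds ht] with x hx using Set.indicator_of_mem hx _
  have hF0 : ∀ t, t ∉ K → F t = 0 := by
    intro t ht
    by_cases h : t ∈ W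
    · rw [(hFW t h).self_of_nhds]; exact pb_eq_zero_of_notMem subset_closure h ht
    · exact Set.indicator_of_notMem h _
  have hts : tsupport F ⊆ K := closure_minimal (fun t ht => by
    by_contra h; exact ht (hF0 t h)) hK.isClosed
  have hFs : ContDiff ℝ ∞ F := by
    rw [contDiff_iff_contDiffAt]
    intro t
    by_cases h : t ∈ W
    · exact (hz.contDiffAt_pb hf h).congr_of_eventuallyEq (hFW t h)
    · have : F =ᶠ[𝓝 t] fun _ => 0 := by
        filter_upwards [hK.isClosed.isOpen_compl.mem_nhds fun h' => h (hKW h')] with x hx using hF0 x hx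
      exact contDiffAt_const.congr_of_eventuallyEq this
  have hext0 : ∀ t, t ∉ K → extDeriv F t = 0 := by
    intro t ht
    have : F =ᶠ[𝓝 t] 0 := by
      filter_upwards [hK.isClosed.isOpen_compl.mem_nhds ht] with x hx using hF0 x hx
    rw [this.extDeriv_eq]
    ext v
    rw [extDeriv_eq_sum]
    simp
  have h1 : ∫ t in W, wedgeEval (pb (fun t => z.symm (P t)) (extD f) t) (g t) (realBasis n) =
      ∫ t, wedgeEval (extDeriv F t) (g t) (realBasis n) := by
    refine Eq.trans (setIntegral_congr_fun hz.isOpen.measurableSet fun t ht => ?_)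
      (setIntegral_eq_integral_of_forall_compl_eq_zero (s := W) fun t ht => by
        rw [hext0 t fun h => ht (hKW h), wedgeEval_zero_left])
    rw [extDeriv_pb isOpen_univ hf (hz.contMDiffAt ht) trivial, (hFW t ht).extDeriv_eq]
  have h2 : ∫ t in W, wedgeEval (pb (fun t => z.symm (P t)) f t) (extDeriv g t) (realBasis n) =
      ∫ t, wedgeEval (F t) (extDeriv g t) (realBasis n) := by
    refine Eq.trans (setIntegral_congr_fun hz.isOpen.measurableSet fun t ht => ?_)
      (setIntegral_eq_integral_of_forall_compl_eq_zero (s := W) fun t ht => by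
        rw [hF0 t fun h => ht (hKW h), wedgeEval_zero_left])
    rw [(hFW t ht).self_of_nhds]
  rw [h1, h2]
  exact integral_wedgeEval_extDeriv hz.isOpen hFs (hK.of_isClosed_subset (isClosed_tsupport F) hts)
    (hts.trans hKW) hg.1 _

end Local

end Branched

/-! ## Currents defined by forms that are smooth on branched charts -/

section Currents

open MeasureTheory

variable {n m a b : ℕ} {X : Type u} [TopologicalSpace X] [ChartedSpace (Fin n → ℂ) X]

/-- Finite smooth partitions of unity subordinate to a family of neighbourhoods. -/
lemma exists_finite_partition [T2Space X] [CompactSpace X] [IsManifold 𝓘(ℂ, Fin n → ℂ) ω X]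
    (U : X → Set X) (hU : ∀ p, IsOpen (U p)) (hp : ∀ p, p ∈ U p) :
    ∃ (s : Finset X) (ρ : X → X → ℂ), (∀ i, ContMDiff 𝓘(ℝ, Fin n → ℂ) 𝓘(ℝ, ℂ) ∞ (ρ i)) ∧
      (∀ i ∈ s, closure {x | ρ i x ≠ 0} ⊆ U i) ∧ ∀ x, ∑ i ∈ s, ρ i x = 1 := by
  classical
  have : IsManifold 𝓘(ℝ, Fin n → ℂ) ∞ X := isManifold_real
  obtain ⟨s, hs⟩ := isCompact_univ.elim_finite_subcover U hU
    fun x _ => Set.mem_iUnion.2 ⟨x, hp x⟩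
  obtain ⟨f, hf⟩ := SmoothPartitionOfUnity.exists_isSubordinate 𝓘(ℝ, Fin n → ℂ) isClosed_univ
    (fun i : s => U i) (fun i => hU i) (fun x hx => by
      obtain ⟨i, hi, hxi⟩ := Set.mem_iUnion₂.1 (hs hx)
      exact Set.mem_iUnion.2 ⟨⟨i, hi⟩, hxi⟩)
  refine ⟨s, fun i x => if h : i ∈ s then ((f ⟨i, h⟩ x : ℝ) : ℂ) else 0, fun i => ?_, fun i hi => ?_,
    fun x => ?_⟩
  · by_cases h : i ∈ s
    · simp only [h, dif_pos]
      exact (Complex.ofRealCLM.contDiff.contMDiff).comp (f ⟨i, h⟩).contMDiff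
    · simp only [h, dif_neg, not_false_eq_true]
      exact contMDiff_const
  · refine (closure_mono ?_).trans (hf ⟨i, hi⟩)
    intro x hx
    simpa [hi] using hx
  · have h1 := f.sum_eq_one (Set.mem_univ x)
    rw [finsum_eq_sum_of_fintype] at h1
    rw [← Finset.sum_coe_sort]
    simp only [Finset.coe_mem, dif_pos]
    rw [← Complex.ofReal_sum]
    exact_mod_cast h1

lemma smul_form_ne_zero {x : X} {c : ℂ} {F : TangentSpace 𝓘(ℝ, Fin n → ℂ) x [⋀^Fin m]→L[ℝ] ℂ}
    (h : c • F ≠ 0) : c ≠ 0 ∧ F ≠ 0 := by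
  constructor
  · rintro rfl
    exact h (zero_smul ℂ F)
  · rintro rfl
    exact h (ContinuousAlternatingMap.ext fun v => mul_zero c)

lemma closure_support_smul (ρ : X → ℂ) (f : DForm n m X) :
    closure {x | ρ x • f x ≠ 0} ⊆ closure {x | ρ x ≠ 0} ∩ closure {x | f x ≠ 0} :=
  Set.subset_inter (closure_mono fun _ hx => (smul_form_ne_zero hx).1)
    (closure_mono fun _ hx => (smul_form_ne_zero hx).2)

lemma Current.toFun_zero (T : Current n a X) : T.toFun 0 = 0 := by
  have := T.map_smul 0 0 IsSmoothForm.zero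
  rw [zero_mul] at this
  rw [← this]
  congr 1
  funext x
  exact (zero_smul ℂ (0 : TangentSpace 𝓘(ℝ, Fin n → ℂ) x [⋀^Fin a]→L[ℝ] ℂ)).symm

lemma Current.map_sum (T : Current n a X) {ι : Type*} (s : Finset ι) {f : ι → DForm n a X}
    (hf : ∀ i ∈ s, IsSmoothForm (f i)) : T.toFun (∑ i ∈ s, f i) = ∑ i ∈ s, T.toFun (f i) := by
  classical
  induction s using Finset.induction_on with
  | empty => simpa using T.toFun_zero
  | insert i s hi ih =>
    rw [Finset.sum_insert hi, Finset.sum_insert hi, T.map_add _ _ (hf i (by simp))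
      (IsSmoothForm.sum s fun j hj => hf j (by simp [hj])), ih fun j hj => hf j (by simp [hj])]

lemma eq_sum_partition (s : Finset X) (ρ : X → X → ℂ) (h : ∀ x, ∑ i ∈ s, ρ i x = 1)
    (f : DForm n m X) : f = ∑ i ∈ s, (fun x => ρ i x • f x : DForm n m X) := by
  funext x
  rw [Finset.sum_apply, ← Finset.sum_smul, h, one_smul]

variable [IsManifold 𝓘(ℂ, Fin n → ℂ) ω X]

lemma Current.IsRepresentedBy.eq_integral {T : Current n a X} {η : DForm n b X}
    (hT : T.IsRepresentedBy η) {φ z : OpenPartialHomeomorph X (Fin n → ℂ)}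
    (hφ : φ ∈ atlas (Fin n → ℂ) X) (hz : IsHolChart z) {f : DForm n a X} (hf : IsSmoothForm f)
    (hs : closure {x | f x ≠ 0} ⊆ φ.source ∩ z.source) :
    T.toFun f = ∫ t in z.target, wedgeDensity z f η t := by
  rw [(hT.2 φ hφ f hf (hs.trans Set.inter_subset_left)).2]
  exact (wedgeDensity_change (isHolChart_of_mem_atlas hφ) hz hT.1 η (subset_closure.trans hs)).2

variable [T2Space X] [CompactSpace X] {D : Set X}

lemma Current.eq_of_agree (hD : ∀ p, ∃ (z : OpenPartialHomeomorph X (Fin n → ℂ)), p ∈ z.source ∧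
      IsHolChart z ∧ volume {t | t ∈ z.target ∧ z.symm t ∈ D} = 0)
    {T₁ T₂ : Current n a X} {η₁ η₂ : DForm n b X}
    (h₁ : T₁.IsRepresentedBy η₁) (h₂ : T₂.IsRepresentedBy η₂) (h : ∀ x, x ∉ D → η₁ x = η₂ x)
    {f : DForm n a X} (hf : IsSmoothForm f) : T₁.toFun f = T₂.toFun f := by
  choose z hpz hz hnull using hD
  obtain ⟨s, ρ, hρ, hsub, hsum⟩ := exists_finite_partition (n := n)
    (fun p => (chartAt (Fin n → ℂ) p).source ∩ (z p).source)
    (fun p => (chartAt _ p).open_source.inter (z p).open_source)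
    (fun p => ⟨mem_chart_source _ p, hpz p⟩)
  rw [eq_sum_partition s ρ hsum f, T₁.map_sum s fun i _ => hf.smul (hρ i),
    T₂.map_sum s fun i _ => hf.smul (hρ i)]
  refine Finset.sum_congr rfl fun i hi => ?_
  have hs := ((closure_support_smul (ρ i) f).trans Set.inter_subset_left).trans (hsub i hi)
  rw [h₁.eq_integral (chart_mem_atlas _ i) (hz i) (hf.smul (hρ i)) hs,
    h₂.eq_integral (chart_mem_atlas _ i) (hz i) (hf.smul (hρ i)) hs]
  refine setIntegral_congr_ae (z i).open_target.measurableSet ?_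
  filter_upwards [measure_eq_zero_iff_ae_notMem.1 (hnull i)] with t ht htz
  unfold wedgeDensity
  have : localRep (z i) η₁ t = localRep (z i) η₂ t := by
    unfold localRep
    rw [h _ fun hD => ht ⟨htz, hD⟩]
  rw [this]

/-- Stokes' theorem for currents represented by forms that are smooth on branched charts: if
`dγ = η₁ - η₂` there, then `T₁ - T₂ = dS`. -/
lemma Current.stokes {T₁ T₂ : Current n a X} {S : Current n (a + 1) X} {η₁ η₂ : DForm n (b + 1) X}
    {γ : DForm n b X} (h₁ : T₁.IsRepresentedBy η₁) (h₂ : T₂.IsRepresentedBy η₂)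
    (hS : S.IsRepresentedBy γ)
    (h : ∀ p, ∃ z P N g₁ g₂ g, p ∈ z.source ∧ IsOrbChart D z P N ∧ IsOrbExt D z P η₁ g₁ ∧
      IsOrbExt D z P η₂ g₂ ∧ IsOrbExt D z P γ g ∧
      ∀ t, P t ∈ z.target → extDeriv g t = g₁ t - g₂ t)
    {f : DForm n a X} (hf : IsSmoothForm f) :
    T₁.toFun f - T₂.toFun f = (-1) ^ (a + 1) * S.toFun (extD f) := by
  choose z P N g₁ g₂ g hpz hz hg₁ hg₂ hg hdg using h
  obtain ⟨s, ρ, hρ, hsub, hsum⟩ := exists_finite_partition (n := n)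
    (fun p => (chartAt (Fin n → ℂ) p).source ∩ (z p).source)
    (fun p => (chartAt _ p).open_source.inter (z p).open_source)
    (fun p => ⟨mem_chart_source _ p, hpz p⟩)
  rw [eq_sum_partition s ρ hsum f, T₁.map_sum s fun i _ => hf.smul (hρ i),
    T₂.map_sum s fun i _ => hf.smul (hρ i), extD_sum s fun i _ => hf.smul (hρ i),
    S.map_sum s fun i _ => (hf.smul (hρ i)).extD, ← Finset.sum_sub_distrib, Finset.mul_sum]
  refine Finset.sum_congr rfl fun i hi => ?_
  have hfi := hf.smul (hρ i)
  have hs := ((closure_support_smul (ρ i) f).trans Set.inter_subset_left).trans (hsub i hi)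
  have hsz := hs.trans Set.inter_subset_right
  have hN : (N i : ℂ) ≠ 0 := Nat.cast_ne_zero.2 (hz i).cover.pos.ne'
  apply mul_left_cancel₀ hN
  rw [h₁.eq_integral (chart_mem_atlas _ i) (hz i).chart hfi hs,
    h₂.eq_integral (chart_mem_atlas _ i) (hz i).chart hfi hs,
    hS.eq_integral (chart_mem_atlas _ i) (hz i).chart hfi.extD
      ((closure_minimal (support_extD _) isClosed_closure).trans hs), mul_sub, mul_left_comm (N i : ℂ),
    (hz i).integral_extD (by have := hS.1; omega) hfi hsz (hg i),
    ((hz i).integral_eq h₁.1 hfi hsz (hg₁ i)).2, ((hz i).integral_eq h₂.1 hfi hsz (hg₂ i)).2,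
    ← mul_assoc, ← mul_pow]
  simp only [mul_neg, mul_one, neg_neg, one_pow, one_mul]
  obtain ⟨hK, hKW⟩ := (hz i).isCompact_preimage isClosed_closure.isCompact hsz
  have hint : ∀ {g' : (Fin n → ℂ) → (Fin n → ℂ) [⋀^Fin (b + 1)]→L[ℝ] ℂ},
      ContDiffOn ℝ ∞ g' (P i ⁻¹' (z i).target) → IntegrableOn (fun t => wedgeEval
        (pb (fun t => (z i).symm (P i t)) (fun x => ρ i x • f x) t) (g' t) (realBasis n))
        (P i ⁻¹' (z i).target) := fun hg' => by
    have hcont := continuousOn_wedgeEval (fun t ht =>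
      ((hz i).contDiffAt_pb hfi ht).continuousAt.continuousWithinAt) hg'.continuousOn (realBasis n)
    refine ((hcont.mono hKW).integrableOn_compact hK).of_forall_sdiff_eq_zero
      (hz i).isOpen.measurableSet fun t ht => ?_
    rw [pb_eq_zero_of_notMem subset_closure ht.1 ht.2, wedgeEval_zero_left]
  rw [← integral_sub (hint (hg₁ i).1) (hint (hg₂ i).1)]
  refine setIntegral_congr_fun (hz i).isOpen.measurableSet fun t ht => ?_
  simp only [hdg i t ht, wedgeEval_sub_right]

/-- Stokes' theorem: the current of a form that is smooth and closed on branched charts is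
closed. -/
lemma Current.isClosed_of_orbExt {T : Current n a X} {η : DForm n b X} (hT : T.IsRepresentedBy η)
    (h : ∀ p, ∃ z P N g, p ∈ z.source ∧ IsOrbChart D z P N ∧ IsOrbExt D z P η g ∧
      ∀ t, P t ∈ z.target → extDeriv g t = 0) : T.IsClosed := by
  cases a with
  | zero => trivial
  | succ a =>
    intro f hf
    choose z P N g hpz hz hg hdg using h
    obtain ⟨s, ρ, hρ, hsub, hsum⟩ := exists_finite_partition (n := n)
      (fun p => (chartAt (Fin n → ℂ) p).source ∩ (z p).source)
      (fun p => (chartAt _ p).open_source.inter (z p).open_source)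
      (fun p => ⟨mem_chart_source _ p, hpz p⟩)
    rw [eq_sum_partition s ρ hsum f, extD_sum s fun i _ => hf.smul (hρ i),
      T.map_sum s fun i _ => (hf.smul (hρ i)).extD]
    refine Finset.sum_eq_zero fun i hi => ?_
    have hfi := hf.smul (hρ i)
    have hs := ((closure_support_smul (ρ i) f).trans Set.inter_subset_left).trans (hsub i hi)
    have hsz := hs.trans Set.inter_subset_right
    have hN : (N i : ℂ) ≠ 0 := Nat.cast_ne_zero.2 (hz i).cover.pos.ne'
    apply mul_left_cancel₀ hN
    rw [hT.eq_integral (chart_mem_atlas _ i) (hz i).chart hfi.extD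
      ((closure_minimal (support_extD _) isClosed_closure).trans hs),
      (hz i).integral_extD hT.1 hfi hsz (hg i), mul_zero]
    rw [setIntegral_congr_fun (hz i).isOpen.measurableSet (g := fun _ => 0)
      (fun t ht => by simp only [hdg i t ht, wedgeEval_zero_right])]
    simp

/-- A form that extends smoothly to branched charts defines a current. -/
lemma exists_current_of_orbExt (hab : a + b = 2 * n) {η : DForm n b X}
    (h : ∀ p, ∃ z P N g, p ∈ z.source ∧ IsOrbChart D z P N ∧ IsOrbExt D z P η g) :
    ∃ T : Current n a X, T.IsRepresentedBy η := by
  choose z P N g hpz hz hg using h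
  obtain ⟨s, ρ, hρ, hsub, hsum⟩ := exists_finite_partition (n := n)
    (fun p => (chartAt (Fin n → ℂ) p).source ∩ (z p).source)
    (fun p => (chartAt _ p).open_source.inter (z p).open_source)
    (fun p => ⟨mem_chart_source _ p, hpz p⟩)
  have hs : ∀ (f : DForm n a X), ∀ i ∈ s, closure {x | ρ i x • f x ≠ 0} ⊆
      (chartAt (Fin n → ℂ) i).source ∩ (z i).source := fun f i hi =>
    ((closure_support_smul (ρ i) f).trans Set.inter_subset_left).trans (hsub i hi)
  have hint : ∀ {f : DForm n a X}, IsSmoothForm f → ∀ i ∈ s, _ := fun {f} hf i hi =>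
    (hz i).integral_eq hab (hf.smul (hρ i)) ((hs f i hi).trans Set.inter_subset_right) (hg i)
  refine ⟨{ toFun := fun f => ∑ i ∈ s, ∫ t in (z i).target,
              wedgeDensity (z i) (fun x => ρ i x • f x) η t
            map_add := fun f f' hf hf' => ?_
            map_smul := fun c f hf => ?_
            cont := fun f hf hlim => ?_ }, hab, fun φ hφ f hf hsup => ?_⟩
  · rw [← Finset.sum_add_distrib]
    refine Finset.sum_congr rfl fun i hi => ?_
    rw [← integral_add (hint hf i hi).1 (hint hf' i hi).1]
    refine integral_congr_ae (Filter.Eventually.of_forall fun t => ?_)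
    simp only [wedgeDensity, ← wedgeEval_add_left]
    congr 1
    rw [← Pi.add_apply, ← localRep_add]
    congr 1
    funext x
    exact smul_add _ _ _
  · rw [Finset.mul_sum]
    refine Finset.sum_congr rfl fun i hi => ?_
    rw [← integral_const_mul]
    refine integral_congr_ae (Filter.Eventually.of_forall fun t => ?_)
    simp only [wedgeDensity, ← wedgeEval_smul_left]
    congr 1
    rw [localRep_eq_pb, localRep_eq_pb, ← pb_smul _ (fun _ => c)]
    congr 1
    funext x
    exact ContinuousAlternatingMap.ext fun v => mul_left_comm _ _ _
  · rw [← Finset.sum_const_zero (s := s)]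
    refine tendsto_finsetSum s fun i hi => ?_
    have hN : (N i : ℂ) ≠ 0 := Nat.cast_ne_zero.2 (hz i).cover.pos.ne'
    suffices hN0 : Filter.Tendsto (fun j => (N i : ℂ) * ∫ t in (z i).target,
        wedgeDensity (z i) (fun x => ρ i x • f j x) η t) Filter.atTop (𝓝 0) by
      have := hN0.const_mul (N i : ℂ)⁻¹
      simpa [← mul_assoc, hN] using this
    set W := P i ⁻¹' (z i).target with hW
    set φ := chartAt (Fin n → ℂ) i with hφ
    have hφc : IsHolChart φ := isHolChart_of_mem_atlas (chart_mem_atlas _ i)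
    set ψ := fun t => (z i).symm (P i t) with hψ
    obtain ⟨hK, hKW⟩ := (hz i).isCompact_preimage (K := closure {x | ρ i x ≠ 0})
      isClosed_closure.isCompact ((hsub i hi).trans Set.inter_subset_right)
    set K := P i ⁻¹' ((z i) '' closure {x | ρ i x ≠ 0}) with hKdef
    have hKψ : ∀ t ∈ K, ψ t ∈ φ.source := by
      rintro t ⟨x, hx, hxt⟩
      have : ψ t = x := by
        simp only [hψ, ← hxt]
        exact (z i).left_inv (hsub i hi hx).2
      rw [this]
      exact (hsub i hi hx).1
    have hψs : ∀ t ∈ K, ContMDiffAt 𝓘(ℝ, Fin n → ℂ) 𝓘(ℝ, Fin n → ℂ) ∞ ψ t := fun t ht =>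
      (hz i).contMDiffAt (hKW ht)
    have hcomp : ∀ t ∈ K, ContDiffAt ℝ ∞ (fun t => φ (ψ t)) t := fun t ht =>
      contMDiffAt_iff_contDiffAt.1 ((contMDiffAt_real (hφc.contMDiffAt (hKψ t ht))).comp t (hψs t ht))
    obtain ⟨C, hC0, hC⟩ := norm_wedgeEval_le n a b (realBasis n)
    have hcM : ContinuousOn (fun t => C * (‖ρ i (ψ t)‖ * ‖fderiv ℝ (fun t => φ (ψ t)) t‖ ^ a * ‖g i t‖))
        K := by
      refine continuousOn_const.mul ((ContinuousOn.mul ?_ ?_).mul ?_)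
      · exact fun t ht => ((hρ i).continuous.continuousAt.comp
          (hψs t ht).continuousAt).norm.continuousWithinAt
      · exact fun t ht => (((hcomp t ht).fderiv_right (m := 0) (by simp)).continuousAt.norm.pow
          a).continuousWithinAt
      · exact ((hg i).1.continuousOn.mono hKW).norm
    obtain ⟨M, hM⟩ := hK.exists_bound_of_continuousOn hcM
    have hM0 : 0 ≤ max M 0 := le_max_right _ _
    have hlim' := hlim φ (chart_mem_atlas _ i) ((fun t => φ (ψ t)) '' K)
      (hK.image_of_continuousOn fun t ht => (hcomp t ht).continuousAt.continuousWithinAt)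
      (by rintro _ ⟨t, ht, rfl⟩; exact φ.map_source (hKψ t ht)) 0
    rw [Metric.tendstoUniformlyOn_iff] at hlim'
    rw [Metric.tendsto_atTop]
    intro ε hε
    have hvK : 0 ≤ volume.real K := measureReal_nonneg
    set δ := ε / (max M 0 * volume.real K + 1) with hδ
    have hδ0 : 0 < δ := by positivity
    obtain ⟨j₀, hj₀⟩ := Filter.eventually_atTop.1 (hlim' δ hδ0)
    refine ⟨j₀, fun j hj => ?_⟩
    rw [dist_zero_right, (hint (hf j) i hi).2]
    have hKeq : ∫ t in W, wedgeEval (pb ψ (fun x => ρ i x • f j x) t) (g i t) (realBasis n) =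
        ∫ t in K, wedgeEval (pb ψ (fun x => ρ i x • f j x) t) (g i t) (realBasis n) :=
      setIntegral_eq_of_subset_of_forall_sdiff_eq_zero (hz i).isOpen.measurableSet hKW fun t ht => by
        rw [pb_eq_zero_of_notMem (K := closure {x | ρ i x ≠ 0}) ?_ ht.1 ht.2, wedgeEval_zero_left]
        exact fun x hx => subset_closure (smul_form_ne_zero hx).1
    rw [hKeq]
    have hb : ∀ t ∈ K, ‖wedgeEval (pb ψ (fun x => ρ i x • f j x) t) (g i t) (realBasis n)‖ ≤
        max M 0 * δ := by
      intro t ht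
      have e1 : ‖localRep φ (f j) (φ (ψ t))‖ ≤ δ := by
        have := hj₀ j hj (φ (ψ t)) ⟨t, ht, rfl⟩
        rw [Pi.zero_apply, dist_zero_left, norm_iteratedFDeriv_zero] at this
        exact this.le
      have e2 : ‖pb ψ (f j) t‖ ≤ δ * ‖fderiv ℝ (fun t => φ (ψ t)) t‖ ^ a := by
        rw [pb_eq hφc ((hψs t ht).mdifferentiableAt (by simp)) (hKψ t ht)]
        refine (ContinuousAlternatingMap.norm_compContinuousLinearMap_le _ _).trans ?_
        rw [Fintype.card_fin]
        exact mul_le_mul_of_nonneg_right e1 (by positivity)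
      refine (hC _ _).trans ?_
      rw [pb_smul, norm_smul]
      have e3 := (Real.le_norm_self _).trans (hM t ht)
      calc C * (‖ρ i (ψ t)‖ * ‖pb ψ (f j) t‖ * ‖g i t‖)
          ≤ C * (‖ρ i (ψ t)‖ * (δ * ‖fderiv ℝ (fun t => φ (ψ t)) t‖ ^ a) * ‖g i t‖) := by
            gcongr
        _ = (C * (‖ρ i (ψ t)‖ * ‖fderiv ℝ (fun t => φ (ψ t)) t‖ ^ a * ‖g i t‖)) * δ := by ring
        _ ≤ max M 0 * δ := mul_le_mul_of_nonneg_right (e3.trans (le_max_left _ _)) hδ0.le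
    refine (norm_setIntegral_le_of_norm_le_const hK.measure_lt_top hb).trans_lt ?_
    rw [hδ, mul_right_comm, ← mul_div_assoc, div_lt_iff₀ (by positivity)]
    nlinarith [mul_nonneg hM0 hvK]
  · have hch : ∀ i ∈ s, _ := fun i hi =>
      wedgeDensity_change (isHolChart_of_mem_atlas hφ) (hz i).chart hab η
        (f := fun x => ρ i x • f x) (fun x hx => ⟨hsup (subset_closure (smul_form_ne_zero hx).2),
          ((hs f i hi) (subset_closure hx)).2⟩)
    have hsumD : wedgeDensity φ f η = fun t => ∑ i ∈ s, wedgeDensity φ (fun x => ρ i x • f x) η t := by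
      funext t
      have : localRep φ f t = ∑ i ∈ s, localRep φ (fun x => ρ i x • f x) t := by
        simp only [localRep_eq_pb, pb_smul]
        rw [← Finset.sum_smul, hsum, one_smul]
      unfold wedgeDensity
      rw [this]
      exact map_sum (AddMonoidHom.mk' (fun F => wedgeEval F (localRep φ η t) (realBasis n))
        fun F F' => wedgeEval_add_left F F' _ _) _ s
    constructor
    · rw [hsumD]
      exact integrable_finsetSum _ fun i hi => (hch i hi).1 (hint hf i hi).1
    · rw [hsumD, integral_finsetSum _ fun i hi => (hch i hi).1 (hint hf i hi).1]
      exact Finset.sum_congr rfl fun i hi => (hch i hi).2.symm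

end Currents

/-! ## Holomorphic frames and Gram matrices -/

section Frames

open scoped Matrix ComplexOrder

variable {n m r : ℕ} {X : Type u} [TopologicalSpace X] [ChartedSpace (Fin n → ℂ) X]

lemma contMDiffAt_det {ι : Type*} [Fintype ι] [DecidableEq ι] {C : X → Matrix ι ι ℂ} {x : X}
    (h : ∀ i j, ContMDiffAt 𝓘(ℂ, Fin n → ℂ) 𝓘(ℂ, ℂ) ω (fun y => C y i j) x) :
    ContMDiffAt 𝓘(ℂ, Fin n → ℂ) 𝓘(ℂ, ℂ) ω (fun y => (C y).det) x := by
  have : (fun y => (C y).det) = fun y => ∑ σ : Equiv.Perm ι,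
      ((Equiv.Perm.sign σ : ℤ) : ℂ) * ∏ i, C y (σ i) i := by
    funext y; rw [Matrix.det_apply']
  rw [this]
  exact ContMDiffAt.sum fun σ _ => contMDiffAt_const.mul (contMDiffAt_finsetProd fun i _ => h _ _)

lemma contMDiffAt_matrix_inv {C : X → Matrix (Fin r) (Fin r) ℂ} {x : X}
    (h : ∀ i j, ContMDiffAt 𝓘(ℂ, Fin n → ℂ) 𝓘(ℂ, ℂ) ω (fun y => C y i j) x) (hx : IsUnit (C x))
    (i j : Fin r) : ContMDiffAt 𝓘(ℂ, Fin n → ℂ) 𝓘(ℂ, ℂ) ω (fun y => (C y)⁻¹ i j) x := by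
  have h1 : ContMDiffAt 𝓘(ℂ, Fin n → ℂ) 𝓘(ℂ, ℂ) ω (fun y => (C y).det⁻¹) x := by
    have hd : ContDiffAt ℂ ω (fun c : ℂ => c⁻¹) (C x).det :=
      contDiffAt_inv ℂ ((Matrix.isUnit_iff_isUnit_det _).1 hx).ne_zero
    exact hd.contMDiffAt.comp x (contMDiffAt_det h)
  have h2 : ContMDiffAt 𝓘(ℂ, Fin n → ℂ) 𝓘(ℂ, ℂ) ω (fun y => (C y).adjugate i j) x := by
    simp only [Matrix.adjugate_apply]
    refine contMDiffAt_det fun a b => ?_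
    by_cases ha : a = j
    · subst ha
      simp only [Matrix.updateRow_self]
      exact contMDiffAt_const
    · simp only [Matrix.updateRow_ne ha]
      exact h a b
  have h3 : (fun y => (C y)⁻¹ i j) = fun y => (C y).det⁻¹ * (C y).adjugate i j := by
    funext y
    rw [Matrix.inv_def, Matrix.smul_apply, Ring.inverse_eq_inv', smul_eq_mul]
  rw [h3]
  exact h1.mul h2

variable (E : HolBundle.{u, w} n r X)

/-- The Gram matrix of a family of sections. -/
def gramOf (H : E.Sesq) (e : Fin r → ∀ x, E.Fib x) (x : X) : Matrix (Fin r) (Fin r) ℂ :=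
  Matrix.of fun a b => H x (e a x) (e b x)

/-- The frame of the preferred trivialization at `x`. -/
def prefFrame (x : X) : Fin r → ∀ y, E.Fib y :=
  (trivializationAt (Fin r → ℂ) E.Fib x).localFrame (Pi.basisFun ℂ (Fin r))

lemma isHolFrame_prefFrame [IsManifold 𝓘(ℂ, Fin n → ℂ) ω X] (x : X) :
    E.IsHolFrame (prefFrame E x) (trivializationAt (Fin r → ℂ) E.Fib x).baseSet :=
  (trivializationAt (Fin r → ℂ) E.Fib x).isLocalFrameOn_localFrame_baseSet _ _ _

lemma gram_eq (H : E.Sesq) (x : X) (t : Fin n → ℂ) :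
    E.gram H x t = gramOf E H (prefFrame E x) ((chartAt (Fin n → ℂ) x).symm t) := rfl

variable {E}

lemma gramOf_apply (H : E.Sesq) (e : Fin r → ∀ x, E.Fib x) (x : X) (a b : Fin r) :
    gramOf E H e x a b = H x (e a x) (e b x) := rfl

lemma sesq_transition {V : Type*} [AddCommGroup V] [Module ℂ V] (B : V →ₗ⋆[ℂ] V →ₗ[ℂ] ℂ)
    {e f : Fin r → V} {g : Matrix (Fin r) (Fin r) ℂ} (h : ∀ b, f b = ∑ c, g c b • e c) :
    (Matrix.of fun a b => B (f a) (f b)) = gᴴ * (Matrix.of fun a b => B (e a) (e b)) * g := by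
  ext a b
  rw [Matrix.of_apply, h a, h b, Matrix.mul_apply]
  simp only [map_sum, LinearMap.map_smulₛₗ, LinearMap.sum_apply, LinearMap.smul_apply,
    RingHom.id_apply, smul_eq_mul, Matrix.mul_apply, Matrix.conjTranspose_apply, Matrix.of_apply,
    Finset.mul_sum, Finset.sum_mul]
  refine Finset.sum_congr rfl fun c _ => Finset.sum_congr rfl fun d _ => ?_
  rw [starRingEnd_apply]
  ring

lemma gramOf_transition (H : E.Sesq) {e f : Fin r → ∀ x, E.Fib x} {x : X}
    {g : Matrix (Fin r) (Fin r) ℂ} (h : ∀ b, f b x = ∑ c, g c b • e c x) :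
    gramOf E H f x = gᴴ * gramOf E H e x * g := sesq_transition (H x) h

lemma HolBundle.IsHolFrame.contMDiffAt {e : Fin r → ∀ x, E.Fib x} {U : Set X} (h : E.IsHolFrame e U)
    (hU : IsOpen U) {x : X} (hx : x ∈ U) (i : Fin r) :
    ContMDiffAt 𝓘(ℂ, Fin n → ℂ) (𝓘(ℂ, Fin n → ℂ).prod 𝓘(ℂ, Fin r → ℂ)) ω
      (fun x => Bundle.TotalSpace.mk' (Fin r → ℂ) x (e i x)) x :=
  ((IsLocalFrameOn.contMDiffOn h i) x hx).contMDiffAt (hU.mem_nhds hx)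

lemma HolBundle.IsHolFrame.sum_injective {e : Fin r → ∀ x, E.Fib x} {U : Set X}
    (h : E.IsHolFrame e U) {x : X} (hx : x ∈ U) {c d : Fin r → ℂ}
    (hcd : ∑ i, c i • e i x = ∑ i, d i • e i x) : c = d := by
  have := Fintype.linearIndependent_iff.1 (IsLocalFrameOn.linearIndependent h hx) (c - d) (by
    simp only [Pi.sub_apply, sub_smul, Finset.sum_sub_distrib, hcd, sub_self])
  funext i
  exact sub_eq_zero.1 (this i)

/-- The holomorphic coefficients of sections with respect to a holomorphic frame. -/
lemma HolBundle.IsHolFrame.exists_coeff [IsManifold 𝓘(ℂ, Fin n → ℂ) ω X]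
    {e : Fin r → ∀ x, E.Fib x} {U : Set X} (h : E.IsHolFrame e U) (hU : IsOpen U)
    (f : Fin r → ∀ x, E.Fib x) :
    ∃ g : X → Matrix (Fin r) (Fin r) ℂ, (∀ x ∈ U, ∀ b, f b x = ∑ c, g x c b • e c x) ∧
      ∀ x ∈ U, ∀ b, ContMDiffAt 𝓘(ℂ, Fin n → ℂ) (𝓘(ℂ, Fin n → ℂ).prod 𝓘(ℂ, Fin r → ℂ)) ω
          (fun x => Bundle.TotalSpace.mk' (Fin r → ℂ) x (f b x)) x →
        ∀ c, ContMDiffAt 𝓘(ℂ, Fin n → ℂ) 𝓘(ℂ, ℂ) ω (fun x => g x c b) x := by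
  refine ⟨fun x => Matrix.of fun c b => IsLocalFrameOn.coeff h c x (f b x),
    fun x hx b => IsLocalFrameOn.coeff_sum_eq h (f b) hx, fun x hx b hf c => ?_⟩
  set T := trivializationAt (Fin r → ℂ) E.Fib x with hT
  have hxT : x ∈ T.baseSet := FiberBundle.mem_baseSet_trivializationAt' x
  set C : X → Matrix (Fin r) (Fin r) ℂ := fun y => Matrix.of fun i j => (T ⟨y, e j y⟩).2 i with hC
  have hCs : ∀ i j, ContMDiffAt 𝓘(ℂ, Fin n → ℂ) 𝓘(ℂ, ℂ) ω (fun y => C y i j) x := fun i j => by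
    have := (T.contMDiffAt_section_iff hxT).1 (h.contMDiffAt hU hx j)
    exact (contMDiffAt_pi_space.1 this) i
  have hFs : ∀ i, ContMDiffAt 𝓘(ℂ, Fin n → ℂ) 𝓘(ℂ, ℂ) ω (fun y => (T ⟨y, f b y⟩).2 i) x := fun i =>
    (contMDiffAt_pi_space.1 ((T.contMDiffAt_section_iff hxT).1 hf)) i
  have hCu : ∀ y ∈ U ∩ T.baseSet, IsUnit (C y) := fun y hy => by
    rw [← Matrix.linearIndependent_cols_iff_isUnit]
    have h1 := (IsLocalFrameOn.linearIndependent h hy.1).map' (T.linearEquivAt ℂ y hy.2).toLinearMap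
      (LinearEquiv.ker _)
    exact h1
  have hev : ∀ᶠ y in 𝓝 x, IsLocalFrameOn.coeff h c y (f b y) =
      ∑ i, (C y)⁻¹ c i * (T ⟨y, f b y⟩).2 i := by
    filter_upwards [hU.mem_nhds hx, T.open_baseSet.mem_nhds hxT] with y hyU hyT
    have h1 : (fun i => (T ⟨y, f b y⟩).2 i) = C y *ᵥ fun c => IsLocalFrameOn.coeff h c y (f b y) := by
      have h2 := IsLocalFrameOn.coeff_sum_eq h (f b) hyU
      have h3 : (T ⟨y, f b y⟩).2 = T.linearEquivAt ℂ y hyT (f b y) := rfl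
      funext i
      rw [h3]
      conv_lhs => rw [h2]
      rw [_root_.map_sum, Finset.sum_apply]
      simp only [map_smul, Pi.smul_apply, smul_eq_mul, Matrix.mulVec, dotProduct]
      exact Finset.sum_congr rfl fun j _ => mul_comm _ _
    have h4 : (C y)⁻¹ *ᵥ (fun i => (T ⟨y, f b y⟩).2 i) =
        fun c => IsLocalFrameOn.coeff h c y (f b y) := by
      rw [h1, Matrix.mulVec_mulVec, Matrix.nonsing_inv_mul _
        ((Matrix.isUnit_iff_isUnit_det _).1 (hCu y ⟨hyU, hyT⟩)), Matrix.one_mulVec]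
    exact (congrFun h4 c).symm
  refine ContMDiffAt.congr_of_eventuallyEq ?_ hev
  exact ContMDiffAt.sum fun i _ => (contMDiffAt_matrix_inv hCs (hCu x ⟨hx, hxT⟩) c i).mul (hFs i)

/-- The transition matrix between two holomorphic frames. -/
lemma HolBundle.IsHolFrame.exists_transition [IsManifold 𝓘(ℂ, Fin n → ℂ) ω X]
    {e f : Fin r → ∀ x, E.Fib x} {U U' : Set X} (he : E.IsHolFrame e U) (hU : IsOpen U)
    (hf : E.IsHolFrame f U') (hU' : IsOpen U') :
    ∃ g g' : X → Matrix (Fin r) (Fin r) ℂ,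
      (∀ x ∈ U ∩ U', (∀ b, f b x = ∑ c, g x c b • e c x) ∧ (∀ b, e b x = ∑ c, g' x c b • f c x) ∧
        g x * g' x = 1 ∧ g' x * g x = 1) ∧
      ∀ x ∈ U ∩ U', ∀ c b, ContMDiffAt 𝓘(ℂ, Fin n → ℂ) 𝓘(ℂ, ℂ) ω (fun x => g x c b) x ∧
        ContMDiffAt 𝓘(ℂ, Fin n → ℂ) 𝓘(ℂ, ℂ) ω (fun x => g' x c b) x := by
  obtain ⟨g, hg, hgs⟩ := he.exists_coeff hU f
  obtain ⟨g', hg', hgs'⟩ := hf.exists_coeff hU' e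
  have hprod : ∀ {e f : Fin r → ∀ x, E.Fib x} {U : Set X} (he : E.IsHolFrame e U) {x : X} (hx : x ∈ U)
      {A B : Matrix (Fin r) (Fin r) ℂ}, (∀ b, f b x = ∑ c, A c b • e c x) →
      (∀ b, e b x = ∑ c, B c b • f c x) → A * B = 1 := by
    intro e f U he x hx A B hA hB
    ext c b
    refine congrFun (he.sum_injective hx (c := fun c => (A * B) c b)
      (d := fun c => (1 : Matrix (Fin r) (Fin r) ℂ) c b) ?_) c
    have h1 : ∑ i, (1 : Matrix (Fin r) (Fin r) ℂ) i b • e i x = e b x := by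
      simp [Matrix.one_apply, ite_smul]
    rw [h1, hB b]
    simp only [hA, Finset.smul_sum, smul_smul, Matrix.mul_apply, Finset.sum_smul]
    rw [Finset.sum_comm]
    exact Finset.sum_congr rfl fun i _ => Finset.sum_congr rfl fun j _ => by rw [mul_comm]
  exact ⟨g, g', fun x hx => ⟨hg x hx.1, hg' x hx.2, hprod he hx.1 (hg x hx.1) (hg' x hx.2),
    hprod hf hx.2 (hg' x hx.2) (hg x hx.1)⟩, fun x hx c b =>
    ⟨hgs x hx.1 b (hf.contMDiffAt hU' hx.2 b) c, hgs' x hx.2 b (he.contMDiffAt hU hx.1 b) c⟩⟩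

lemma posDef_gramOf {H : E.Sesq} {W : Set X} (hH : E.IsHermitianMetricOn H W)
    {e : Fin r → ∀ x, E.Fib x} {U : Set X} (he : E.IsHolFrame e U) {x : X} (hx : x ∈ U) (hxW : x ∈ W) :
    (gramOf E H e x).PosDef := by
  refine Matrix.PosDef.of_dotProduct_mulVec_pos ?_ fun v hv => ?_
  · ext a b
    rw [Matrix.conjTranspose_apply, gramOf_apply, gramOf_apply]
    exact (hH.1 x hxW _ _).symm
  · set s : E.Fib x := ∑ i, v i • e i x with hs
    have hs0 : s ≠ 0 := by
      intro h0
      apply hv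
      refine he.sum_injective hx (d := 0) ?_
      rw [← hs, h0]
      simp
    have h1 : star v ⬝ᵥ gramOf E H e x *ᵥ v = H x s s := by
      simp only [hs, dotProduct, Matrix.mulVec, gramOf_apply, map_sum, LinearMap.map_smulₛₗ,
        LinearMap.sum_apply, LinearMap.smul_apply, RingHom.id_apply, smul_eq_mul, Finset.mul_sum,
        Pi.star_apply]
      rw [Finset.sum_comm]
      refine Finset.sum_congr rfl fun a _ => Finset.sum_congr rfl fun b _ => ?_
      rw [starRingEnd_apply]
      ring
    rw [h1, Complex.lt_def]
    refine ⟨hH.2.1 x hxW s hs0, ?_⟩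
    have := congrArg Complex.im (hH.1 x hxW s s)
    rw [Complex.star_def, Complex.conj_im] at this
    simp only [Complex.zero_im]
    linarith

lemma contMDiffAt_gramOf {H : E.Sesq} {W : Set X} (hW : IsOpen W) (hH : E.IsHermitianMetricOn H W)
    {e : Fin r → ∀ x, E.Fib x} {U : Set X} (hU : IsOpen U) (he : E.IsHolFrame e U) {x : X}
    (hx : x ∈ U) (hxW : x ∈ W) (a b : Fin r) :
    ContMDiffAt 𝓘(ℝ, Fin n → ℂ) 𝓘(ℝ, ℂ) ∞ (fun x => gramOf E H e x a b) x :=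
  ((hH.2.2 U e hU he a b) x ⟨hx, hxW⟩).contMDiffAt ((hU.inter hW).mem_nhds ⟨hx, hxW⟩)

lemma isGramAt_comp {H : E.Sesq} {W : Set X} (hW : IsOpen W) (hH : E.IsHermitianMetricOn H W)
    {e : Fin r → ∀ x, E.Fib x} {U : Set X} (hU : IsOpen U) (he : E.IsHolFrame e U)
    {ψ : (Fin m → ℂ) → X} {t : Fin m → ℂ}
    (hψ : ContMDiffAt 𝓘(ℝ, Fin m → ℂ) 𝓘(ℝ, Fin n → ℂ) ∞ ψ t)
    (hx : ψ t ∈ U) (hxW : ψ t ∈ W) : IsGramAt (fun t => gramOf E H e (ψ t)) t where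
  smooth i j := contMDiffAt_iff_contDiffAt.1
    ((contMDiffAt_gramOf hW hH hU he hx hxW i j).comp t hψ)
  isUnit := (posDef_gramOf hH he hx hxW).isUnit

variable (E) in
/-- The Chern–Weil form of a metric, as a differential form. -/
def chernWeilForm (H : E.Sesq) (Φ : MvPolynomial (Fin r × Fin r) ℂ) (k : ℕ) : DForm n (2 * k) X :=
  fun x => (gramForm Φ k (E.gram H x) (chartAt (Fin n → ℂ) x x)).compContinuousLinearMap
    (mfderiv 𝓘(ℝ, Fin n → ℂ) 𝓘(ℝ, Fin n → ℂ) (chartAt (Fin n → ℂ) x) x)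

variable (E) in
/-- The transgression form between the Chern–Weil forms of two metrics. -/
def transgressionForm (H₀ H₁ : E.Sesq) (Φ : MvPolynomial (Fin r × Fin r) ℂ) (k : ℕ) :
    DForm n (2 * k + 1) X :=
  fun x => (gramTransgression Φ k (E.gram H₀ x) (E.gram H₁ x)
    (chartAt (Fin n → ℂ) x x)).compContinuousLinearMap
      (mfderiv 𝓘(ℝ, Fin n → ℂ) 𝓘(ℝ, Fin n → ℂ) (chartAt (Fin n → ℂ) x) x)

variable [IsManifold 𝓘(ℂ, Fin n → ℂ) ω X]

lemma isGramAt_gram {H : E.Sesq} {W : Set X} (hW : IsOpen W) (hH : E.IsHermitianMetricOn H W)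
    {x : X} {t : Fin n → ℂ} (ht : t ∈ (chartAt (Fin n → ℂ) x).target)
    (hb : (chartAt (Fin n → ℂ) x).symm t ∈ (trivializationAt (Fin r → ℂ) E.Fib x).baseSet)
    (hxW : (chartAt (Fin n → ℂ) x).symm t ∈ W) : IsGramAt (E.gram H x) t :=
  isGramAt_comp hW hH (trivializationAt (Fin r → ℂ) E.Fib x).open_baseSet (isHolFrame_prefFrame E x)
    (contMDiffAt_real ((isHolChart_of_mem_atlas (chart_mem_atlas _ x)).contMDiffAt_symm ht)) hb hxW

lemma isGramAt_gram_self {H : E.Sesq} {W : Set X} (hW : IsOpen W) (hH : E.IsHermitianMetricOn H W)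
    {x : X} (hxW : x ∈ W) : IsGramAt (E.gram H x) (chartAt (Fin n → ℂ) x x) := by
  have hx := (chartAt (Fin n → ℂ) x).left_inv (mem_chart_source _ x)
  refine isGramAt_gram hW hH (mem_chart_target _ x) ?_ ?_
  · rw [hx]; exact FiberBundle.mem_baseSet_trivializationAt' x
  · rwa [hx]

lemma chernWeil_eq {H : E.Sesq} {W : Set X} (hW : IsOpen W) (hH : E.IsHermitianMetricOn H W)
    (Φ : MvPolynomial (Fin r × Fin r) ℂ) (k : ℕ) {x : X} (hxW : x ∈ W)
    (t : Fin (2 * k) → TangentSpace 𝓘(ℝ, Fin n → ℂ) x) :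
    E.chernWeil H Φ k x t = chernWeilForm E H Φ k x t :=
  polyOfTwoForms_eq_gramForm Φ k (isGramAt_gram_self hW hH hxW) _

/-- `e ∘ ψ` multiplied by `g` is a holomorphic frame near `t` of the pullback of `E` along the
holomorphic map `ψ`. -/
structure IsPullbackFrame (E : HolBundle.{u, w} n r X) (ψ : (Fin m → ℂ) → X)
    (e : Fin r → ∀ x, E.Fib x) (g : (Fin m → ℂ) → Matrix (Fin r) (Fin r) ℂ) (t : Fin m → ℂ) :
    Prop where
  hol : ContMDiffAt 𝓘(ℂ, Fin m → ℂ) 𝓘(ℂ, Fin n → ℂ) ω ψ t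
  frame : ∃ U, IsOpen U ∧ ψ t ∈ U ∧ E.IsHolFrame e U
  hol_coeff : ∀ i j, ContDiffAt ℂ ω (fun x => g x i j) t
  isUnit : IsUnit (g t)

lemma IsPullbackFrame.exists_prefFrame {ψ : (Fin m → ℂ) → X} {e : Fin r → ∀ x, E.Fib x}
    {g : (Fin m → ℂ) → Matrix (Fin r) (Fin r) ℂ} {t : Fin m → ℂ} (h : IsPullbackFrame E ψ e g t) :
    ContDiffAt ℂ ω (fun x => chartAt (Fin n → ℂ) (ψ t) (ψ x)) t ∧
    ∃ k : (Fin m → ℂ) → Matrix (Fin r) (Fin r) ℂ, (∀ i j, ContDiffAt ℂ ω (fun x => k x i j) t) ∧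
      IsUnit (k t) ∧ ∀ H : E.Sesq, ∀ᶠ x in 𝓝 t, (g x)ᴴ * gramOf E H e (ψ x) * g x =
        (k x)ᴴ * E.gram H (ψ t) (chartAt (Fin n → ℂ) (ψ t) (ψ x)) * k x := by
  obtain ⟨U, hU, hxU, he⟩ := h.frame
  have hφ := isHolChart_of_mem_atlas (chart_mem_atlas (Fin n → ℂ) (ψ t))
  have hb := FiberBundle.mem_baseSet_trivializationAt' (F := Fin r → ℂ) (E := E.Fib) (ψ t)
  refine ⟨contMDiffAt_iff_contDiffAt.1 ((hφ.contMDiffAt (mem_chart_source _ _)).comp t h.hol), ?_⟩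
  obtain ⟨p, p', hp, hps⟩ := (isHolFrame_prefFrame E (ψ t)).exists_transition
    (trivializationAt (Fin r → ℂ) E.Fib (ψ t)).open_baseSet he hU
  refine ⟨fun x => p (ψ x) * g x, fun i j => ?_, ?_, fun H => ?_⟩
  · simp only [Matrix.mul_apply]
    refine ContDiffAt.sum fun c _ => ContDiffAt.mul ?_ (h.hol_coeff c j)
    exact contMDiffAt_iff_contDiffAt.1 (((hps (ψ t) ⟨hb, hxU⟩ i c).1).comp t h.hol)
  · refine IsUnit.mul ?_ h.isUnit
    exact ⟨⟨p (ψ t), p' (ψ t), (hp _ ⟨hb, hxU⟩).2.2.1, (hp _ ⟨hb, hxU⟩).2.2.2⟩, rfl⟩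
  · have h1 := h.hol.continuousAt (((trivializationAt (Fin r → ℂ) E.Fib (ψ t)).open_baseSet.inter
      hU).mem_nhds ⟨hb, hxU⟩)
    have h2 := h.hol.continuousAt ((chartAt (Fin n → ℂ) (ψ t)).open_source.mem_nhds
      (mem_chart_source _ _))
    filter_upwards [h1, h2] with x hx1 hx2
    rw [gram_eq, (chartAt (Fin n → ℂ) (ψ t)).left_inv hx2, gramOf_transition H (hp _ hx1).1,
      Matrix.conjTranspose_mul]
    simp only [Matrix.mul_assoc]

lemma pb_chart {ψ : (Fin n → ℂ) → X} {t : Fin n → ℂ}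
    (hψ : ContMDiffAt 𝓘(ℂ, Fin n → ℂ) 𝓘(ℂ, Fin n → ℂ) ω ψ t)
    (F : (Fin n → ℂ) [⋀^Fin m]→L[ℝ] ℂ) :
    (F.compContinuousLinearMap (mfderiv 𝓘(ℝ, Fin n → ℂ) 𝓘(ℝ, Fin n → ℂ) (chartAt (Fin n → ℂ) (ψ t))
      (ψ t))).compContinuousLinearMap (mfderiv 𝓘(ℝ, Fin n → ℂ) 𝓘(ℝ, Fin n → ℂ) ψ t) =
      F.compContinuousLinearMap (fderiv ℝ (fun x => chartAt (Fin n → ℂ) (ψ t) (ψ x)) t) := by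
  have hφ := isHolChart_of_mem_atlas (chart_mem_atlas (Fin n → ℂ) (ψ t))
  have h4 : fderiv ℝ (fun x => chartAt (Fin n → ℂ) (ψ t) (ψ x)) t =
      (mfderiv 𝓘(ℝ, Fin n → ℂ) 𝓘(ℝ, Fin n → ℂ) (chartAt (Fin n → ℂ) (ψ t)) (ψ t)).comp
        (mfderiv 𝓘(ℝ, Fin n → ℂ) 𝓘(ℝ, Fin n → ℂ) ψ t) := by
    rw [← mfderiv_eq_fderiv]
    exact mfderiv_comp t (hφ.mdifferentiableAt (mem_chart_source _ _))
      ((contMDiffAt_real hψ).mdifferentiableAt (by simp))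
  rw [h4]
  rfl

/-- The pullback of the Chern–Weil form is computed by any holomorphic frame of the pulled back
bundle. -/
lemma pb_chernWeilForm {Φ : MvPolynomial (Fin r × Fin r) ℂ} (hΦ : IsInvariantPolynomial Φ) (k : ℕ)
    {H : E.Sesq} {W : Set X} (hW : IsOpen W) (hH : E.IsHermitianMetricOn H W) {ψ : (Fin n → ℂ) → X}
    {e : Fin r → ∀ x, E.Fib x} {g h : (Fin n → ℂ) → Matrix (Fin r) (Fin r) ℂ} {t : Fin n → ℂ}
    (hf : IsPullbackFrame E ψ e g t) (hxW : ψ t ∈ W)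
    (hh : ∀ᶠ x in 𝓝 t, h x = (g x)ᴴ * gramOf E H e (ψ x) * g x) :
    pb ψ (chernWeilForm E H Φ k) t = gramForm Φ k h t := by
  obtain ⟨hc, p, hp, hpu, hpe⟩ := hf.exists_prefFrame
  rw [gramForm_eq (ψ := fun x => chartAt (Fin n → ℂ) (ψ t) (ψ x)) hΦ k (isGramAt_gram_self hW hH hxW)
    hc hp hpu ((hh.and (hpe H)).mono fun x hx => hx.1.trans hx.2)]
  exact pb_chart hf.hol _

lemma pb_transgressionForm {Φ : MvPolynomial (Fin r × Fin r) ℂ} (hΦ : IsInvariantPolynomial Φ) (k : ℕ)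
    {H₀ H₁ : E.Sesq} {W : Set X} (hW : IsOpen W) (hH₀ : E.IsHermitianMetricOn H₀ W)
    (hH₁ : E.IsHermitianMetricOn H₁ W) {ψ : (Fin n → ℂ) → X}
    {e : Fin r → ∀ x, E.Fib x} {g h₀ h₁ : (Fin n → ℂ) → Matrix (Fin r) (Fin r) ℂ} {t : Fin n → ℂ}
    (hf : IsPullbackFrame E ψ e g t) (hxW : ψ t ∈ W)
    (hh₀ : ∀ᶠ x in 𝓝 t, h₀ x = (g x)ᴴ * gramOf E H₀ e (ψ x) * g x)
    (hh₁ : ∀ᶠ x in 𝓝 t, h₁ x = (g x)ᴴ * gramOf E H₁ e (ψ x) * g x) :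
    pb ψ (transgressionForm E H₀ H₁ Φ k) t = gramTransgression Φ k h₀ h₁ t := by
  obtain ⟨hc, p, hp, hpu, hpe⟩ := hf.exists_prefFrame
  rw [gramTransgression_eq (ψ := fun x => chartAt (Fin n → ℂ) (ψ t) (ψ x)) hΦ k
    (isGramAt_gram_self hW hH₀ hxW) (isGramAt_gram_self hW hH₁ hxW) hc hp hpu
    ((hh₀.and (hpe H₀)).mono fun x hx => hx.1.trans hx.2)
    ((hh₁.and (hpe H₁)).mono fun x hx => hx.1.trans hx.2)]
  exact pb_chart hf.hol _

end Frames

/-! ## Division by a coordinate and extraction of roots -/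

section Division

variable {n : ℕ}

/-- A holomorphic function that vanishes where the `i`-th coordinate does is a smooth multiple of
this coordinate. -/
lemma exists_smooth_quotient {a : (Fin n → ℂ) → ℂ} {s₀ : Fin n → ℂ} (i : Fin n) (h0 : s₀ i = 0)
    (ha : ContDiffAt ℂ ω a s₀) (hz : ∀ᶠ s in 𝓝 s₀, s i = 0 → a s = 0) :
    ∃ q : (Fin n → ℂ) → ℂ, ContDiffAt ℝ ∞ q s₀ ∧ ∀ᶠ s in 𝓝 s₀, a s = s i * q s := by
  obtain ⟨ε, hε, hB⟩ := Metric.eventually_nhds_iff_ball.1 ((ha.eventually (by simp)).and hz)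
  set B := Metric.ball s₀ ε with hBdef
  let σ : (Fin n → ℂ) × ℝ → Fin n → ℂ := fun p => Function.update p.1 i ((p.2 : ℂ) * p.1 i)
  have hσs : ContDiff ℝ ∞ σ := by
    rw [contDiff_pi]
    intro j
    by_cases hj : j = i
    · subst hj
      simp only [σ, Function.update_self]
      exact (Complex.ofRealCLM.contDiff.comp contDiff_snd).mul
        ((contDiff_apply ℝ ℂ j).comp contDiff_fst)
    · simp only [σ, Function.update_of_ne hj]
      exact (contDiff_apply ℝ ℂ j).comp contDiff_fst
  have hσB : ∀ s ∈ B, ∀ τ ∈ Set.Icc (0 : ℝ) 1, σ (s, τ) ∈ B := by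
    intro s hs τ hτ
    rw [hBdef, Metric.mem_ball, dist_pi_lt_iff hε] at hs ⊢
    intro j
    by_cases hj : j = i
    · subst hj
      simp only [σ, Function.update_self, h0, dist_zero_right, norm_mul, Complex.norm_real]
      have h1 := hs j
      rw [h0, dist_zero_right] at h1
      refine lt_of_le_of_lt ?_ h1
      rw [Real.norm_of_nonneg hτ.1]
      exact mul_le_of_le_one_left (norm_nonneg _) hτ.2
    · simp only [σ, Function.update_of_ne hj]
      exact hs j
  let f : (Fin n → ℂ) × ℝ → ℂ := fun p => fderiv ℂ a (σ p) (Pi.single i 1)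
  set Ω : Set ((Fin n → ℂ) × ℝ) := σ ⁻¹' B with hΩ
  have hΩo : IsOpen Ω := Metric.isOpen_ball.preimage hσs.continuous
  have hf : ContDiffOn ℝ ∞ f Ω := by
    intro p hp
    have h1 : ContDiffAt ℝ ∞ (fderiv ℂ a) (σ p) :=
      (((hB _ hp).1.fderiv_right (m := ω) (by simp)).restrict_scalars ℝ).of_le le_top
    have h2 : ContDiffAt ℝ ∞ (fun p => fderiv ℂ a (σ p)) p := h1.comp p hσs.contDiffAt
    have h3 : ContDiffAt ℝ ∞ (fun L : (Fin n → ℂ) →L[ℂ] ℂ => L (Pi.single i 1)) (fderiv ℂ a (σ p)) :=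
      ((ContinuousLinearMap.apply ℂ ℂ (Pi.single i 1 : Fin n → ℂ)).contDiff.restrict_scalars
        ℝ).contDiffAt
    exact (h3.comp p h2).contDiffWithinAt
  refine ⟨fun s => ∫ τ in (0 : ℝ)..1, f (s, τ), ?_, ?_⟩
  · have := contDiffOn_integral_unitInterval hΩo hf (U := B) Metric.isOpen_ball
      (fun s hs τ hτ => hσB s hs τ hτ)
    exact this.contDiffAt (Metric.ball_mem_nhds _ hε)
  · filter_upwards [Metric.ball_mem_nhds s₀ hε] with s hs
    have hder : ∀ τ ∈ Set.uIcc (0 : ℝ) 1,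
        HasDerivAt (fun τ : ℝ => a (σ (s, τ))) (s i * f (s, τ)) τ := by
      intro τ hτ
      rw [Set.uIcc_of_le zero_le_one] at hτ
      have h1 : HasFDerivAt a ((fderiv ℂ a (σ (s, τ))).restrictScalars ℝ) (σ (s, τ)) :=
        ((hB _ (hσB s hs τ hτ)).1.differentiableAt (by simp)).hasFDerivAt.restrictScalars ℝ
      have h2 : HasDerivAt (fun τ : ℝ => σ (s, τ)) (Pi.single i (s i)) τ := by
        rw [hasDerivAt_pi]
        intro j
        by_cases hj : j = i
        · subst hj
          simp only [σ, Function.update_self, Pi.single_eq_same]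
          simpa using (Complex.ofRealCLM.hasDerivAt (x := τ)).mul_const (s j)
        · simp only [σ, Function.update_of_ne hj, Pi.single_eq_of_ne hj]
          exact hasDerivAt_const _ _
      have h3 := h1.comp_hasDerivAt τ h2
      have h4 : (Pi.single i (s i) : Fin n → ℂ) = s i • Pi.single i 1 := by
        rw [← Pi.single_smul, smul_eq_mul, mul_one]
      have h5 : ((fderiv ℂ a (σ (s, τ))).restrictScalars ℝ) (Pi.single i (s i)) = s i * f (s, τ) := by
        rw [h4]
        exact (fderiv ℂ a (σ (s, τ))).map_smul _ _
      rw [h5] at h3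
      exact h3
    have hcont : ContinuousOn (fun τ : ℝ => s i * f (s, τ)) (Set.uIcc 0 1) := by
      rw [Set.uIcc_of_le zero_le_one]
      refine continuousOn_const.mul (hf.continuousOn.comp (by fun_prop) fun τ hτ => hσB s hs τ hτ)
    have hFTC := intervalIntegral.integral_eq_sub_of_hasDerivAt hder hcont.intervalIntegrable
    rw [intervalIntegral.integral_const_mul] at hFTC
    have e1 : σ (s, 1) = s := by simp [σ]
    have e0 : a (σ (s, 0)) = 0 := by
      refine (hB _ (hσB s hs 0 ⟨le_rfl, zero_le_one⟩)).2 ?_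
      simp [σ]
    rw [e1, e0, sub_zero] at hFTC
    exact hFTC.symm

/-- Local roots of smooth nonvanishing functions. -/
lemma exists_smooth_root {W : Type*} [NormedAddCommGroup W] [NormedSpace ℝ W] {q : W → ℂ} {t : W}
    (hq : ContDiffAt ℝ ∞ q t) (h0 : q t ≠ 0) {N : ℕ} (hN : 0 < N) :
    ∃ ρ : W → ℂ, ContDiffAt ℝ ∞ ρ t ∧ (∀ᶠ x in 𝓝 t, ρ x ^ N = q x) ∧ ∀ x, ρ x ≠ 0 := by
  have hN' : (N : ℂ) ≠ 0 := Nat.cast_ne_zero.2 hN.ne'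
  refine ⟨fun x => Complex.exp (Complex.log (q t) / N) *
    Complex.exp (Complex.log (q x / q t) / N), ?_, ?_, fun x => ?_⟩
  · have h1 : ContDiffAt ℝ ∞ (fun x => q x / q t) t := by
      simp only [div_eq_mul_inv]
      exact hq.mul contDiffAt_const
    have h2 : ContDiffAt ℝ ∞ Complex.log (q t / q t) := by
      rw [div_self h0]
      exact ((Complex.contDiffAt_log (n := ∞) Complex.one_mem_slitPlane).restrict_scalars ℝ)
    have h3 : ContDiffAt ℝ ∞ (fun x => Complex.log (q x / q t) / N) t := by
      simp only [div_eq_mul_inv _ (N : ℂ)]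
      exact (h2.comp t h1).mul contDiffAt_const
    exact contDiffAt_const.mul (Complex.contDiff_exp.contDiffAt.comp t h3)
  · have hne : ∀ᶠ x in 𝓝 t, q x ≠ 0 := hq.continuousAt.eventually_ne h0
    filter_upwards [hne] with x hx
    rw [mul_pow, ← Complex.exp_nat_mul, ← Complex.exp_nat_mul, mul_div_cancel₀ _ hN',
      mul_div_cancel₀ _ hN', Complex.exp_log h0, Complex.exp_log (div_ne_zero hx h0),
      mul_div_cancel₀ _ h0]
  · exact mul_ne_zero (Complex.exp_ne_zero _) (Complex.exp_ne_zero _)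

lemma monotone_eq_of_card_eq {r : ℕ} {α β : Fin r → ℚ} (hα : Monotone α) (hβ : Monotone β)
    (h : ∀ t : ℝ, (Finset.univ.filter fun j => t ≤ (α j : ℝ)).card =
      (Finset.univ.filter fun j => t ≤ (β j : ℝ)).card) : α = β := by
  have key : ∀ {α β : Fin r → ℚ}, Monotone α → Monotone β →
      (∀ t : ℝ, (Finset.univ.filter fun j => t ≤ (α j : ℝ)).card =
      (Finset.univ.filter fun j => t ≤ (β j : ℝ)).card) → ∀ j, β j ≤ α j := by
    intro α β hα hβ h j
    by_contra hlt
    push Not at hlt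
    have h1 : (Finset.univ.filter fun k => ((β j : ℚ) : ℝ) ≤ (α k : ℝ)) ⊆ Finset.Ioi j := by
      intro k hk
      rw [Finset.mem_filter] at hk
      rw [Finset.mem_Ioi]
      by_contra hkj
      have h2 := hα (not_lt.1 hkj)
      have h3 : β j ≤ α k := by exact_mod_cast hk.2
      exact absurd (h3.trans h2) (not_le.2 hlt)
    have h2 : Finset.Ici j ⊆ Finset.univ.filter fun k => ((β j : ℚ) : ℝ) ≤ (β k : ℝ) := by
      intro k hk
      rw [Finset.mem_Ici] at hk
      rw [Finset.mem_filter]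
      exact ⟨Finset.mem_univ _, by exact_mod_cast hβ hk⟩
    have h3 := (Finset.card_le_card h2).trans ((h (β j)).symm.le.trans (Finset.card_le_card h1))
    have h4 : (Finset.Ioi j).card < (Finset.Ici j).card :=
      Finset.card_lt_card ((Finset.ssubset_iff_of_subset Finset.Ioi_subset_Ici_self).2
        ⟨j, by simp, by simp⟩)
    omega
  funext j
  exact le_antisymm (key hβ hα (fun t => (h t).symm) j) (key hα hβ h j)

end Division

/-! ## Extension of admissible metrics over branched covers -/

section Comparison

open scoped Matrix ComplexOrder

variable {n r : ℕ} {X : Type u} [TopologicalSpace X] [ChartedSpace (Fin n → ℂ) X]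
  {E : HolBundle.{u, w} n r X} {D : Set X}

lemma finrank_filt {filt : ∀ x, ℝ → Submodule ℂ (E.Fib x)} {U : Set X} {e : Fin r → ∀ x, E.Fib x}
    {α : Fin r → ℚ} (he : IsAdaptedFrame E D filt U e α) {x : X} (hxD : x ∈ D) (hx : x ∈ U) (t : ℝ) :
    Module.finrank ℂ (filt x t) = (Finset.univ.filter fun j => t ≤ (α j : ℝ)).card := by
  have h1 : {s | ∃ j, t ≤ (α j : ℝ) ∧ s = e j x} =
      Set.range fun j : {j // t ≤ (α j : ℝ)} => e j x := by
    ext s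
    constructor
    · rintro ⟨j, hj, rfl⟩
      exact ⟨⟨j, hj⟩, rfl⟩
    · rintro ⟨⟨j, hj⟩, rfl⟩
      exact ⟨j, hj, rfl⟩
  rw [he.2.2.2.2 x ⟨hxD, hx⟩ t, h1, finrank_span_eq_card, Fintype.card_subtype]
  exact (IsLocalFrameOn.linearIndependent he.2.1 hx).comp _ Subtype.val_injective

lemma adapted_weights_eq {filt : ∀ x, ℝ → Submodule ℂ (E.Fib x)} {U U' : Set X}
    {e f : Fin r → ∀ x, E.Fib x} {α β : Fin r → ℚ} (he : IsAdaptedFrame E D filt U e α)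
    (hf : IsAdaptedFrame E D filt U' f β) {x : X} (hxD : x ∈ D) (hx : x ∈ U) (hx' : x ∈ U') :
    α = β :=
  monotone_eq_of_card_eq he.2.2.1 hf.2.2.1 fun t => by
    rw [← finrank_filt he hxD hx, ← finrank_filt hf hxD hx']

lemma adapted_transition_eq_zero {filt : ∀ x, ℝ → Submodule ℂ (E.Fib x)} {U U' : Set X}
    {e f : Fin r → ∀ x, E.Fib x} {α : Fin r → ℚ} (he : IsAdaptedFrame E D filt U e α)
    (hf : IsAdaptedFrame E D filt U' f α) {x : X} (hxD : x ∈ D) (hx : x ∈ U) (hx' : x ∈ U')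
    {g : Matrix (Fin r) (Fin r) ℂ} (hg : ∀ b, f b x = ∑ c, g c b • e c x) {c b : Fin r}
    (hcb : α c < α b) : g c b = 0 := by
  have h1 : f b x ∈ filt x (α b) := by
    rw [hf.2.2.2.2 x ⟨hxD, hx'⟩]
    exact Submodule.subset_span ⟨b, le_rfl, rfl⟩
  rw [he.2.2.2.2 x ⟨hxD, hx⟩] at h1
  set L := (IsLocalFrameOn.toBasisAt he.2.1 hx).coord c with hL
  have hLe : ∀ j, L (e j x) = if j = c then 1 else 0 := fun j => by
    rw [hL, ← IsLocalFrameOn.toBasisAt_coe he.2.1 hx j, Module.Basis.coord_apply,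
      Module.Basis.repr_self, Finsupp.single_apply]
  have h2 : Submodule.span ℂ {s | ∃ j, ((α b : ℚ) : ℝ) ≤ (α j : ℝ) ∧ s = e j x} ≤ LinearMap.ker L := by
    rw [Submodule.span_le]
    rintro s ⟨j, hj, rfl⟩
    have hjc : j ≠ c := by
      rintro rfl
      exact absurd (by exact_mod_cast hj) (not_le.2 hcb)
    rw [SetLike.mem_coe, LinearMap.mem_ker, hLe, if_neg hjc]
  have h3 : L (f b x) = 0 := h2 h1
  rw [hg b, _root_.map_sum] at h3
  simpa [hLe] using h3

/-- A holomorphic function on `X`, pulled back to a branched cover and multiplied by `w ^ κ`, is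
divisible by `w ^ μ` if it vanishes on `D` or `μ ≤ κ`. -/
lemma exists_smooth_factor {Q : (Fin n → ℂ) → X} {t₀ : Fin n → ℂ}
    (hQ : ContMDiffAt 𝓘(ℂ, Fin n → ℂ) 𝓘(ℂ, Fin n → ℂ) ω Q t₀) (hD : Q t₀ ∈ D)
    {z : OpenPartialHomeomorph X (Fin n → ℂ)} {i : Fin n} (hz : IsDivisorChart D z i)
    (hzs : Q t₀ ∈ z.source) {w : (Fin n → ℂ) → ℂ} (hw : ContDiffAt ℂ ω w t₀) {N : ℕ}
    (hwN : ∀ᶠ t in 𝓝 t₀, z (Q t) i = w t ^ N) {γ : X → ℂ}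
    (hγ : ContMDiffAt 𝓘(ℂ, Fin n → ℂ) 𝓘(ℂ, ℂ) ω γ (Q t₀)) {κ μ : ℕ}
    (h : κ < μ → μ ≤ N ∧ ∀ᶠ x in 𝓝 (Q t₀), x ∈ D → γ x = 0) :
    ∃ A : (Fin n → ℂ) → ℂ, ContDiffAt ℝ ∞ A t₀ ∧ ∀ᶠ t in 𝓝 t₀, w t ^ κ * γ (Q t) = A t * w t ^ μ := by
  have hwr : ContDiffAt ℝ ∞ w t₀ := smooth_of_holomorphic hw
  by_cases hκ : κ < μ
  · obtain ⟨hμ, hγ0⟩ := h hκ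
    have hs0 : z (Q t₀) i = 0 := (hz.2 _ hzs).1 hD
    have ht : z (Q t₀) ∈ z.target := z.map_source hzs
    have hsymm : ContMDiffAt 𝓘(ℂ, Fin n → ℂ) 𝓘(ℂ, Fin n → ℂ) ω z.symm (z (Q t₀)) :=
      IsHolChart.contMDiffAt_symm hz.1 ht
    have ha : ContDiffAt ℂ ω (fun s => γ (z.symm s)) (z (Q t₀)) := by
      refine contMDiffAt_iff_contDiffAt.1 (ContMDiffAt.comp _ ?_ hsymm)
      rwa [z.left_inv hzs]
    have hcs := hsymm.continuousAt
    rw [ContinuousAt, z.left_inv hzs] at hcs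
    obtain ⟨q, hq, hqe⟩ := exists_smooth_quotient i hs0 ha (by
      filter_upwards [hcs hγ0, z.open_target.mem_nhds ht] with s hs hst hsi
      refine hs ((hz.2 _ (z.map_target hst)).2 ?_)
      rwa [z.right_inv hst])
    have hzQ : ContMDiffAt 𝓘(ℂ, Fin n → ℂ) 𝓘(ℂ, Fin n → ℂ) ω (fun t => z (Q t)) t₀ :=
      (IsHolChart.contMDiffAt hz.1 hzs).comp t₀ hQ
    have hzQr : ContDiffAt ℝ ∞ (fun t => z (Q t)) t₀ :=
      smooth_of_holomorphic (contMDiffAt_iff_contDiffAt.1 hzQ)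
    refine ⟨fun t => w t ^ (N + κ - μ) * q (z (Q t)), (hwr.pow _).mul (hq.comp t₀ hzQr), ?_⟩
    filter_upwards [hwN, hzQ.continuousAt hqe, hQ.continuousAt (z.open_source.mem_nhds hzs)]
      with t h1 h2 h3
    have h4 : γ (Q t) = w t ^ N * q (z (Q t)) := by
      have h5 : γ (z.symm (z (Q t))) = z (Q t) i * q (z (Q t)) := h2
      rwa [z.left_inv h3, h1] at h5
    rw [h4, ← mul_assoc, ← pow_add, mul_right_comm, ← pow_add, show N + κ - μ + μ = κ + N by omega]
  · have hγQ : ContDiffAt ℂ ω (fun t => γ (Q t)) t₀ :=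
      contMDiffAt_iff_contDiffAt.1 (hγ.comp t₀ hQ)
    refine ⟨fun t => w t ^ (κ - μ) * γ (Q t), (hwr.pow _).mul (smooth_of_holomorphic hγQ),
      Filter.Eventually.of_forall fun t => ?_⟩
    rw [mul_right_comm, ← pow_add, Nat.sub_add_cancel (not_lt.1 hκ)]

lemma eq_of_frequently {W : Type*} [TopologicalSpace W] {f : W → ℂ} {t : W} {c : ℂ}
    (hf : ContinuousAt f t) (h : ∃ᶠ x in 𝓝 t, f x = c) : f t = c :=
  isClosed_singleton.mem_of_frequently_of_tendsto (s := {c}) h hf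

lemma den_dvd_of_mul_eq {α : ℚ} {N κ : ℕ} (h : (κ : ℚ) = N * α) : α.den ∣ N := by
  have h1 : ((κ * α.den : ℤ) : ℚ) = ((N * α.num : ℤ) : ℚ) := by
    push_cast
    rw [h, mul_assoc, Rat.mul_den_eq_num]
  have h2 : (κ * α.den : ℤ) = N * α.num := by exact_mod_cast h1
  have h3 : (α.den : ℤ) ∣ α.num * N := ⟨κ, by rw [mul_comm α.num, ← h2, mul_comm]⟩
  have h4 : Int.gcd α.den α.num = 1 := by
    rw [Int.gcd_comm]
    exact α.reduced
  exact_mod_cast Int.dvd_of_dvd_mul_right_of_gcd_one h3 h4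

lemma eq_diagonal_conj_iff {x : Fin r → ℂ} {A M : Matrix (Fin r) (Fin r) ℂ} :
    A = (Matrix.diagonal x)ᴴ * M * Matrix.diagonal x ↔ ∀ a b, A a b = star (x a) * M a b * x b := by
  rw [← Matrix.ext_iff]
  simp [Matrix.diagonal_conjTranspose, Matrix.mul_diagonal, Matrix.diagonal_mul]

variable [IsManifold 𝓘(ℂ, Fin n → ℂ) ω X]

/-- An admissible metric extends to a smooth metric over any local cover that is branched along `D`
in the way prescribed by the weights. -/
theorem IsAdmissible.exists_extension {P : ParabolicStructure E D} {H : E.Sesq}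
    (hH : IsAdmissible P H) {Q : (Fin n → ℂ) → X} {t₀ : Fin n → ℂ}
    (hQ : ContMDiffAt 𝓘(ℂ, Fin n → ℂ) 𝓘(ℂ, Fin n → ℂ) ω Q t₀) (hD : Q t₀ ∈ D)
    {U : Set X} {e : Fin r → ∀ x, E.Fib x} {α : Fin r → ℚ} (he : IsAdaptedFrame E D P.filt U e α)
    (hU : Q t₀ ∈ U) {z : OpenPartialHomeomorph X (Fin n → ℂ)} {i : Fin n} (hz : IsDivisorChart D z i)
    (hzs : Q t₀ ∈ z.source) {w : (Fin n → ℂ) → ℂ} (hw : ContDiffAt ℂ ω w t₀) {N : ℕ} (hN : 0 < N)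
    (hwN : ∀ᶠ t in 𝓝 t₀, z (Q t) i = w t ^ N) {κ : Fin r → ℕ} (hκ : ∀ j, (κ j : ℚ) = N * α j)
    (hdense : ∃ᶠ t in 𝓝 t₀, w t ≠ 0) :
    ∃ M : (Fin n → ℂ) → Matrix (Fin r) (Fin r) ℂ, (∀ a b, ContDiffAt ℝ ∞ (fun t => M t a b) t₀) ∧
      ∀ᶠ t in 𝓝 t₀, (M t).PosDef ∧ (w t ≠ 0 → gramOf E H e (Q t) =
        (Matrix.diagonal fun a => w t ^ κ a)ᴴ * M t * Matrix.diagonal fun a => w t ^ κ a) := by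
  obtain ⟨z₂, i₂, f, β, N₂, κ₂, G, hp₂, hz₂, hf, hN₂, hκ₂, hGs, hG⟩ := hH.2 _ hD
  obtain rfl : α = β := adapted_weights_eq he hf hD hU hp₂
  have hdvd : N₂ ∣ N := by
    rw [hN₂]
    exact Finset.lcm_dvd fun j _ => den_dvd_of_mul_eq (hκ j)
  obtain ⟨m, rfl⟩ := hdvd
  have hN₂0 : 0 < N₂ := Nat.pos_of_mul_pos_right hN
  have hκκ : ∀ j, κ j = m * κ₂ j := fun j => by
    have : (κ j : ℚ) = ((m * κ₂ j : ℕ) : ℚ) := by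
      push_cast
      rw [hκ, hκ₂]
      push_cast
      ring
    exact_mod_cast this
  have hwr : ContDiffAt ℝ ∞ w t₀ := smooth_of_holomorphic hw
  have hzQ : ContMDiffAt 𝓘(ℂ, Fin n → ℂ) 𝓘(ℂ, Fin n → ℂ) ω (fun t => z (Q t)) t₀ :=
    (IsHolChart.contMDiffAt hz.1 hzs).comp t₀ hQ
  have hzQr : ContDiffAt ℝ ∞ (fun t => z (Q t)) t₀ :=
    smooth_of_holomorphic (contMDiffAt_iff_contDiffAt.1 hzQ)
  have hz₂Q : ContMDiffAt 𝓘(ℂ, Fin n → ℂ) 𝓘(ℂ, Fin n → ℂ) ω (fun t => z₂ (Q t)) t₀ :=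
    (IsHolChart.contMDiffAt hz₂.1 hp₂).comp t₀ hQ
  have hz₂Qr : ContDiffAt ℝ ∞ (fun t => z₂ (Q t)) t₀ :=
    smooth_of_holomorphic (contMDiffAt_iff_contDiffAt.1 hz₂Q)
  have hnear : ∀ᶠ t in 𝓝 t₀, Q t ∈ z.source ∧ Q t ∈ z₂.source ∧ Q t ∈ U := by
    filter_upwards [hQ.continuousAt (z.open_source.mem_nhds hzs),
      hQ.continuousAt (z₂.open_source.mem_nhds hp₂), hQ.continuousAt (he.1.mem_nhds hU)]
      with t h1 h2 h3 using ⟨h1, h2, h3⟩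
  -- comparison of the two equations of `D`
  have hquot : ∀ {z z' : OpenPartialHomeomorph X (Fin n → ℂ)} {i i' : Fin n},
      IsDivisorChart D z i → IsDivisorChart D z' i' → Q t₀ ∈ z.source → Q t₀ ∈ z'.source →
      ∃ q : (Fin n → ℂ) → ℂ, ContDiffAt ℝ ∞ q (z (Q t₀)) ∧
        ∀ᶠ t in 𝓝 t₀, z' (Q t) i' = z (Q t) i * q (z (Q t)) := by
    intro z z' i i' hz hz' hzs hzs'
    have ht := z.map_source hzs
    have hlt : z.symm (z (Q t₀)) ∈ z'.source := by rwa [z.left_inv hzs]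
    have ha : ContDiffAt ℂ ω (fun s => z' (z.symm s) i') (z (Q t₀)) :=
      contDiffAt_pi.1 (IsHolChart.transition hz'.1 hz.1 ht hlt) i'
    obtain ⟨q, hq, hqe⟩ := exists_smooth_quotient i ((hz.2 _ hzs).1 hD) ha (by
      filter_upwards [(z.continuousAt_symm ht) (z'.open_source.mem_nhds hlt),
        z.open_target.mem_nhds ht] with s hs hst hsi
      refine (hz'.2 _ hs).1 ((hz.2 _ (z.map_target hst)).2 ?_)
      rwa [z.right_inv hst])
    refine ⟨q, hq, ?_⟩
    have hc : ContinuousAt (fun t => z (Q t)) t₀ := (z.continuousAt hzs).comp hQ.continuousAt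
    filter_upwards [hc hqe, hQ.continuousAt (z.open_source.mem_nhds hzs)] with t h1 h2
    have h5 : z' (z.symm (z (Q t))) i' = z (Q t) i * q (z (Q t)) := h1
    rwa [z.left_inv h2] at h5
  obtain ⟨q, hq, hqe⟩ := hquot hz hz₂ hzs hp₂
  obtain ⟨q', hq', hqe'⟩ := hquot hz₂ hz hp₂ hzs
  have hqt : ContDiffAt ℝ ∞ (fun t => q (z (Q t))) t₀ := hq.comp t₀ hzQr
  have hqt' : ContDiffAt ℝ ∞ (fun t => q' (z₂ (Q t))) t₀ := hq'.comp t₀ hz₂Qr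
  have hq0 : q (z (Q t₀)) ≠ 0 := by
    have : q (z (Q t₀)) * q' (z₂ (Q t₀)) = 1 := by
      refine eq_of_frequently (f := fun t => q (z (Q t)) * q' (z₂ (Q t))) (t := t₀)
        (hqt.continuousAt.mul hqt'.continuousAt) ?_
      refine (hdense.and_eventually (hqe.and (hqe'.and hwN))).mono ?_
      rintro t ⟨h1, h2, h3, h4⟩
      have h5 : z (Q t) i ≠ 0 := by rw [h4]; exact pow_ne_zero _ h1
      rw [h2, mul_assoc] at h3
      exact (mul_right_eq_self₀.1 h3.symm).resolve_right h5
    exact left_ne_zero_of_mul (this.trans_ne one_ne_zero)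
  obtain ⟨ρ, hρ, hρN, hρ0⟩ := exists_smooth_root hqt hq0 hN₂0
  set τ : (Fin n → ℂ) → Fin n → ℂ := fun t => Function.update (z₂ (Q t)) i₂ (ρ t * w t ^ m) with hτ
  have hτs : ContDiffAt ℝ ∞ τ t₀ := by
    rw [contDiffAt_pi]
    intro j
    by_cases hj : j = i₂
    · subst hj
      simp only [hτ, Function.update_self]
      exact hρ.mul (hwr.pow m)
    · simp only [hτ, Function.update_of_ne hj]
      exact contDiffAt_pi.1 hz₂Qr j
  have hτi : ∀ t, τ t i₂ = ρ t * w t ^ m := fun t => by simp [hτ]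
  have hPτ : ∀ᶠ t in 𝓝 t₀, powerMap i₂ N₂ (τ t) = z₂ (Q t) := by
    filter_upwards [hρN, hqe, hwN] with t h1 h2 h3
    funext j
    by_cases hj : j = i₂
    · subst hj
      rw [powerMap_self, hτi, mul_pow, h1, h2, h3, ← pow_mul, mul_comm N₂ m, mul_comm]
    · rw [powerMap_of_ne hj]
      simp [hτ, hj]
  -- the transition between the two adapted frames
  obtain ⟨g, g', hgg, hgs⟩ := he.2.1.exists_transition he.1 hf.2.1 hf.1
  have hκN : ∀ b, κ b ≤ N₂ * m := fun b => by
    have h1 : (κ b : ℚ) ≤ ((N₂ * m : ℕ) : ℚ) := by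
      rw [hκ b]
      exact mul_le_of_le_one_right (by positivity) (he.2.2.2.1 b).2.le
    exact_mod_cast h1
  have hκlt : ∀ {c b}, κ c < κ b → α c < α b := fun {c b} h => by
    have h1 : (κ c : ℚ) < κ b := by exact_mod_cast h
    rw [hκ c, hκ b] at h1
    exact lt_of_mul_lt_mul_left h1 (by positivity)
  have hUU : ∀ᶠ x in 𝓝 (Q t₀), x ∈ U ∩ z₂.source :=
    (he.1.inter hf.1).mem_nhds ⟨hU, hp₂⟩
  have hA : ∀ c b, ∃ A : (Fin n → ℂ) → ℂ, ContDiffAt ℝ ∞ A t₀ ∧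
      ∀ᶠ t in 𝓝 t₀, w t ^ κ c * g' (Q t) c b = A t * w t ^ κ b := fun c b =>
    exists_smooth_factor hQ hD hz hzs hw hwN (hgs _ ⟨hU, hp₂⟩ c b).2 fun h => ⟨hκN b, by
      filter_upwards [hUU] with x hx hxD
      exact adapted_transition_eq_zero hf he hxD hx.2 hx.1 (hgg x hx).2.1 (hκlt h)⟩
  have hA' : ∀ c b, ∃ A : (Fin n → ℂ) → ℂ, ContDiffAt ℝ ∞ A t₀ ∧
      ∀ᶠ t in 𝓝 t₀, w t ^ κ c * g (Q t) c b = A t * w t ^ κ b := fun c b =>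
    exists_smooth_factor hQ hD hz hzs hw hwN (hgs _ ⟨hU, hp₂⟩ c b).1 fun h => ⟨hκN b, by
      filter_upwards [hUU] with x hx hxD
      exact adapted_transition_eq_zero he hf hxD hx.1 hx.2 (hgg x hx).1 (hκlt h)⟩
  choose A hAs hAe using hA
  choose A' hAs' hAe' using hA'
  set W : (Fin n → ℂ) → Matrix (Fin r) (Fin r) ℂ := fun t => Matrix.diagonal fun a => w t ^ κ a
  set R : (Fin n → ℂ) → Matrix (Fin r) (Fin r) ℂ := fun t => Matrix.diagonal fun a => ρ t ^ κ₂ a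
  set Am : (Fin n → ℂ) → Matrix (Fin r) (Fin r) ℂ := fun t => Matrix.of fun c b => A c b t
  set Am' : (Fin n → ℂ) → Matrix (Fin r) (Fin r) ℂ := fun t => Matrix.of fun c b => A' c b t
  have hAW : ∀ᶠ t in 𝓝 t₀, W t * g' (Q t) = Am t * W t := by
    filter_upwards [Filter.eventually_all.2 fun c => Filter.eventually_all.2 fun b => hAe c b] with t ht
    ext c b
    simp only [W, Am, Matrix.diagonal_mul, Matrix.mul_diagonal, Matrix.of_apply]
    exact ht c b
  have hAW' : ∀ᶠ t in 𝓝 t₀, W t * g (Q t) = Am' t * W t := by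
    filter_upwards [Filter.eventually_all.2 fun c => Filter.eventually_all.2 fun b => hAe' c b] with t ht
    ext c b
    simp only [W, Am', Matrix.diagonal_mul, Matrix.mul_diagonal, Matrix.of_apply]
    exact ht c b
  have hQnear : ∀ᶠ t in 𝓝 t₀, Q t ∈ U ∩ z₂.source := hQ.continuousAt hUU
  have hAA : Am t₀ * Am' t₀ = 1 := by
    ext c b
    have hcont : ContinuousAt (fun t => (Am t * Am' t) c b) t₀ := by
      simp only [Matrix.mul_apply, Am, Am', Matrix.of_apply]
      exact tendsto_finsetSum _ fun d _ =>
        (hAs c d).continuousAt.mul (hAs' d b).continuousAt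
    refine eq_of_frequently (f := fun t => (Am t * Am' t) c b) (t := t₀) hcont ?_
    refine (hdense.and_eventually (hAW.and (hAW'.and hQnear))).mono ?_
    rintro t ⟨h1, h2, h3, h4⟩
    have h5 : Am t * Am' t * W t = W t := by
      rw [Matrix.mul_assoc, ← h3, ← Matrix.mul_assoc, ← h2, Matrix.mul_assoc, (hgg _ h4).2.2.2,
        Matrix.mul_one]
    have h6 := congrFun (congrFun h5 c) b
    simp only [W, Matrix.mul_diagonal, Matrix.diagonal_apply] at h6
    rw [Matrix.one_apply]
    have h7 : w t ^ κ b ≠ 0 := pow_ne_zero _ h1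
    split_ifs with hcb
    · subst hcb
      rw [if_pos rfl] at h6
      exact mul_eq_right₀ h7 |>.1 h6
    · rw [if_neg hcb] at h6
      exact (mul_eq_zero.1 h6).resolve_right h7
  set B : (Fin n → ℂ) → Matrix (Fin r) (Fin r) ℂ := fun t => R t * Am t with hB
  have hBs : ∀ a b, ContDiffAt ℝ ∞ (fun t => B t a b) t₀ := fun a b => by
    simp only [hB, R, Am, Matrix.diagonal_mul, Matrix.of_apply]
    exact (hρ.pow _).mul (hAs a b)
  have hτt : ∀ᶠ t in 𝓝 t₀, τ t ∈ powerMap i₂ N₂ ⁻¹' z₂.target := by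
    filter_upwards [hPτ, hQnear] with t h1 h2
    rw [Set.mem_preimage, h1]
    exact z₂.map_source h2.2
  have hBu : ∀ᶠ t in 𝓝 t₀, IsUnit (B t) := by
    have h0 : IsUnit (B t₀) := by
      refine IsUnit.mul ?_ (IsUnit.of_mul_eq_one _ hAA)
      rw [Matrix.isUnit_iff_isUnit_det, Matrix.det_diagonal, isUnit_iff_ne_zero]
      exact Finset.prod_ne_zero_iff.2 fun a _ => pow_ne_zero _ (hρ0 t₀)
    have hc : ContinuousAt B t₀ :=
      continuousAt_pi.2 fun a => continuousAt_pi.2 fun b => (hBs a b).continuousAt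
    exact eventually_isUnit_matrix hc h0
  refine ⟨fun t => (B t)ᴴ * G (τ t) * B t, fun a b => ?_, ?_⟩
  · have hGt : ∀ c d, ContDiffAt ℝ ∞ (fun t => G (τ t) c d) t₀ := fun c d => by
      refine ContDiffAt.comp t₀ ((hGs c d).contDiffAt ?_) hτs
      exact (z₂.open_target.preimage (contDiff_powerMap i₂ N₂).continuous).mem_nhds hτt.self_of_nhds
    have hstar : ∀ c d, ContDiffAt ℝ ∞ (fun t => star (B t c d)) t₀ := fun c d =>
      (Complex.conjCLE.contDiff.contDiffAt.comp t₀ (hBs c d))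
    simp only [Matrix.mul_apply, Matrix.conjTranspose_apply]
    exact ContDiffAt.sum fun d _ => (ContDiffAt.sum fun c _ => (hstar c a).mul (hGt c d)).mul (hBs d b)
  · filter_upwards [hBu, hτt, hPτ, hQnear, hAW] with t h1 h2 h3 h4 h5
    obtain ⟨hpos, hval⟩ := hG _ h2
    refine ⟨hpos.conjTranspose_mul_mul_same (Matrix.mulVec_injective_of_isUnit h1), fun hwt => ?_⟩
    have hτ0 : τ t i₂ ≠ 0 := by
      rw [hτi]
      exact mul_ne_zero (hρ0 t) (pow_ne_zero _ hwt)
    have hval' := hval hτ0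
    rw [h3, z₂.left_inv h4.2] at hval'
    have hgf : gramOf E H f (Q t) = (Matrix.diagonal fun a => τ t i₂ ^ κ₂ a)ᴴ * G (τ t) *
        Matrix.diagonal fun a => τ t i₂ ^ κ₂ a := eq_diagonal_conj_iff.2 hval'
    have hT : (Matrix.diagonal fun a => τ t i₂ ^ κ₂ a) = R t * W t := by
      simp only [R, W, Matrix.diagonal_mul_diagonal]
      congr 1
      funext a
      rw [hτi, mul_pow, hκκ, pow_mul]
    have hTg : (R t * W t) * g' (Q t) = B t * W t := by
      rw [Matrix.mul_assoc, h5, ← Matrix.mul_assoc]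
    rw [gramOf_transition H (hgg _ h4).2.1, hgf, hT]
    calc (g' (Q t))ᴴ * ((R t * W t)ᴴ * G (τ t) * (R t * W t)) * g' (Q t)
        = ((R t * W t) * g' (Q t))ᴴ * G (τ t) * ((R t * W t) * g' (Q t)) := by
          rw [Matrix.conjTranspose_mul (R t * W t)]
          simp only [Matrix.mul_assoc]
      _ = _ := by
          rw [hTg, Matrix.conjTranspose_mul]
          simp only [W, Matrix.mul_assoc]

end Comparison

/-! ## Branched charts adapted to admissible metrics -/

section OrbCharts

open scoped Matrix ComplexOrder
open MeasureTheory

variable {n r : ℕ} {X : Type u} [TopologicalSpace X] [ChartedSpace (Fin n → ℂ) X]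
  {E : HolBundle.{u, w} n r X} {D : Set X}

/-- Local smooth extensions from a dense set patch together. -/
lemma exists_smooth_patch {W : Type*} [NormedAddCommGroup W] [NormedSpace ℝ W] {O S : Set W}
    (hO : IsOpen O) (hS : ∀ t ∈ O, ∃ᶠ x in 𝓝 t, x ∈ S) {G : W → Matrix (Fin r) (Fin r) ℂ}
    {p : Matrix (Fin r) (Fin r) ℂ → Prop}
    (h : ∀ t ∈ O, ∃ M : W → Matrix (Fin r) (Fin r) ℂ, (∀ a b, ContDiffAt ℝ ∞ (fun t => M t a b) t) ∧
      p (M t) ∧ ∀ᶠ x in 𝓝 t, x ∈ S → M x = G x) :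
    ∃ G' : W → Matrix (Fin r) (Fin r) ℂ, ∀ t ∈ O, (∀ a b, ContDiffAt ℝ ∞ (fun t => G' t a b) t) ∧
      p (G' t) ∧ (t ∈ S → G' t = G t) := by
  choose! M hM using h
  refine ⟨fun t => M t t, fun t ht => ⟨fun a b => ?_, (hM t ht).2.1,
    fun hs => (hM t ht).2.2.self_of_nhds hs⟩⟩
  refine ((hM t ht).1 a b).congr_of_eventuallyEq ?_
  have hc : ∀ᶠ x in 𝓝 t, ContDiffAt ℝ 1 (fun t' => M t t' a b) x :=
    (((hM t ht).1 a b).of_le (m := 1) (by simp)).eventually (by simp)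
  filter_upwards [hO.mem_nhds ht, eventually_eventually_nhds.2 (hM t ht).2.2, hc] with x hx h1 h2
  have h3 : ContinuousAt (fun t' => M x t' a b) x := ((hM x hx).1 a b).continuousAt
  refine tendsto_nhds_unique_of_frequently_eq h3 h2.continuousAt ?_
  refine ((hS x hx).and_eventually (h1.and (hM x hx).2.2)).mono ?_
  rintro y ⟨hy, h5, h6⟩
  rw [h5 hy, h6 hy]

lemma frequently_coordinate_ne (i : Fin n) (t : Fin n → ℂ) : ∃ᶠ s in 𝓝 t, s i ≠ 0 := by
  intro h
  have h1 : {s : Fin n → ℂ | s i = 0} ∈ 𝓝 t := by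
    filter_upwards [h] with s hs
    exact not_not.1 hs
  exact (Measure.measure_pos_of_mem_nhds volume h1).ne' (volume_coordinate_hyperplane i)

/-- `h` is the Gram matrix of a smooth extension of `H` to a branched chart, in the frame that is
`e * g` away from `D`. -/
def IsOrbGram (E : HolBundle.{u, w} n r X) (D : Set X) (z : OpenPartialHomeomorph X (Fin n → ℂ))
    (P : (Fin n → ℂ) → Fin n → ℂ) (e : Fin r → ∀ x, E.Fib x)
    (g : (Fin n → ℂ) → Matrix (Fin r) (Fin r) ℂ) (H : E.Sesq)
    (h : (Fin n → ℂ) → Matrix (Fin r) (Fin r) ℂ) : Prop :=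
  ∀ t, P t ∈ z.target → IsGramAt h t ∧ (z.symm (P t) ∉ D →
    ∀ᶠ x in 𝓝 t, h x = (g x)ᴴ * gramOf E H e (z.symm (P x)) * g x)

variable [IsManifold 𝓘(ℂ, Fin n → ℂ) ω X]

lemma exists_orbGram_of_notMem (hDc : IsClosed D) {p : X} (hp : p ∉ D) :
    ∃ (z : OpenPartialHomeomorph X (Fin n → ℂ)) (P : (Fin n → ℂ) → Fin n → ℂ) (N : ℕ)
      (e : Fin r → ∀ x, E.Fib x) (g : (Fin n → ℂ) → Matrix (Fin r) (Fin r) ℂ),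
      p ∈ z.source ∧ IsOrbChart D z P N ∧
      (∀ t, P t ∈ z.target → z.symm (P t) ∉ D →
        IsPullbackFrame E (fun t => z.symm (P t)) e g t) ∧
      ∀ H, E.IsHermitianMetricOn H Dᶜ → ∃ h, IsOrbGram E D z P e g H h := by
  set B := (trivializationAt (Fin r → ℂ) E.Fib p).baseSet with hB
  have hBo : IsOpen B := (trivializationAt (Fin r → ℂ) E.Fib p).open_baseSet
  have hpB : p ∈ B := FiberBundle.mem_baseSet_trivializationAt' p
  have hV : IsOpen (B ∩ Dᶜ) := hBo.inter hDc.isOpen_compl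
  set z := (chartAt (Fin n → ℂ) p).restr (B ∩ Dᶜ) with hz
  have hsrc : z.source = (chartAt (Fin n → ℂ) p).source ∩ (B ∩ Dᶜ) := by
    rw [hz, OpenPartialHomeomorph.restr_source, hV.interior_eq]
  have hzh : IsHolChart z := by
    exact restr_mem_maximalAtlas _ (isHolChart_of_mem_atlas (chart_mem_atlas _ p)) hV
  have hmem : ∀ t ∈ z.target, z.symm t ∈ B ∩ Dᶜ := fun t ht => by
    have := z.map_target ht
    rw [hsrc] at this
    exact this.2
  have hnull : {t | t ∈ z.target ∧ z.symm t ∈ D} = ∅ := by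
    ext t
    simp only [Set.mem_ofPred_eq, Set.mem_empty_iff_false, iff_false, not_and]
    exact fun ht hD => (hmem t ht).2 hD
  refine ⟨z, id, 1, prefFrame E p, fun _ => 1, ?_, ⟨hzh, isBranchedCover_id, ?_⟩, ?_, ?_⟩
  · rw [hsrc]
    exact ⟨mem_chart_source _ p, hpB, hp⟩
  · simp only [id_eq]
    rw [hnull, measure_empty]
  · intro t ht _
    exact ⟨hzh.contMDiffAt_symm ht, ⟨B, hBo, (hmem t ht).1, isHolFrame_prefFrame E p⟩,
      fun i j => contDiffAt_const, isUnit_one⟩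
  · intro H hH
    refine ⟨fun t => gramOf E H (prefFrame E p) (z.symm t), fun t ht => ⟨?_, fun _ => ?_⟩⟩
    · exact isGramAt_comp hDc.isOpen_compl hH hBo (isHolFrame_prefFrame E p)
        (contMDiffAt_real (hzh.contMDiffAt_symm ht)) (hmem t ht).1 (hmem t ht).2
    · exact Filter.Eventually.of_forall fun x => by simp

lemma exists_orbGram_of_mem (hDc : IsClosed D) {P : ParabolicStructure E D} {H₀ : E.Sesq}
    (hH₀ : IsAdmissible P H₀) {p : X} (hp : p ∈ D) :
    ∃ (z : OpenPartialHomeomorph X (Fin n → ℂ)) (Q : (Fin n → ℂ) → Fin n → ℂ) (N : ℕ)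
      (e : Fin r → ∀ x, E.Fib x) (g : (Fin n → ℂ) → Matrix (Fin r) (Fin r) ℂ),
      p ∈ z.source ∧ IsOrbChart D z Q N ∧
      (∀ t, Q t ∈ z.target → z.symm (Q t) ∉ D →
        IsPullbackFrame E (fun t => z.symm (Q t)) e g t) ∧
      ∀ H, IsAdmissible P H → ∃ h, IsOrbGram E D z Q e g H h := by
  obtain ⟨z, i, e, α, N, κ, -, hp, hz, he, hN, hκ, -, -⟩ := hH₀.2 p hp
  have hN0 : 0 < N := by
    rw [hN, Nat.pos_iff_ne_zero, Ne, Finset.lcm_eq_zero_iff]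
    rintro ⟨j, -, hj⟩
    exact (α j).den_ne_zero hj
  have hPc : ContDiff ℂ ω (powerMap i N) := contDiff_powerMap i N
  have hO : IsOpen (powerMap i N ⁻¹' z.target) := z.open_target.preimage hPc.continuous
  have hDi : ∀ t ∈ z.target, (z.symm t ∈ D ↔ t i = 0) := fun t ht => by
    rw [hz.2 _ (z.map_target ht), z.right_inv ht]
  have hDi' : ∀ t, powerMap i N t ∈ z.target → (z.symm (powerMap i N t) ∈ D ↔ t i = 0) :=
    fun t ht => by rw [hDi _ ht, powerMap_self, pow_eq_zero_iff hN0.ne']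
  have hQ : ∀ t, powerMap i N t ∈ z.target →
      ContMDiffAt 𝓘(ℂ, Fin n → ℂ) 𝓘(ℂ, Fin n → ℂ) ω (fun t => z.symm (powerMap i N t)) t :=
    fun t ht => (IsHolChart.contMDiffAt_symm hz.1 ht).comp t hPc.contDiffAt.contMDiffAt
  set g : (Fin n → ℂ) → Matrix (Fin r) (Fin r) ℂ :=
    fun t => Matrix.diagonal fun a => (t i ^ κ a)⁻¹ with hg
  have hgs : ∀ t : Fin n → ℂ, t i ≠ 0 → ∀ a b, ContDiffAt ℂ ω (fun x => g x a b) t := by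
    intro t ht a b
    simp only [hg, Matrix.diagonal_apply]
    split_ifs
    · exact ((contDiff_apply ℂ ℂ i).contDiffAt.pow _).inv (pow_ne_zero _ ht)
    · exact contDiffAt_const
  have hgW : ∀ t : Fin n → ℂ, t i ≠ 0 → (Matrix.diagonal fun a => t i ^ κ a) * g t = 1 := by
    intro t ht
    rw [hg, Matrix.diagonal_mul_diagonal, ← Matrix.diagonal_one]
    congr 1
    funext a
    exact mul_inv_cancel₀ (pow_ne_zero _ ht)
  have hgu : ∀ t : Fin n → ℂ, t i ≠ 0 → IsUnit (g t) := fun t ht =>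
    IsUnit.of_mul_eq_one _ (mul_eq_one_comm.1 (hgW t ht))
  refine ⟨z, powerMap i N, N, e, g, hp, ⟨hz.1, isBranchedCover_powerMap i hN0, ?_⟩, ?_, ?_⟩
  · refine measure_mono_null ?_ (volume_coordinate_hyperplane i)
    exact fun t ht => (hDi' t ht.1).1 ht.2
  · intro t ht htD
    rw [hDi' t ht] at htD
    exact ⟨hQ t ht, ⟨z.source, he.1, z.map_target ht, he.2.1⟩, hgs t htD, hgu t htD⟩
  · intro H hH
    obtain ⟨G', hG'⟩ := exists_smooth_patch (S := {t : Fin n → ℂ | t i ≠ 0}) hO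
      (fun t _ => frequently_coordinate_ne i t)
      (G := fun t => (g t)ᴴ * gramOf E H e (z.symm (powerMap i N t)) * g t)
      (p := fun A => IsUnit A) (by
        intro t ht
        by_cases hti : t i = 0
        · obtain ⟨M, hMs, hM⟩ := hH.exists_extension (hQ t ht) ((hDi' t ht).2 hti) he
            (z.map_target ht) hz (z.map_target ht) (w := fun t => t i)
            (contDiff_apply ℂ ℂ i).contDiffAt hN0 (by
              filter_upwards [hO.mem_nhds ht] with x hx
              rw [z.right_inv hx, powerMap_self]) hκ (frequently_coordinate_ne i t)
          refine ⟨M, hMs, hM.self_of_nhds.1.isUnit, ?_⟩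
          filter_upwards [hM] with x hx hxi
          have h1 := hgW x hxi
          rw [hx.2 hxi]
          calc M x = (1 : Matrix (Fin r) (Fin r) ℂ)ᴴ * M x * 1 := by simp
            _ = _ := by
              rw [← h1, Matrix.conjTranspose_mul]
              simp only [Matrix.mul_assoc]
        · have htD : z.symm (powerMap i N t) ∈ Dᶜ := fun h => hti ((hDi' t ht).1 h)
          have h1 := isGramAt_comp hDc.isOpen_compl hH.1 he.1 he.2.1 (contMDiffAt_real (hQ t ht))
            (z.map_target ht) htD
          have h2 : ∀ a b, ContDiffAt ℝ ∞ (fun x => g x a b) t := fun a b =>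
            smooth_of_holomorphic (hgs t hti a b)
          refine ⟨_, fun a b => ?_, ?_, Filter.Eventually.of_forall fun x _ => rfl⟩
          · have h3 : ∀ c d, ContDiffAt ℝ ∞ (fun t => star (g t c d)) t := fun c d =>
              (Complex.conjCLE.contDiff.contDiffAt.comp t (h2 c d))
            simp only [Matrix.mul_apply, Matrix.conjTranspose_apply]
            exact ContDiffAt.sum fun d _ => (ContDiffAt.sum fun c _ =>
              (h3 c a).mul (h1.smooth c d)).mul (h2 d b)
          · exact (((Matrix.isUnit_conjTranspose (A := g t)).2 (hgu t hti)).mul h1.isUnit).mul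
              (hgu t hti))
    refine ⟨G', fun t ht => ⟨⟨(hG' t ht).1, (hG' t ht).2.1⟩, fun htD => ?_⟩⟩
    rw [hDi' t ht] at htD
    have hne : ∀ᶠ x : Fin n → ℂ in 𝓝 t, x i ≠ 0 :=
      (continuous_apply i).continuousAt.eventually_ne htD
    filter_upwards [hO.mem_nhds ht, hne] with x hx hxi using (hG' x hx).2.2 hxi

/-- Near every point there is a branched chart on which all admissible metrics extend. -/
lemma exists_orbGram (hDc : IsClosed D) {P : ParabolicStructure E D} {H₁ H₂ : E.Sesq}
    (hH₁ : IsAdmissible P H₁) (hH₂ : IsAdmissible P H₂) (p : X) :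
    ∃ (z : OpenPartialHomeomorph X (Fin n → ℂ)) (Q : (Fin n → ℂ) → Fin n → ℂ) (N : ℕ)
      (e : Fin r → ∀ x, E.Fib x) (g h₁ h₂ : (Fin n → ℂ) → Matrix (Fin r) (Fin r) ℂ),
      p ∈ z.source ∧ IsOrbChart D z Q N ∧
      (∀ t, Q t ∈ z.target → z.symm (Q t) ∉ D →
        IsPullbackFrame E (fun t => z.symm (Q t)) e g t) ∧
      IsOrbGram E D z Q e g H₁ h₁ ∧ IsOrbGram E D z Q e g H₂ h₂ := by
  by_cases hp : p ∈ D
  · obtain ⟨z, Q, N, e, g, h1, h2, h3, h4⟩ := exists_orbGram_of_mem hDc hH₁ hp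
    obtain ⟨a, ha⟩ := h4 _ hH₁
    obtain ⟨b, hb⟩ := h4 _ hH₂
    exact ⟨z, Q, N, e, g, a, b, h1, h2, h3, ha, hb⟩
  · obtain ⟨z, Q, N, e, g, h1, h2, h3, h4⟩ := exists_orbGram_of_notMem (E := E) hDc hp
    obtain ⟨a, ha⟩ := h4 _ hH₁.1
    obtain ⟨b, hb⟩ := h4 _ hH₂.1
    exact ⟨z, Q, N, e, g, a, b, h1, h2, h3, ha, hb⟩

section Ext

variable {z : OpenPartialHomeomorph X (Fin n → ℂ)} {Q : (Fin n → ℂ) → Fin n → ℂ} {N : ℕ}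
  {e : Fin r → ∀ x, E.Fib x} {g h h₁ h₂ : (Fin n → ℂ) → Matrix (Fin r) (Fin r) ℂ}
  {H H₁ H₂ : E.Sesq} {Φ : MvPolynomial (Fin r × Fin r) ℂ}

lemma IsOrbGram.isOrbExt_chernWeilForm (hDc : IsClosed D) (hH : E.IsHermitianMetricOn H Dᶜ)
    (hΦ : IsInvariantPolynomial Φ) (k : ℕ)
    (hf : ∀ t, Q t ∈ z.target → z.symm (Q t) ∉ D → IsPullbackFrame E (fun t => z.symm (Q t)) e g t)
    (hh : IsOrbGram E D z Q e g H h) : IsOrbExt D z Q (chernWeilForm E H Φ k) (gramForm Φ k h) :=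
  ⟨fun t ht => (contDiffAt_gramForm Φ k (hh t ht).1).contDiffWithinAt, fun t ht htD =>
    pb_chernWeilForm hΦ k hDc.isOpen_compl hH (hf t ht htD) htD ((hh t ht).2 htD)⟩

lemma IsOrbGram.isOrbExt_transgressionForm (hDc : IsClosed D) (hz : IsOrbChart D z Q N)
    (hH₁ : E.IsHermitianMetricOn H₁ Dᶜ) (hH₂ : E.IsHermitianMetricOn H₂ Dᶜ)
    (hΦ : IsInvariantPolynomial Φ) (k : ℕ)
    (hf : ∀ t, Q t ∈ z.target → z.symm (Q t) ∉ D → IsPullbackFrame E (fun t => z.symm (Q t)) e g t)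
    (hh₁ : IsOrbGram E D z Q e g H₁ h₁) (hh₂ : IsOrbGram E D z Q e g H₂ h₂) :
    IsOrbExt D z Q (transgressionForm E H₁ H₂ Φ k) (gramTransgression Φ k h₁ h₂) :=
  ⟨contDiffOn_gramTransgression Φ k hz.isOpen (fun t ht => (hh₁ t ht).1) (fun t ht => (hh₂ t ht).1),
    fun t ht htD => pb_transgressionForm hΦ k hDc.isOpen_compl hH₁ hH₂ (hf t ht htD) htD
      ((hh₁ t ht).2 htD) ((hh₂ t ht).2 htD)⟩

end Ext

lemma IsOrbExt.congr {z : OpenPartialHomeomorph X (Fin n → ℂ)} {Q : (Fin n → ℂ) → Fin n → ℂ} {m : ℕ}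
    {η η' : DForm n m X} {g : (Fin n → ℂ) → (Fin n → ℂ) [⋀^Fin m]→L[ℝ] ℂ} (h : IsOrbExt D z Q η g)
    (h' : ∀ x, x ∉ D → η' x = η x) : IsOrbExt D z Q η' g :=
  ⟨h.1, fun t ht htD => by rw [← h.2 t ht htD, pb, pb, h' _ htD]⟩

end OrbCharts

/-! ## Lifting admissible metrics to Kawamata covers -/

section Sesquilinear

open scoped Matrix ComplexOrder

variable {r : ℕ} {V : Type*} [AddCommGroup V] [Module ℂ V]

lemma exists_sesq (b : Module.Basis (Fin r) ℂ V) (A : Matrix (Fin r) (Fin r) ℂ) :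
    ∃ B : V →ₗ⋆[ℂ] V →ₗ[ℂ] ℂ, ∀ i j, B (b i) (b j) = A i j := by
  refine ⟨LinearMap.mk₂'ₛₗ (starRingEnd ℂ) (RingHom.id ℂ)
    (fun s t => ∑ i, ∑ j, star (b.repr s i) * A i j * b.repr t j) ?_ ?_ ?_ ?_, fun i j => ?_⟩
  · intro s s' t
    simp only [map_add, Finsupp.add_apply, star_add, add_mul, Finset.sum_add_distrib]
  · intro c s t
    simp only [map_smul, Finsupp.smul_apply, smul_eq_mul, star_mul', Finset.mul_sum, mul_assoc]
    rfl
  · intro s t t'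
    simp only [map_add, Finsupp.add_apply, mul_add, Finset.sum_add_distrib]
  · intro c s t
    simp only [map_smul, Finsupp.smul_apply, smul_eq_mul, Finset.mul_sum, RingHom.id_apply]
    refine Finset.sum_congr rfl fun i _ => Finset.sum_congr rfl fun j _ => ?_
    ring
  · rw [LinearMap.mk₂'ₛₗ_apply]
    simp only [Module.Basis.repr_self, Finsupp.single_apply]
    rw [Finset.sum_eq_single i, Finset.sum_eq_single j]
    · simp
    · intro k _ hk
      simp [hk.symm]
    · simp
    · intro k _ hk
      simp [hk.symm]
    · simp

lemma sesq_apply_eq (b : Module.Basis (Fin r) ℂ V) (B : V →ₗ⋆[ℂ] V →ₗ[ℂ] ℂ) (s t : V) :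
    B s t = star (b.repr s : Fin r → ℂ) ⬝ᵥ (Matrix.of fun i j => B (b i) (b j)) *ᵥ b.repr t := by
  conv_lhs => rw [← b.sum_repr s, ← b.sum_repr t]
  simp only [dotProduct, Matrix.mulVec, Matrix.of_apply, map_sum, LinearMap.map_smulₛₗ,
    LinearMap.sum_apply, LinearMap.smul_apply, RingHom.id_apply, smul_eq_mul, Finset.mul_sum,
    Pi.star_apply]
  rw [Finset.sum_comm]
  refine Finset.sum_congr rfl fun a _ => Finset.sum_congr rfl fun c _ => ?_
  rw [starRingEnd_apply]
  ring

lemma sesq_hermitian (b : Module.Basis (Fin r) ℂ V) (B : V →ₗ⋆[ℂ] V →ₗ[ℂ] ℂ)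
    (h : (Matrix.of fun i j => B (b i) (b j)).IsHermitian) (s t : V) : B s t = star (B t s) := by
  rw [sesq_apply_eq b B s t, sesq_apply_eq b B t s, Matrix.star_dotProduct,
    Matrix.star_mulVec, h.eq, Matrix.dotProduct_mulVec]

lemma sesq_pos (b : Module.Basis (Fin r) ℂ V) (B : V →ₗ⋆[ℂ] V →ₗ[ℂ] ℂ)
    (h : (Matrix.of fun i j => B (b i) (b j)).PosDef) {s : V} (hs : s ≠ 0) : 0 < (B s s).re := by
  rw [sesq_apply_eq b B s s]
  refine (Complex.lt_def.1 (h.dotProduct_mulVec_pos ?_)).1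
  intro h0
  apply hs
  rw [← b.sum_repr s]
  simp [h0]

end Sesquilinear

section Lift

open scoped Matrix ComplexOrder

variable {n r : ℕ} {X : Type u} [TopologicalSpace X] [ChartedSpace (Fin n → ℂ) X]
  {E : HolBundle.{u, w} n r X} {D : Set X} {P : ParabolicStructure E D}

lemma contMDiffAt_complex_mul {f g : X → ℂ} {x : X}
    (hf : ContMDiffAt 𝓘(ℝ, Fin n → ℂ) 𝓘(ℝ, ℂ) ∞ f x)
    (hg : ContMDiffAt 𝓘(ℝ, Fin n → ℂ) 𝓘(ℝ, ℂ) ∞ g x) :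
    ContMDiffAt 𝓘(ℝ, Fin n → ℂ) 𝓘(ℝ, ℂ) ∞ (fun x => f x * g x) x :=
  (contDiff_mul (𝕜 := ℝ) (𝔸 := ℂ)).contMDiff.contMDiffAt.comp x (hf.prodMk_space hg)

/-- The metric on `V` that corresponds to `H` under `θ`. -/
def KawamataCover.push (c : KawamataCover.{u, v, w} P) (H : E.Sesq) : c.V.Sesq := fun y =>
  ((H (c.q y)).comp (c.θ y).symm.toLinearMap).compl₂ (c.θ y).symm.toLinearMap

lemma KawamataCover.push_apply (c : KawamataCover.{u, v, w} P) (H : E.Sesq) (y : c.Y) (s t) :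
    c.push H y s t = H (c.q y) ((c.θ y).symm s) ((c.θ y).symm t) := rfl

lemma KawamataCover.gramOf_push (c : KawamataCover.{u, v, w} P) (H : E.Sesq)
    (e : Fin r → ∀ x, E.Fib x) (y : c.Y) :
    gramOf c.V (c.push H) (fun j y => c.θ y (e j (c.q y))) y = gramOf E H e (c.q y) := by
  ext a b
  rw [gramOf_apply, gramOf_apply, push_apply, LinearEquiv.symm_apply_apply,
    LinearEquiv.symm_apply_apply]

lemma KawamataCover.isHolFrame_θ (c : KawamataCover.{u, v, w} P) {e : Fin r → ∀ x, E.Fib x}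
    {U : Set X} (hU : IsOpen U) (he : E.IsHolFrame e U) :
    c.V.IsHolFrame (fun j y => c.θ y (e j (c.q y))) (c.q ⁻¹' (U \ D)) where
  linearIndependent {y} hy :=
    (IsLocalFrameOn.linearIndependent he hy.1).map' (c.θ y).toLinearMap (LinearEquiv.ker _)
  generating {y} hy := by
    have h1 := IsLocalFrameOn.generating he hy.1
    have h2 : (Set.range fun j => c.θ y (e j (c.q y))) =
        (c.θ y).toLinearMap '' Set.range fun j => e j (c.q y) := by
      rw [← Set.range_comp]
      rfl
    rw [h2, Submodule.span_image, top_le_iff.1 h1, Submodule.map_top, LinearEquiv.range]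
  contMDiffOn j := c.θ_hol U (e j) hU (IsLocalFrameOn.contMDiffOn he j)

lemma KawamataCover.frequently_ne_zero (c : KawamataCover.{u, v, w} P) {w : c.Y → ℂ} {y : c.Y}
    (h : mfderiv 𝓘(ℂ, Fin n → ℂ) 𝓘(ℂ, ℂ) w y ≠ 0) : ∃ᶠ y' in 𝓝 y, w y' ≠ 0 := by
  intro h0
  have h1 : w =ᶠ[𝓝 y] fun _ => 0 := by
    filter_upwards [h0] with y' hy'
    exact not_not.1 hy'
  apply h
  rw [h1.mfderiv_eq, mfderiv_const]
  rfl

/-- The preimage of `D` is nowhere dense. -/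
lemma KawamataCover.frequently_notMem (c : KawamataCover.{u, v, w} P) (y : c.Y) :
    ∃ᶠ y' in 𝓝 y, c.q y' ∉ D := by
  by_cases hy : c.q y ∈ D
  · obtain ⟨U, e, α, z, i, O, w, e', N, κ, -, -, -, hz, hO, hyO, hOU, -, hdw, hN, hzw, -⟩ :=
      c.direct_image y hy
    refine ((c.frequently_ne_zero hdw).and_eventually (hO.mem_nhds hyO)).mono ?_
    rintro y' ⟨h1, h2⟩ h3
    rw [hz.2 _ (hOU h2).2, hzw _ h2] at h3
    exact pow_ne_zero _ h1 h3
  · exact fun h => h.self_of_nhds hy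

variable [IsManifold 𝓘(ℂ, Fin n → ℂ) ω X]

lemma KawamataCover.exists_local_gram (c : KawamataCover.{u, v, w} P) (hDc : IsClosed D) {H : E.Sesq}
    (hH : IsAdmissible P H) (y : c.Y) :
    ∃ (O : Set c.Y) (f : Fin r → ∀ y, c.V.Fib y) (M : c.Y → Matrix (Fin r) (Fin r) ℂ),
      IsOpen O ∧ y ∈ O ∧ c.V.IsHolFrame f O ∧
      (∀ a b, ContMDiffAt 𝓘(ℝ, Fin n → ℂ) 𝓘(ℝ, ℂ) ∞ (fun y => M y a b) y) ∧ (M y).PosDef ∧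
      ∀ᶠ y' in 𝓝 y, c.q y' ∉ D → gramOf c.V (c.push H) f y' = M y' := by
  have hφ := isHolChart_of_mem_atlas (chart_mem_atlas (Fin n → ℂ) y)
  set φ := chartAt (Fin n → ℂ) y with hφd
  have hys : y ∈ φ.source := mem_chart_source _ y
  by_cases hy : c.q y ∈ D
  · obtain ⟨U, e, α, z, i, O, w, e', N, κ, hyU, he, hyz, hz, hO, hyO, hOU, hw, hdw, hN, hzw, hκ, he',
      hθ⟩ := c.direct_image y hy
    have hsy : φ.symm (φ y) = y := φ.left_inv hys
    have hsymm := hφ.contMDiffAt_symm (φ.map_source hys)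
    have hQ : ContMDiffAt 𝓘(ℂ, Fin n → ℂ) 𝓘(ℂ, Fin n → ℂ) ω (fun t => c.q (φ.symm t)) (φ y) :=
      (c.q_hol _).comp (φ y) hsymm
    have hcs : Filter.Tendsto φ.symm (𝓝 (φ y)) (𝓝 y) := by
      have := hsymm.continuousAt
      rwa [ContinuousAt, hsy] at this
    have hcφ : Filter.Tendsto φ (𝓝 y) (𝓝 (φ y)) := φ.continuousAt hys
    have hws : ContDiffAt ℂ ω (fun t => w (φ.symm t)) (φ y) := by
      refine contMDiffAt_iff_contDiffAt.1 (ContMDiffAt.comp (φ y) ?_ hsymm)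
      rw [hsy]
      exact (hw y hyO).contMDiffAt (hO.mem_nhds hyO)
    obtain ⟨M, hMs, hM⟩ := hH.exists_extension hQ (by rwa [hsy]) he (by rwa [hsy]) hz (by rwa [hsy])
      hws hN (by
        filter_upwards [hcs (hO.mem_nhds hyO)] with t ht using hzw _ ht) hκ (by
        refine hcφ.frequently ((c.frequently_ne_zero hdw).and_eventually
          (φ.open_source.mem_nhds hys) |>.mono ?_)
        rintro y' ⟨h1, h2⟩
        rwa [φ.left_inv h2])
    refine ⟨O, e', fun y => M (φ y), hO, hyO, he', fun a b => ?_, hM.self_of_nhds.1, ?_⟩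
    · exact (hMs a b).contMDiffAt.comp y (contMDiffAt_real (hφ.contMDiffAt hys))
    · filter_upwards [hO.mem_nhds hyO, φ.open_source.mem_nhds hys, hcφ hM] with y' h1 h2 h3 hD
      have hw0 : w y' ≠ 0 := by
        intro h0
        apply hD
        rw [hz.2 _ (hOU h1).2, hzw _ h1, h0, zero_pow hN.ne']
      have h4 := h3.2
      rw [φ.left_inv h2, ← c.gramOf_push H e y'] at h4
      have h5 : gramOf c.V (c.push H) (fun j y => c.θ y (e j (c.q y))) y' =
          (Matrix.diagonal fun a => w y' ^ κ a)ᴴ * gramOf c.V (c.push H) e' y' *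
            Matrix.diagonal fun a => w y' ^ κ a := by
        refine gramOf_transition _ fun b => ?_
        rw [hθ y' h1 hD b]
        simp [Matrix.diagonal_apply, ite_smul]
      ext a b
      have h6 := eq_diagonal_conj_iff.1 (h4 hw0) a b
      rw [eq_diagonal_conj_iff.1 h5 a b] at h6
      exact mul_left_cancel₀ (star_ne_zero.2 (pow_ne_zero _ hw0))
        (mul_right_cancel₀ (pow_ne_zero _ hw0) h6)
  · set T := trivializationAt (Fin r → ℂ) E.Fib (c.q y) with hT
    have hyT : c.q y ∈ T.baseSet := FiberBundle.mem_baseSet_trivializationAt' _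
    have he := isHolFrame_prefFrame E (c.q y)
    refine ⟨c.q ⁻¹' (T.baseSet \ D), _, fun y' => gramOf E H (prefFrame E (c.q y)) (c.q y'),
      (T.open_baseSet.sdiff hDc).preimage c.q_hol.continuous, ⟨hyT, hy⟩,
      c.isHolFrame_θ T.open_baseSet he, fun a b => ?_, posDef_gramOf hH.1 he hyT hy,
      Filter.Eventually.of_forall fun y' _ => c.gramOf_push H _ y'⟩
    exact (contMDiffAt_gramOf hDc.isOpen_compl hH.1 T.open_baseSet he hyT hy a b).comp y
      (contMDiffAt_real (c.q_hol y))

lemma sum_smul_prefFrame {x y : X} (hy : y ∈ (trivializationAt (Fin r → ℂ) E.Fib x).baseSet)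
    (s : E.Fib y) :
    s = ∑ i, (trivializationAt (Fin r → ℂ) E.Fib x ⟨y, s⟩).2 i • prefFrame E x i y := by
  set T := trivializationAt (Fin r → ℂ) E.Fib x
  have h1 := ((T.basisAt (Pi.basisFun ℂ (Fin r)) hy).sum_repr s).symm
  refine h1.trans (Finset.sum_congr rfl fun i _ => ?_)
  rw [prefFrame, T.localFrame_apply_of_mem_baseSet _ hy]
  congr 1

/-- Every admissible metric lifts to a smooth invariant metric on every Kawamata cover. -/
theorem KawamataCover.exists_lift (c : KawamataCover.{u, v, w} P) (hDc : IsClosed D) {H : E.Sesq}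
    (hH : IsAdmissible P H) : ∃ H' : c.V.Sesq, c.IsLift Set.univ H H' := by
  choose O f M hO hyO hf hMs hMp hM using c.exists_local_gram hDc hH
  obtain ⟨β, hβ⟩ : ∃ β : ∀ y, Module.Basis (Fin r) ℂ (c.V.Fib y), ∀ y j, β y j = f y j y :=
    ⟨fun y => IsLocalFrameOn.toBasisAt (hf y) (hyO y), fun y j =>
      IsLocalFrameOn.toBasisAt_coe (hf y) (hyO y) j⟩
  choose H' hH' using fun y => exists_sesq (β y) (M y y)
  have hself : ∀ y, gramOf c.V H' (f y) y = M y y := fun y => by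
    ext a b
    rw [gramOf_apply, ← hH' y a b, hβ, hβ]
  have hpush : ∀ y, c.q y ∉ D → H' y = c.push H y := fun y hy => by
    refine LinearMap.ext_basis (β y)
      (β y) fun a b => ?_
    rw [hH', ← (hM y).self_of_nhds hy, gramOf_apply, hβ, hβ]
  have hnear : ∀ y, ∀ᶠ y' in 𝓝 y, gramOf c.V H' (f y) y' = M y y' := by
    intro y
    have hc : ∀ a b, ∀ᶠ y' in 𝓝 y, ContinuousAt (fun x => M y x a b) y' := fun a b => by
      have : IsManifold 𝓘(ℝ, Fin n → ℂ) 1 c.Y :=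
        have : IsManifold 𝓘(ℝ, Fin n → ℂ) ∞ c.Y := isManifold_real
        IsManifold.of_le (n := ∞) (by simp)
      have h1 := (contMDiffAt_iff_contMDiffAt_nhds (by simp)).1
        ((hMs y a b).of_le (n := ∞) (m := 1) (by simp))
      filter_upwards [h1] with y' h2 using h2.continuousAt
    filter_upwards [(hO y).mem_nhds (hyO y), eventually_eventually_nhds.2 (hM y),
      Filter.eventually_all.2 fun a => Filter.eventually_all.2 fun b => hc a b] with y' h1 h2 h3
    obtain ⟨g, g', hg, hgs⟩ := (hf y').exists_transition (hO y') (hf y) (hO y)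
    have hy' : y' ∈ O y' ∩ O y := ⟨hyO y', h1⟩
    rw [gramOf_transition H' (hg _ hy').1, hself]
    ext a b
    have hcg : ∀ a b, ContinuousAt (fun x => g x a b) y' := fun a b => (hgs _ hy' a b).1.continuousAt
    have hcR : ContinuousAt (fun x => ((g x)ᴴ * M y' x * g x) a b) y' := by
      simp only [Matrix.mul_apply, Matrix.conjTranspose_apply]
      exact tendsto_finsetSum _ fun d _ => (tendsto_finsetSum _ fun c _ =>
        ((hcg c a).star).mul ((hMs y' c d).continuousAt)).mul (hcg d b)
    refine tendsto_nhds_unique_of_frequently_eq hcR (h3 a b) ?_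
    refine ((c.frequently_notMem y').and_eventually
      (h2.and ((hM y').and (((hO y').inter (hO y)).mem_nhds hy')))).mono ?_
    rintro x ⟨h4, h5, h6, h7⟩
    rw [← h5 h4, gramOf_transition (c.push H) (hg _ h7).1, h6 h4]
  have hbasis : ∀ y, (Matrix.of fun a b => H' y (β y a)
      (β y b)) = M y y := fun y => by
    ext a b
    exact hH' y a b
  have hcont : ∀ {e : Fin r → ∀ y, c.V.Fib y} {U : Set c.Y}, IsOpen U → c.V.IsHolFrame e U →
      ∀ y ∈ U, ∀ a b, ContMDiffAt 𝓘(ℝ, Fin n → ℂ) 𝓘(ℝ, ℂ) ∞ (fun x => gramOf c.V H' e x a b) y := by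
    intro e U hU he y hy a b
    obtain ⟨g, g', hg, hgs⟩ := (hf y).exists_transition (hO y) he hU
    have hyy : y ∈ O y ∩ U := ⟨hyO y, hy⟩
    have hgr : ∀ a b, ContMDiffAt 𝓘(ℝ, Fin n → ℂ) 𝓘(ℝ, ℂ) ∞ (fun x => g x a b) y := fun a b =>
      contMDiffAt_real (hgs _ hyy a b).1
    have hgr' : ∀ a b, ContMDiffAt 𝓘(ℝ, Fin n → ℂ) 𝓘(ℝ, ℂ) ∞ (fun x => star (g x a b)) y :=
      fun a b => Complex.conjCLE.contDiff.contMDiff.contMDiffAt.comp y (hgr a b)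
    have hev : (fun x => gramOf c.V H' e x a b) =ᶠ[𝓝 y]
        fun x => ((g x)ᴴ * M y x * g x) a b := by
      filter_upwards [hnear y, ((hO y).inter hU).mem_nhds hyy] with x h1 h2
      rw [gramOf_transition H' (hg _ h2).1, h1]
    refine ContMDiffAt.congr_of_eventuallyEq ?_ hev
    simp only [Matrix.mul_apply, Matrix.conjTranspose_apply]
    exact ContMDiffAt.sum fun d _ => contMDiffAt_complex_mul (ContMDiffAt.sum fun c _ =>
      contMDiffAt_complex_mul (hgr' c a) (hMs y c d)) (hgr d b)
  refine ⟨H', ⟨fun y _ s t => ?_, fun y _ s hs => ?_, fun U e hU he a b y hy => ?_⟩, ?_, ?_⟩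
  · refine sesq_hermitian (β y) _ ?_ s t
    rw [hbasis]
    exact (hMp y).1
  · refine sesq_pos (β y) _ ?_ hs
    rw [hbasis]
    exact hMp y
  · exact (hcont hU he y hy.1 a b).contMDiffWithinAt
  · intro γ y _ s t
    set B : c.V.Fib y →ₗ⋆[ℂ] c.V.Fib y →ₗ[ℂ] ℂ :=
      ((H' (γ • y)).comp (c.act γ y)).compl₂ (c.act γ y) with hB
    suffices B = H' y from LinearMap.congr_fun (LinearMap.congr_fun this s) t
    refine LinearMap.ext_basis (β y)
      (β y) fun a b => ?_
    rw [hβ, hβ]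
    set T := trivializationAt (Fin r → ℂ) c.V.Fib (γ • y) with hT
    have hyT : γ • y ∈ T.baseSet := FiberBundle.mem_baseSet_trivializationAt' _
    have hγc : ContinuousAt (fun x : c.Y => γ • x) y := (c.smul_hol γ).continuous.continuousAt
    set m : c.Y → Matrix (Fin r) (Fin r) ℂ := fun x => Matrix.of fun i j =>
      (T ⟨γ • x, c.act γ x (f y j x)⟩).2 i with hm
    have hmc : ∀ i j, ContinuousAt (fun x => m x i j) y := fun i j => by
      have h1 : ContinuousAt (fun x => (⟨γ • x, c.act γ x (f y j x)⟩ :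
          Bundle.TotalSpace (Fin r → ℂ) c.V.Fib)) y :=
        ContinuousAt.comp (f := fun x => Bundle.TotalSpace.mk' (Fin r → ℂ) x (f y j x))
          (c.act_hol γ).continuous.continuousAt
          ((hf y).contMDiffAt (hO y) (hyO y) j).continuousAt
      have h2 : ContinuousAt T (⟨γ • y, c.act γ y (f y j y)⟩ :
          Bundle.TotalSpace (Fin r → ℂ) c.V.Fib) :=
        T.continuousAt (T.mem_source.2 hyT)
      exact (continuous_apply i).continuousAt.comp
        (continuous_snd.continuousAt.comp (ContinuousAt.comp h2 h1))
    have hexp : ∀ᶠ x in 𝓝 y, (Matrix.of fun a b => H' (γ • x) (c.act γ x (f y a x))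
        (c.act γ x (f y b x))) =
        (m x)ᴴ * gramOf c.V H' (prefFrame c.V (γ • y)) (γ • x) * m x := by
      filter_upwards [hγc (T.open_baseSet.mem_nhds hyT)] with x hx
      exact sesq_transition _ fun b => sum_smul_prefFrame hx _
    have hgc : ∀ i j, ContinuousAt (fun x =>
        gramOf c.V H' (prefFrame c.V (γ • y)) (γ • x) i j) y := fun i j =>
      ContinuousAt.comp (f := fun x => γ • x) (hcont T.open_baseSet (isHolFrame_prefFrame c.V (γ • y)) _ hyT i j).continuousAt hγc
    have hL : ContinuousAt (fun x => ((m x)ᴴ * gramOf c.V H' (prefFrame c.V (γ • y)) (γ • x) * m x)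
        a b) y := by
      simp only [Matrix.mul_apply, Matrix.conjTranspose_apply]
      exact tendsto_finsetSum _ fun d _ => (tendsto_finsetSum _ fun c _ =>
        ((hmc c a).star).mul (hgc c d)).mul (hmc d b)
    have hR : ContinuousAt (fun x => gramOf c.V H' (f y) x a b) y :=
      (hcont (hO y) (hf y) y (hyO y) a b).continuousAt
    have key := tendsto_nhds_unique_of_frequently_eq hL hR (by
      refine ((c.frequently_notMem y).and_eventually hexp).mono ?_
      rintro x ⟨h1, h2⟩
      rw [← h2, Matrix.of_apply, gramOf_apply]
      classical
      have hq : c.q (γ • x) = c.q x := ((c.q_fibre x (γ • x)).2 ⟨γ, rfl⟩).symm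
      rw [hpush _ h1, hpush _ (by rwa [hq])]
      have hact : ∀ v : c.V.Fib x, ∃ σ : ∀ z, E.Fib z, v = c.θ x (σ (c.q x)) := fun v =>
        ⟨Function.update 0 (c.q x) ((c.θ x).symm v), by simp⟩
      obtain ⟨σ, hσ⟩ := hact (f y a x)
      obtain ⟨τ, hτ⟩ := hact (f y b x)
      rw [hσ, hτ, c.θ_equivariant γ x σ h1, c.θ_equivariant γ x τ h1, c.push_apply, c.push_apply]
      simp only [LinearEquiv.symm_apply_apply]
      rw [hq])
    have h3 := congrFun (congrFun hexp.self_of_nhds a) b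
    exact h3.trans key
  · intro y hy s t
    rw [hpush y hy.2, c.push_apply, LinearEquiv.symm_apply_apply, LinearEquiv.symm_apply_apply]

end Lift

/-! ## Parabolic Chern–Weil forms -/

section Parabolic

open scoped Matrix ComplexOrder
open MeasureTheory

variable {n r : ℕ} {X : Type u} [TopologicalSpace X] [ChartedSpace (Fin n → ℂ) X]

lemma eval_smul_of_isHomogeneous {ι : Type*} {Q : MvPolynomial ι ℂ} {d : ℕ} (hQ : Q.IsHomogeneous d)
    (c : ℂ) (v : ι → ℂ) : MvPolynomial.eval (c • v) Q = c ^ d * MvPolynomial.eval v Q := by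
  rw [MvPolynomial.eval_eq, MvPolynomial.eval_eq, Finset.mul_sum]
  refine Finset.sum_congr rfl fun m hm => ?_
  have hd : ∑ i ∈ m.support, m i = d := by
    have := hQ (MvPolynomial.mem_support_iff.1 hm)
    rw [← this, Finsupp.weight_apply, Finsupp.sum]
    simp
  simp only [Pi.smul_apply, smul_eq_mul, mul_pow, Finset.prod_mul_distrib,
    Finset.prod_pow_eq_pow_sum, hd]
  ring

lemma IsZariskiOpen.isOpen {U : Set X} (hU : IsZariskiOpen n U) : IsOpen U := by
  obtain ⟨N, ι, S, hι, hS, rfl⟩ := hU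
  rw [isOpen_iff_mem_nhds]
  rintro x ⟨Q, hQ, hx⟩
  obtain ⟨d, hd⟩ := hS Q hQ
  obtain ⟨U, f, hUo, hxU, hf, hfι, -⟩ := hι.2 x
  have key : ∀ x' ∈ U, (MvPolynomial.eval (ι x').rep Q ≠ 0 ↔ MvPolynomial.eval (f x') Q ≠ 0) := by
    intro x' hx'
    obtain ⟨h, hι'⟩ := hfι x' hx'
    obtain ⟨a, ha⟩ := Projectivization.exists_smul_eq_mk_rep ℂ (f x') h
    rw [hι', ← ha, Units.smul_def, eval_smul_of_isHomogeneous hd, mul_ne_zero_iff,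
      and_iff_right (pow_ne_zero _ a.ne_zero)]
  have hc : ContinuousAt (fun x' => MvPolynomial.eval (f x') Q) x :=
    (MvPolynomial.continuous_eval Q).continuousAt.comp
      ((hf x hxU).contMDiffAt (hUo.mem_nhds hxU)).continuousAt
  filter_upwards [hUo.mem_nhds hxU, hc.eventually_ne ((key x hxU).1 hx)] with x' h1 h2
  exact ⟨Q, hQ, (key x' h1).2 h2⟩

variable {E : HolBundle.{u, w} n r X} {D : Set X} {P : ParabolicStructure E D}

lemma KawamataCover.IsLift.mono {c : KawamataCover.{u, v, w} P} {U U' : Set X} {H : E.Sesq}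
    {H' : c.V.Sesq} (h : c.IsLift U H H') (hU : U' ⊆ U) : c.IsLift U' H H' :=
  ⟨⟨fun y hy => h.1.1 y (hU hy), fun y hy => h.1.2.1 y (hU hy), fun O e hO he i j =>
    (h.1.2.2 O e hO he i j).mono (Set.inter_subset_inter_right _ (Set.preimage_mono hU))⟩,
    fun g y hy => h.2.1 g y (hU hy), fun y hy => h.2.2 y ⟨hU hy.1, hy.2⟩⟩

variable [IsManifold 𝓘(ℂ, Fin n → ℂ) ω X] {Φ : MvPolynomial (Fin r × Fin r) ℂ} {k : ℕ}

/-- The Chern–Weil form of `H` is induced by every lift of `H` to a Kawamata cover. -/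
lemma KawamataCover.IsLift.inducesAt {c : KawamataCover.{u, v, w} P} (hDc : IsClosed D) {U : Set X}
    (hU : IsOpen U) {H : E.Sesq} (hH : E.IsHermitianMetricOn H Dᶜ) {H' : c.V.Sesq}
    (h : c.IsLift U H H') (hΦ : IsInvariantPolynomial Φ) {x : X} (hx : x ∈ U \ D) :
    c.InducesAt H' Φ (chernWeilForm E H Φ k) x := by
  rintro y rfl t
  have hW : IsOpen (c.q ⁻¹' U) := hU.preimage c.q_hol.continuous
  rw [chernWeil_eq hW h.1 Φ k hx.1]
  have hφ := isHolChart_of_mem_atlas (chart_mem_atlas (Fin n → ℂ) y)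
  set φ := chartAt (Fin n → ℂ) y with hφd
  have hys : y ∈ φ.source := mem_chart_source _ y
  have hsy : φ.symm (φ y) = y := φ.left_inv hys
  have hsymm := hφ.contMDiffAt_symm (φ.map_source hys)
  set ψ : (Fin n → ℂ) → X := fun t => c.q (φ.symm t) with hψ
  have hψh : ContMDiffAt 𝓘(ℂ, Fin n → ℂ) 𝓘(ℂ, Fin n → ℂ) ω ψ (φ y) :=
    (c.q_hol _).comp (φ y) hsymm
  have hψy : ψ (φ y) = c.q y := by rw [hψ]; exact congrArg c.q hsy
  set T := trivializationAt (Fin r → ℂ) E.Fib (c.q y) with hT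
  set S := trivializationAt (Fin r → ℂ) c.V.Fib y with hS
  have hyT : c.q y ∈ T.baseSet := FiberBundle.mem_baseSet_trivializationAt' _
  have hyS : y ∈ S.baseSet := FiberBundle.mem_baseSet_trivializationAt' _
  have he := isHolFrame_prefFrame E (c.q y)
  have hθ := c.isHolFrame_θ T.open_baseSet he
  have hO : IsOpen (c.q ⁻¹' (T.baseSet \ D)) :=
    (T.open_baseSet.sdiff hDc).preimage c.q_hol.continuous
  obtain ⟨g, g', hg, hgs⟩ := hθ.exists_transition hO (isHolFrame_prefFrame c.V y) S.open_baseSet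
  have hyy : y ∈ c.q ⁻¹' (T.baseSet \ D) ∩ S.baseSet := ⟨⟨hyT, hx.2⟩, hyS⟩
  have hpf : IsPullbackFrame E ψ (prefFrame E (c.q y)) (fun t => g (φ.symm t)) (φ y) := by
    refine ⟨hψh, ⟨T.baseSet, T.open_baseSet, by rwa [hψy], he⟩, fun i j => ?_, ?_⟩
    · refine contMDiffAt_iff_contDiffAt.1
        (ContMDiffAt.comp (g := fun x => g x i j) (φ y) ?_ hsymm)
      rw [hsy]
      exact (hgs y hyy i j).1
    · rw [hsy]
      exact ⟨⟨g y, g' y, (hg y hyy).2.2.1, (hg y hyy).2.2.2⟩, rfl⟩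
  have hcs : Filter.Tendsto φ.symm (𝓝 (φ y)) (𝓝 y) := by
    have := hsymm.continuousAt
    rwa [ContinuousAt, hsy] at this
  have hh : ∀ᶠ t in 𝓝 (φ y), c.V.gram H' y t = (g (φ.symm t))ᴴ *
      gramOf E H (prefFrame E (c.q y)) (ψ t) * g (φ.symm t) := by
    filter_upwards [hcs ((hO.inter S.open_baseSet).mem_nhds hyy), hcs (hW.mem_nhds hx.1)]
      with t h1 h2
    rw [gram_eq, gramOf_transition H' (e := fun j y' => c.θ y' (prefFrame E (c.q y) j (c.q y')))
      (hg _ h1).1]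
    congr 2
    ext a b
    exact h.2.2 _ ⟨h2, h1.1.2⟩ _ _
  have hpb := pb_chernWeilForm hΦ k hDc.isOpen_compl hH hpf (by rw [hψy]; exact hx.2) hh
  have hd : mfderiv 𝓘(ℝ, Fin n → ℂ) 𝓘(ℝ, Fin n → ℂ) c.q y =
      (mfderiv 𝓘(ℝ, Fin n → ℂ) 𝓘(ℝ, Fin n → ℂ) ψ (φ y)).comp
        (mfderiv 𝓘(ℝ, Fin n → ℂ) 𝓘(ℝ, Fin n → ℂ) φ y) := by
    have h1 : c.q =ᶠ[𝓝 y] ψ ∘ φ := by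
      filter_upwards [φ.open_source.mem_nhds hys] with y' hy'
      exact congrArg c.q (φ.left_inv hy').symm
    rw [h1.mfderiv_eq]
    exact mfderiv_comp y ((contMDiffAt_real hψh).mdifferentiableAt (by simp))
      (hφ.mdifferentiableAt hys)
  have hη : ∀ {x x' : X}, x = x' → ∀ v : Fin (2 * k) → Fin n → ℂ,
      chernWeilForm E H Φ k x v = chernWeilForm E H Φ k x' v := by
    rintro x _ rfl v
    rfl
  have h2 := congrArg (fun F : (Fin n → ℂ) [⋀^Fin (2 * k)]→L[ℝ] ℂ => F fun i =>
    mfderiv 𝓘(ℝ, Fin n → ℂ) 𝓘(ℝ, Fin n → ℂ) φ y (t i)) hpb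
  refine (hη hψy.symm _).trans (Eq.trans ?_ h2)
  rw [hd]
  rfl

lemma isSmoothFormOn_chernWeilForm (hDc : IsClosed D) {H : E.Sesq}
    (hH : E.IsHermitianMetricOn H Dᶜ) (hΦ : IsInvariantPolynomial Φ) (k : ℕ) :
    IsSmoothFormOn (chernWeilForm E H Φ k) Dᶜ := by
  rintro φ hφ t ⟨ht, htD⟩
  have hφh := isHolChart_of_mem_atlas hφ
  rw [localRep_eq_pb]
  set T := trivializationAt (Fin r → ℂ) E.Fib (φ.symm t) with hT
  have htT : φ.symm t ∈ T.baseSet := FiberBundle.mem_baseSet_trivializationAt' _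
  have he := isHolFrame_prefFrame E (φ.symm t)
  have hs := hφh.contMDiffAt_symm ht
  refine ContDiffAt.contDiffWithinAt ?_
  refine (contDiffAt_gramForm Φ k (isGramAt_comp hDc.isOpen_compl hH T.open_baseSet he
    (contMDiffAt_real hs) htT htD)).congr_of_eventuallyEq ?_
  filter_upwards [φ.open_target.mem_nhds ht, hs.continuousAt
    ((T.open_baseSet.inter hDc.isOpen_compl).mem_nhds ⟨htT, htD⟩)] with x h1 h2
  refine pb_chernWeilForm (g := fun _ => 1) hΦ k hDc.isOpen_compl hH
    ⟨hφh.contMDiffAt_symm h1, ⟨T.baseSet, T.open_baseSet, h2.1, he⟩, fun i j => contDiffAt_const,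
      isUnit_one⟩ h2.2 (Filter.Eventually.of_forall fun x => by simp)

/-- Parabolic Chern–Weil forms agree with the Chern–Weil form of the metric. -/
lemma IsParabolicChernWeilForm.eq (hDc : IsClosed D) {H : E.Sesq} (hH : E.IsHermitianMetricOn H Dᶜ)
    (hΦ : IsInvariantPolynomial Φ) {η : DForm n (2 * k) X}
    (hη : IsParabolicChernWeilForm.{u, v, w} P H Φ η) {x : X} (hx : x ∉ D) :
    η x = chernWeilForm E H Φ k x := by
  obtain ⟨c, U, H', ⟨hU, hxU, hbr⟩, hlift, hind⟩ := hη x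
  have h1 := hind hx
  have h2 := hlift.inducesAt hDc hU.isOpen hH hΦ (k := k) ⟨hxU, hx⟩
  obtain ⟨y, rfl⟩ := c.q_surj x
  have hbij : Function.Bijective (mfderiv 𝓘(ℝ, Fin n → ℂ) 𝓘(ℝ, Fin n → ℂ) c.q y) := by
    by_contra hb
    have h3 : c.q y ∈ c.branch ∩ U := ⟨⟨y, hb, rfl⟩, hxU⟩
    rw [hbr] at h3
    exact hx h3.1
  refine ContinuousAlternatingMap.ext fun v => ?_
  choose s hs using fun i => hbij.2 (v i)
  obtain rfl : (fun i => mfderiv 𝓘(ℝ, Fin n → ℂ) 𝓘(ℝ, Fin n → ℂ) c.q y (s i)) = v := funext hs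
  exact (h1 y rfl s).trans (h2 y rfl s).symm

lemma IsSmoothDivisor.exists_null_chart (hD : IsSmoothDivisor n D) (p : X) :
    ∃ z : OpenPartialHomeomorph X (Fin n → ℂ), p ∈ z.source ∧ IsHolChart z ∧
      volume {t | t ∈ z.target ∧ z.symm t ∈ D} = 0 := by
  by_cases hp : p ∈ D
  · obtain ⟨z, i, hpz, hz⟩ := hD.2 p hp
    refine ⟨z, hpz, hz.1, measure_mono_null (fun t ht => ?_) (volume_coordinate_hyperplane i)⟩
    have := (hz.2 _ (z.map_target ht.1)).1 ht.2
    rwa [z.right_inv ht.1] at this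
  · have hV : IsOpen Dᶜ := hD.1.isOpen_compl
    refine ⟨(chartAt (Fin n → ℂ) p).restr Dᶜ, ?_,
      restr_mem_maximalAtlas _ (isHolChart_of_mem_atlas (chart_mem_atlas _ p)) hV, ?_⟩
    · rw [OpenPartialHomeomorph.restr_source, hV.interior_eq]
      exact ⟨mem_chart_source _ p, hp⟩
    · refine measure_mono_null (t := ∅) (fun t ht => ?_) measure_empty
      have := ((chartAt (Fin n → ℂ) p).restr Dᶜ).map_target ht.1
      rw [OpenPartialHomeomorph.restr_source, hV.interior_eq] at this
      exact this.2 ht.2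

variable [T2Space X] [CompactSpace X]

theorem IsParabolicChernWeilForm.exists_current (hDc : IsClosed D) {H : E.Sesq}
    (hH : IsAdmissible P H) (hΦ : IsInvariantPolynomial Φ) {η : DForm n (2 * k) X}
    (hη : IsParabolicChernWeilForm.{u, v, w} P H Φ η) {a : ℕ} (hab : a + 2 * k = 2 * n) :
    ∃ T : Current n a X, T.IsRepresentedBy η ∧ T.IsClosed := by
  have key : ∀ p, ∃ z Q N g, p ∈ z.source ∧ IsOrbChart D z Q N ∧ IsOrbExt D z Q η g ∧
      ∀ t, Q t ∈ z.target → extDeriv g t = 0 := by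
    intro p
    obtain ⟨z, Q, N, e, g, h, -, hpz, hz, hf, hh, -⟩ := exists_orbGram hDc hH hH p
    exact ⟨z, Q, N, _, hpz, hz, (hh.isOrbExt_chernWeilForm hDc hH.1 hΦ k hf).congr
      fun x hx => hη.eq hDc hH.1 hΦ hx, fun t ht => extDeriv_gramForm hΦ k (hh t ht).1⟩
  obtain ⟨T, hT⟩ := exists_current_of_orbExt hab fun p => by
    obtain ⟨z, Q, N, g, h1, h2, h3, -⟩ := key p
    exact ⟨z, Q, N, g, h1, h2, h3⟩
  exact ⟨T, hT, Current.isClosed_of_orbExt hT key⟩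

theorem IsParabolicChernWeilForm.cohomologous (hD : IsSmoothDivisor n D) {H₁ H₂ : E.Sesq}
    (hH₁ : IsAdmissible P H₁) (hH₂ : IsAdmissible P H₂) (hΦ : IsInvariantPolynomial Φ)
    {η₁ η₂ : DForm n (2 * k) X} (hη₁ : IsParabolicChernWeilForm.{u, v, w} P H₁ Φ η₁)
    (hη₂ : IsParabolicChernWeilForm.{u, v', w} P H₂ Φ η₂) {a : ℕ} {T₁ T₂ : Current n a X}
    (h₁ : T₁.IsRepresentedBy η₁) (h₂ : T₂.IsRepresentedBy η₂) : T₁.Cohomologous T₂ := by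
  have e₁ := fun x (hx : x ∉ D) => hη₁.eq hD.1 hH₁.1 hΦ hx
  have e₂ := fun x (hx : x ∉ D) => hη₂.eq hD.1 hH₂.1 hΦ hx
  cases k with
  | zero =>
    have h : ∀ f, IsSmoothForm f → T₁.toFun f = T₂.toFun f := fun f hf =>
      Current.eq_of_agree hD.exists_null_chart h₁ h₂ (fun x hx => by
        rw [e₁ x hx, e₂ x hx, chernWeilForm, chernWeilForm]
        rw [gramForm_zero_eq]) hf
    refine ⟨⟨fun _ => 0, fun _ _ _ _ => (add_zero 0).symm, fun _ _ _ => (mul_zero _).symm,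
      fun _ _ _ => tendsto_const_nhds⟩, fun f hf => ?_⟩
    rw [h f hf, sub_self, mul_zero]
  | succ k =>
    have key : ∀ p, ∃ z Q N g₁ g₂ g, p ∈ z.source ∧ IsOrbChart D z Q N ∧ IsOrbExt D z Q η₁ g₁ ∧
        IsOrbExt D z Q η₂ g₂ ∧ IsOrbExt D z Q (transgressionForm E H₂ H₁ Φ k) g ∧
        ∀ t, Q t ∈ z.target → extDeriv g t = g₁ t - g₂ t := by
      intro p
      obtain ⟨z, Q, N, e, g, a₁, a₂, hpz, hz, hf, hh₁, hh₂⟩ := exists_orbGram hD.1 hH₁ hH₂ p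
      exact ⟨z, Q, N, _, _, _, hpz, hz,
        (hh₁.isOrbExt_chernWeilForm hD.1 hH₁.1 hΦ (k + 1) hf).congr e₁,
        (hh₂.isOrbExt_chernWeilForm hD.1 hH₂.1 hΦ (k + 1) hf).congr e₂,
        hh₂.isOrbExt_transgressionForm hD.1 hz hH₂.1 hH₁.1 hΦ k hf hh₁, fun t ht =>
        extDeriv_gramTransgression hΦ k hz.isOpen (fun t ht => (hh₂ t ht).1)
          (fun t ht => (hh₁ t ht).1) ht⟩
    have hab : a + 1 + (2 * k + 1) = 2 * n := by
      have := h₁.1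
      omega
    obtain ⟨S, hS⟩ := exists_current_of_orbExt hab (η := transgressionForm E H₂ H₁ Φ k) (D := D)
      fun p => by
        obtain ⟨z, Q, N, -, -, g, h1, h2, -, -, h3, -⟩ := key p
        exact ⟨z, Q, N, g, h1, h2, h3⟩
    exact ⟨S, fun f hf => Current.stokes (b := 2 * k + 1) h₁ h₂ hS key hf⟩

end Parabolic

end ParChernWeil

end

theorem mainTheorem8 {n r : ℕ} {X : Type u} [TopologicalSpace X] [T2Space X]
    [CompactSpace X] [ConnectedSpace X] [ChartedSpace (Fin n → ℂ) X]
    [IsManifold 𝓘(ℂ, Fin n → ℂ) ω X] (hX : IsProjectiveManifold n X)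
    (D : Set X) (hD : IsSmoothDivisor n D)
    (E : HolBundle.{u, w} n r X) (P : ParabolicStructure E D)
    (Φ : MvPolynomial (Fin r × Fin r) ℂ) (hΦ : IsInvariantPolynomial Φ) (k : ℕ) :
    -- for a fixed admissible metric `H`:
    (∀ H : E.Sesq, IsAdmissible P H →
      -- there is one form, smooth off `D`, that is induced by all locally good Kawamata covers
      (∃ η : DForm n (2 * k) X, IsSmoothFormOn η Dᶜ ∧
        ∀ (c : KawamataCover.{u, v, w} P) (p : X) (U : Set X), c.IsLocallyGood p U →
          (∃ H' : c.V.Sesq, c.IsLift U H H') ∧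
          ∀ H' : c.V.Sesq, c.IsLift U H H' → ∀ x ∈ U \ D, c.InducesAt H' Φ η x) ∧
      -- each choice of covers gives a closed current
      (∀ η : DForm n (2 * k) X, IsParabolicChernWeilForm.{u, v, w} P H Φ η →
        ∀ a : ℕ, a + 2 * k = 2 * n →
          ∃ T : Current n a X, T.IsRepresentedBy η ∧ T.IsClosed) ∧
      -- two choices of covers give the same form off `D` and the same current
      (∀ η₁ η₂ : DForm n (2 * k) X, IsParabolicChernWeilForm.{u, v, w} P H Φ η₁ →
        IsParabolicChernWeilForm.{u, v', w} P H Φ η₂ →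
          (∀ x, x ∉ D → η₁ x = η₂ x) ∧
          ∀ (a : ℕ) (T₁ T₂ : Current n a X), T₁.IsRepresentedBy η₁ → T₂.IsRepresentedBy η₂ →
            ∀ f, IsSmoothForm f → T₁.toFun f = T₂.toFun f)) ∧
    -- the cohomology class does not depend on the admissible metric
    (∀ H₁ H₂ : E.Sesq, IsAdmissible P H₁ → IsAdmissible P H₂ →
      ∀ η₁ η₂ : DForm n (2 * k) X, IsParabolicChernWeilForm.{u, v, w} P H₁ Φ η₁ →
        IsParabolicChernWeilForm.{u, v', w} P H₂ Φ η₂ →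
          ∀ (a : ℕ) (T₁ T₂ : Current n a X), T₁.IsRepresentedBy η₁ → T₂.IsRepresentedBy η₂ →
            T₁.Cohomologous T₂) := by
  refine ⟨fun H hH => ⟨⟨chernWeilForm E H Φ k, isSmoothFormOn_chernWeilForm hD.1 hH.1 hΦ k,
    fun c p U hU => ⟨?_, fun H' hH' x hx => hH'.inducesAt hD.1 hU.1.isOpen hH.1 hΦ hx⟩⟩,
    fun η hη a hab => hη.exists_current hD.1 hH hΦ hab, fun η₁ η₂ hη₁ hη₂ => ?_⟩,
    fun H₁ H₂ hH₁ hH₂ η₁ η₂ hη₁ hη₂ a T₁ T₂ h₁ h₂ =>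
      hη₁.cohomologous hD hH₁ hH₂ hΦ hη₂ h₁ h₂⟩
  · obtain ⟨H', hH'⟩ := c.exists_lift hD.1 hH
    exact ⟨H', hH'.mono (Set.subset_univ U)⟩
  · have h : ∀ x, x ∉ D → η₁ x = η₂ x := fun x hx =>
      (hη₁.eq hD.1 hH.1 hΦ hx).trans (hη₂.eq hD.1 hH.1 hΦ hx).symm
    exact ⟨h, fun a T₁ T₂ h₁ h₂ f hf => Current.eq_of_agree hD.exists_null_chart h₁ h₂ h hf⟩
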